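/- **Conventions.** For a finite sequence $\mathbf a=(a_1,\dots,a_n)$ of non-negative integers put $a_k:=0$ for $k>n$, and $$\operatorname{O}(\mathbf a)=\sum_{i\text{ odd}}a_i,\qquad \operatorname{E}(\mathbf a)=\sum_{i\text{ even}}a_i,\qquad \mathbf s_k(\mathbf a)=\sum_{i=1}^k a_i .$$ Let $(u)_m=u(u+1)\cdots(u+m-1)$, $\operatorname{H}(m)=0!\,1!\cdots(m-1)!$, and let $\operatorname{H}_2(m)=0!\,2!\,4!\cdots(m-2)!$ for even $m$, $\operatorname{H}_2(m)=1!\,3!\,5!\cdots(m-2)!$ for odd $m$. Empty products are $1$. Consider the triangular lattice with horizontal lattice lines. A lozenge is the union of two unit triangles sharing an edge; it is vertical if that edge is horizontal. A tiling of a region is a set of lozenges covering it without gaps or overlaps. In all regions below the western side is a vertical zigzag lattice path; each of its full steps (bumps) consists of two unit edges and bulges to the west. Every vertical lozenge along the western side (i.e. lying in a bump) has weight $\tfrac12$, all other lozenges have weight $1$; the weight of a tiling is the product of the weights of its lozenges, and $\operatorname{M}(\mathcal R)$ is the sum of the weights of all tilings of $\mathcal R$ (so the empty region has $\operatorname{M}=1$).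 *The numbers $\operatorname{Q}'(\mathbf t)$ and $\operatorname{K}'(\mathbf t)$.* Let $\mathbf t=(t_1,\dots,t_{2l})$ be non-negative integers. Take the trapezoid with northern, northeastern and southern sides of lengths $\operatorname{O}(\mathbf t)$, $2\operatorname{E}(\mathbf t)$, $\operatorname{E}(\mathbf t)+\operatorname{O}(\mathbf t)$, whose western side is a zigzag with $\operatorname{E}(\mathbf t)$ steps, and remove from its base, from left to right, up-pointing triangles of sides $t_2,t_4,\dots,t_{2l}$, the first at distance $t_1$ from the left end of the base and consecutive ones at distances $t_3,t_5,\dots,t_{2l-1}$. $\operatorname{Q}'(\mathbf t)$ is the weighted tiling number of the resulting region. $\operatorname{K}'(\mathbf t)$ is defined in the same way from the trapezoid with sides $\operatorname{O}(\mathbf t)$, $2\operatorname{E}(\mathbf t)-1$, $\operatorname{E}(\mathbf t)+\operatorname{O}(\mathbf t)$, whose western side is a zigzag with $\operatorname{E}(\mathbf t)-\tfrac12$ steps ($\operatorname{E}(\mathbf t)-1$ bumps and, at the bottom, the upper half of one); the region is empty if $\operatorname{E}(\mathbf t)=0$. For the empty sequence both numbers are $1$. *The region $\mathcal R'_{x,y,z}(\mathbf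 a)$.* Take the halved hexagon whose northern, northeastern, southeastern and southern sides have lengths $x+\operatorname{E}(\mathbf a)$, $y+z+2\operatorname{O}(\mathbf a)-1$, $y+z+2\operatorname{E}(\mathbf a)-1$, $x+\operatorname{O}(\mathbf a)$, and whose western side is a zigzag with $y+z+\mathbf s_n(\mathbf a)-1$ steps. On the horizontal lattice line $z$ levels above its rightmost vertex place, from right to left and starting at the northeastern side, contiguous triangles of sides $a_1,a_2,\dots,a_n$, each with one side on that line, those of odd index up-pointing (above the line), those of even index down-pointing (below the line). $\mathcal R'_{x,y,z}(\mathbf a)$ is the halved hexagon with these triangles removed. (In the one degenerate case $y=z=0$, $n=1$, where the southeastern side would have length $-1$, it is the trapezoid with northern side $x$, northeastern side $2a_1-2$, southern side $x+a_1-1$ and a western zigzag with $a_1-1$ steps, from which the up-pointing triangle of side $a_1-1$ at the right end of its base is removed.) **Theorem.** Let $x,y,z$ be non-negative integers and $\mathbf a=(a_1,\dots,a_n)$ a (possibly empty) sequence of positive integers with $y+2\operatorname{O}(\mathbf a)\ge a_1+1$. Then for odd $y$ $$\begin{aligned}\operatorname{M}(\mathcal R'_{x,y,z}(\mathbf a))={}&\prod_{i=1}^{\frac{y-1}{2}}(2x+2i-1)_{2\mathbf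 s_n(\mathbf a)+2y+2z-4i+1}\\ &\times\frac1{2^{y-1}}\,\frac{\operatorname{H}(\mathbf s_n(\mathbf a)+y+z-1)\operatorname{H}_2(y)\operatorname{H}_2(2\operatorname{E}(\mathbf a)+2z+1)\operatorname{H}_2(2\operatorname{O}(\mathbf a)+1)\operatorname{H}_2(2\mathbf s_n(\mathbf a)+y+2z)}{\operatorname{H}(\mathbf s_n(\mathbf a)+z)\operatorname{H}_2(2\operatorname{E}(\mathbf a)+y+2z)\operatorname{H}_2(2\operatorname{O}(\mathbf a)+y)\operatorname{H}_2(2\mathbf s_n(\mathbf a)+2y+2z-1)}\\ &\times\operatorname{Q}'\!\left(x+\tfrac{y-1}2+a_{2\lfloor\frac{n+1}2\rfloor},a_{2\lfloor\frac{n+1}2\rfloor-1},\dots,a_1\right)\operatorname{Q}'\!\left(x+\tfrac{y-1}2+a_{2\lfloor\frac n2\rfloor+1},a_{2\lfloor\frac n2\rfloor},\dots,a_1,z\right),\end{aligned}$$ and for even $y$ $$\begin{aligned}\operatorname{M}(\mathcal R'_{x,y,z}(\mathbf a))={}&\prod_{i=1}^{\frac{y}{2}}(2x+2i-1)_{2\mathbf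 s_n(\mathbf a)+2y+2z-4i+1}\\ &\times\frac{\operatorname{H}(\mathbf s_n(\mathbf a)+y+z)\operatorname{H}_2(y)\operatorname{H}_2(2\operatorname{E}(\mathbf a)+2z)\operatorname{H}_2(2\operatorname{O}(\mathbf a))\operatorname{H}_2(2\mathbf s_n(\mathbf a)+y+2z)}{\operatorname{H}(\mathbf s_n(\mathbf a)+z)\operatorname{H}_2(2\operatorname{E}(\mathbf a)+y+2z)\operatorname{H}_2(2\operatorname{O}(\mathbf a)+y)\operatorname{H}_2(2\mathbf s_n(\mathbf a)+2y+2z)}\\ &\times\operatorname{K}'\!\left(x+\tfrac y2+a_{2\lfloor\frac{n+1}2\rfloor},a_{2\lfloor\frac{n+1}2\rfloor-1},\dots,a_1\right)\operatorname{K}'\!\left(x+\tfrac y2+a_{2\lfloor\frac n2\rfloor+1},a_{2\lfloor\frac n2\rfloor},\dots,a_1,z\right).\end{aligned}$$ For $n=0$ the argument of the first factor $\operatorname{Q}'$, respectively $\operatorname{K}'$, is the empty sequence. -/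

import Mathlib

open scoped Nat

/-! ### Sequences -/

/-- The entry `a_k` of `a = (a_1, …, a_n)`, for `k ≥ 1`, with `a_k = 0` for `k > n`. -/
def seqTerm (a : List ℕ) (k : ℕ) : ℕ := a.getD (k - 1) 0

/-- `s_k(a) = a_1 + ⋯ + a_k`. -/
def partialSum (a : List ℕ) (k : ℕ) : ℕ := ∑ i ∈ Finset.Icc 1 k, seqTerm a i

/-- `O(a)`, the sum of the entries of odd index. -/
def oddSum (a : List ℕ) : ℕ := ∑ i ∈ Finset.Icc 1 a.length with Odd i, seqTerm a i

/-- `E(a)`, the sum of the entries of even index. -/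
def evenSum (a : List ℕ) : ℕ := ∑ i ∈ Finset.Icc 1 a.length with Even i, seqTerm a i

/-- The sequence `(a_m, a_{m-1}, …, a_1)`. -/
def descending (a : List ℕ) (m : ℕ) : List ℕ :=
  ((List.range m).map fun i => seqTerm a (i + 1)).reverse

/-- The sequence `(w + a_m, a_{m-1}, …, a_1)` with `m = 2⌊(n+1)/2⌋`; it is empty for `n = 0`. -/
def upperSeq (w : ℕ) (a : List ℕ) : List ℕ :=
  (descending a (2 * ((a.length + 1) / 2))).modifyHead (w + ·)

/-- The sequence `(w + a_m, a_{m-1}, …, a_1, z)` with `m = 2⌊n/2⌋ + 1`. -/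
def lowerSeq (w z : ℕ) (a : List ℕ) : List ℕ :=
  (descending a (2 * (a.length / 2) + 1)).modifyHead (w + ·) ++ [z]

/-! ### Hyperfactorials -/

/-- `H(n) = 0! 1! ⋯ (n-1)!`. -/
def hyperFac (n : ℕ) : ℕ := ∏ i ∈ Finset.range n, i !

/-- `H₂(n) = 0! 2! 4! ⋯ (n-2)!` for even `n`, and `1! 3! 5! ⋯ (n-2)!` for odd `n`. -/
def hyperFac₂ (n : ℕ) : ℕ := ∏ i ∈ Finset.range (n / 2), (2 * i + n % 2)!

/-! ### The triangular lattice, lozenges, weighted tilings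

The lattice has horizontal lattice lines, the *levels* `j ∈ ℤ`, numbered upwards. Horizontal
distances are measured in half side-lengths, so the lattice points are the pairs `(X, j)` with
`X + j` even. *Row* `j` is the strip between the levels `j` and `j + 1`. -/

/-- A unit triangle, given by the horizontal coordinate of its centre and by its row.
The triangle `(X, j)` with `X + j` odd is up-pointing, with vertices the lattice points
`(X - 1, j)`, `(X + 1, j)`, `(X, j + 1)`; the one with `X + j` even is down-pointing, with
vertices `(X, j)`, `(X - 1, j + 1)`, `(X + 1, j + 1)`. -/
abbrev UnitTriangle : Type := ℤ × ℤ

/-- The triangle is up-pointing. -/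
def IsUp (u : UnitTriangle) : Prop := Odd (u.1 + u.2)

instance : DecidablePred IsUp := fun u => inferInstanceAs (Decidable (Odd (u.1 + u.2)))

/-- A lozenge: an up-pointing unit triangle together with one of the three (down-pointing) unit
triangles sharing its left, right or horizontal edge. -/
def IsLozenge (l : Finset UnitTriangle) : Prop :=
  ∃ u ∈ l, IsUp u ∧ (l = {u, (u.1 - 1, u.2)} ∨ l = {u, (u.1 + 1, u.2)} ∨ l = {u, (u.1, u.2 - 1)})

instance : DecidablePred IsLozenge := fun l => by unfold IsLozenge; infer_instance

/-- The lozenges contained in a region. -/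
def lozengesIn (R : Finset UnitTriangle) : Finset (Finset UnitTriangle) :=
  {l ∈ R.powerset | IsLozenge l}

/-- The lozenge tilings of a region: sets of lozenges contained in the region that cover every
unit triangle of the region exactly once. -/
def tilings (R : Finset UnitTriangle) : Finset (Finset (Finset UnitTriangle)) :=
  {T ∈ (lozengesIn R).powerset | ∀ t ∈ R, {l ∈ T | t ∈ l}.card = 1}

/-- A vertical lozenge (two unit triangles sharing a horizontal edge) centred on the vertical
line `X = 0`. In all regions below the western side is the zigzag through the points `(0, j)`,
`j` even, and `(-1, j)`, `j` odd, so these are the vertical lozenges along the western side. -/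
def IsWesternVertical (l : Finset UnitTriangle) : Prop :=
  ∃ u ∈ l, IsUp u ∧ u.1 = 0 ∧ l = {u, (u.1, u.2 - 1)}

instance : DecidablePred IsWesternVertical := fun l => by unfold IsWesternVertical; infer_instance

/-- The weight of a lozenge: `1/2` for the vertical lozenges along the western side, `1` for all
others. -/
def lozengeWeight (l : Finset UnitTriangle) : ℚ := if IsWesternVertical l then 1 / 2 else 1

/-- The weighted tiling number: the sum over all tilings of the product of the weights of the
lozenges. -/
def weightedTilingNumber (R : Finset UnitTriangle) : ℚ :=
  ∑ T ∈ tilings R, ∏ l ∈ T, lozengeWeight l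

/-! ### The regions -/

/-- `t` lies in the up-pointing triangle whose base goes from `(l, L)` to `(r, L)`. -/
def InUpTriangle (l r L : ℤ) (t : UnitTriangle) : Prop :=
  L ≤ t.2 ∧ l < t.1 - (t.2 - L) ∧ t.1 + (t.2 - L) < r

instance (l r L : ℤ) : DecidablePred (InUpTriangle l r L) := fun t => by
  unfold InUpTriangle; infer_instance

/-- `t` lies in the down-pointing triangle whose horizontal side goes from `(l, L)` to
`(r, L)`. -/
def InDownTriangle (l r L : ℤ) (t : UnitTriangle) : Prop :=
  t.2 < L ∧ l < t.1 - (L - 1 - t.2) ∧ t.1 + (L - 1 - t.2) < r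

instance (l r L : ℤ) : DecidablePred (InDownTriangle l r L) := fun t => by
  unfold InDownTriangle; infer_instance

/-- The trapezoid with dents, with base on level `b`, where `b` is `0` or `1`. The trapezoid has
northern, northeastern and southern sides of lengths `O(t)`, `2E(t) - b`, `E(t) + O(t)`; its base
goes from `(-b, b)` to `(-b + 2(E(t) + O(t)), b)`, its northern side from `(0, 2E(t))` to
`(2O(t), 2E(t))`, and its western side is the vertical zigzag between `(0, 2E(t))` and `(-b, b)`.
Up-pointing triangles of sides `t_2, t_4, …` are removed along the base, from left to right, where
`t_1` is the distance of the first one from the left end of the base and `t_3, t_5, …` are the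
distances between consecutive ones. -/
noncomputable def dentedTrapezoid (b : ℤ) (t : List ℕ) : Finset UnitTriangle :=
  {c ∈ Finset.Ico (0 : ℤ) (2 * (evenSum t + oddSum t)) ×ˢ Finset.Ico b (2 * evenSum t) |
    c.1 + c.2 < 2 * (evenSum t + oddSum t) ∧
    ¬ ∃ k ∈ Finset.Icc 1 t.length, Even k ∧
      InUpTriangle (-b + 2 * partialSum t (k - 1)) (-b + 2 * partialSum t k) b c}

/-- The region `𝒬(t)`: northeastern side `2E(t)`, western side a zigzag with `E(t)` steps. -/
noncomputable def QRegion (t : List ℕ) : Finset UnitTriangle := dentedTrapezoid 0 t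

/-- The region `𝒦(t)`: northeastern side `2E(t) - 1`, western side a zigzag with `E(t) - 1/2`
steps (empty if `E(t) = 0`). -/
noncomputable def KRegion (t : List ℕ) : Finset UnitTriangle := dentedTrapezoid 1 t

/-- `Q'(t)`. -/
noncomputable def QWeighted (t : List ℕ) : ℚ := weightedTilingNumber (QRegion t)

/-- `K'(t)`. -/
noncomputable def KWeighted (t : List ℕ) : ℚ := weightedTilingNumber (KRegion t)

/-- The halved hexagon with southern side of length `s` from `(0, 0)` to `(2s, 0)`, southeastern
side of length `e`, western side a vertical zigzag with `w` steps (two rows each) from `(0, 0)` to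
`(0, 2w)`; hence the northeastern side has length `2w - e` and the northern side `s + e - w`. -/
noncomputable def halvedHexagon (s e w : ℤ) : Finset UnitTriangle :=
  {c ∈ Finset.Ico (0 : ℤ) (2 * s + 2 * e) ×ˢ Finset.Ico (0 : ℤ) (2 * w) |
    c.1 - c.2 ≤ 2 * s ∧ c.1 + c.2 < 2 * s + 2 * e}

/-- `t` lies in the array of alternating triangles of sides `a_1, a_2, …, a_n`, placed from right
to left along level `L` with right end `(r, L)`; those of odd index are up-pointing (above the
level), those of even index are down-pointing (below it). -/
def InTriangleArray (a : List ℕ) (r L : ℤ) (t : UnitTriangle) : Prop :=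
  ∃ k ∈ Finset.Icc 1 a.length,
    (Odd k ∧ InUpTriangle (r - 2 * partialSum a k) (r - 2 * partialSum a (k - 1)) L t) ∨
    (Even k ∧ InDownTriangle (r - 2 * partialSum a k) (r - 2 * partialSum a (k - 1)) L t)

instance (a : List ℕ) (r L : ℤ) : DecidablePred (InTriangleArray a r L) := fun t => by
  unfold InTriangleArray; infer_instance

/-- The region `ℛ_{x,y,z}(a)`: the halved hexagon with northern, northeastern, southeastern and
southern sides `x + E(a)`, `y + z + 2O(a) - 1`, `y + z + 2E(a) - 1`, `x + O(a)` and a western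
zigzag with `y + z + E(a) + O(a) - 1` steps, from which the array of alternating triangles of
sides `a_1, …, a_n` (from right to left) is removed, starting at the point of the northeastern
side that is `z` levels above the rightmost vertex of the halved hexagon. -/
noncomputable def RRegion (x y z : ℕ) (a : List ℕ) : Finset UnitTriangle :=
  let s : ℤ := x + oddSum a
  let e : ℤ := y + z + 2 * evenSum a - 1
  let w : ℤ := y + z + evenSum a + oddSum a - 1
  {c ∈ halvedHexagon s e w | ¬ InTriangleArray a (2 * s + e - z) (e + z) c}

/-! ### Tilings: expansion at a cell -/

/-! The level carrying the triangles cuts the region in two. To the left of the triangles exactly k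
= ⌊y/2⌋ vertical lozenges cross that level; once the set S of their columns is fixed, the parts
above and below are tiled independently, and the lower part is reflected
(`weightedTilingNumber_split`, `weightedTilingNumber_RRegion`). A triangle removed along a base has
the same effect as removing only the up-pointing unit triangles of its lowest row, because the rest
of it is then tiled in a forced way (`weightedTilingNumber_fill`). The corner of side z that the
lower part lacks on its right acts as one more such triangle. Hence both parts are trapezoids with
unit dents, in the columns S ∪ A above and S ∪ B below, where A comes from the up-pointing and B
from the down-pointing triangles. The regions of Q' and K' are trapezoids of the same kind, with
dents A or B alone.

Such a trapezoid has a product formula. Removing its lowest row replaces the dents by an interlacing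
set. Inductively the tiling number is a determinant of central factorials, whose sum over an
interlacing gap telescopes; the weight 1/2 in column 0 is exactly what cancels the boundary term at
the zigzag (`sum_interlacing_weighted`). Column operations turn the determinant into ∏ (v² - u²)
over pairs of dents u < v, with an additional factor ∏ u if the height is even
(`weightedTilingNumber_even_height`, `weightedTilingNumber_odd_height`).

In the product of the two halves the Vandermonde products of A and of B split off; up to constants
they are the two factors Q' or K'. What remains is a sum over S of the squared Vandermonde product
of S, weighted by the factors d² - s² with d in A or in B. The triangles are contiguous, so A and B
together fill an arithmetic progression (`prod_upDents_mul_prod_downDents`) and the sum depends on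
the sequence only through s_n(a) + z. This is why the shape of the array enters only through Q' or
K' and a few constants.

The sum over S is evaluated by the discrete Andréief identity `sum_squareVandermonde_sq`. Its two
polynomial bases are chosen so that the matrix entries, apart from row and column factors, depend on
i + j alone; the resulting Hankel determinant has a closed form (`det_hankel`). A comparison of
factorials, factor by factor, gives the stated constants (`even_constant`, `odd_constant`). -/

theorem mem_tilings {R : Finset UnitTriangle} {T : Finset (Finset UnitTriangle)} :
    T ∈ tilings R ↔ (∀ l ∈ T, l ⊆ R ∧ IsLozenge l) ∧ ∀ t ∈ R, ∃! l, l ∈ T ∧ t ∈ l := by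
  unfold tilings lozengesIn
  simp only [Finset.mem_filter, Finset.mem_powerset, Finset.card_eq_one]
  refine and_congr ?_ (forall₂_congr fun t _ => ?_)
  · simp [Finset.subset_iff]
  · constructor
    · rintro ⟨l, hl⟩
      refine ⟨l, ?_, ?_⟩
      · have : l ∈ ({l ∈ T | t ∈ l} : Finset _) := by rw [hl]; simp
        simpa using this
      · intro m hm
        have : m ∈ ({l ∈ T | t ∈ l} : Finset _) := by simpa using hm
        rw [hl] at this; simpa using this
    · rintro ⟨l, hl, hu⟩
      refine ⟨l, ?_⟩
      ext m
      simp only [Finset.mem_filter, Finset.mem_singleton]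
      exact ⟨hu m, fun h => h ▸ hl⟩

theorem IsLozenge.nonempty {l : Finset UnitTriangle} (h : IsLozenge l) : l.Nonempty := by
  obtain ⟨u, hu, -⟩ := h
  exact ⟨u, hu⟩

theorem eq_of_mem_tilings {R : Finset UnitTriangle} {T : Finset (Finset UnitTriangle)}
    (hT : T ∈ tilings R) {l m : Finset UnitTriangle} {t : UnitTriangle} (hl : l ∈ T) (hm : m ∈ T)
    (htl : t ∈ l) (htm : t ∈ m) : l = m := by
  obtain ⟨h1, h2⟩ := mem_tilings.1 hT
  exact (h2 t ((h1 l hl).1 htl)).unique ⟨hl, htl⟩ ⟨hm, htm⟩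

@[simp] theorem tilings_empty : tilings ∅ = {∅} := by
  ext T
  rw [mem_tilings, Finset.mem_singleton]
  constructor
  · rintro ⟨h, -⟩
    refine Finset.eq_empty_of_forall_notMem fun l hl => ?_
    obtain ⟨h1, h2⟩ := h l hl
    rw [Finset.subset_empty] at h1
    exact absurd h2.nonempty (by simp [h1])
  · rintro rfl
    simp

@[simp] theorem weightedTilingNumber_empty : weightedTilingNumber ∅ = 1 := by
  simp [weightedTilingNumber]

theorem insert_mem_tilings {R l : Finset UnitTriangle} {T : Finset (Finset UnitTriangle)}
    (hl : IsLozenge l) (hlR : l ⊆ R) (hT : T ∈ tilings (R \ l)) :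
    l ∉ T ∧ insert l T ∈ tilings R := by
  rw [mem_tilings] at hT
  obtain ⟨h1, h2⟩ := hT
  have hdis : ∀ m ∈ T, ∀ t ∈ m, t ∉ l := fun m hm t ht =>
    (Finset.mem_sdiff.1 ((h1 m hm).1 ht)).2
  have hlT : l ∉ T := by
    intro h
    obtain ⟨t, ht⟩ := hl.nonempty
    exact hdis l h t ht ht
  refine ⟨hlT, mem_tilings.2 ⟨?_, ?_⟩⟩
  · intro m hm
    rcases Finset.mem_insert.1 hm with rfl | hm
    · exact ⟨hlR, hl⟩
    · exact ⟨(h1 m hm).1.trans Finset.sdiff_subset, (h1 m hm).2⟩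
  · intro t ht
    by_cases htl : t ∈ l
    · refine ⟨l, ⟨Finset.mem_insert_self _ _, htl⟩, ?_⟩
      rintro m ⟨hm, htm⟩
      rcases Finset.mem_insert.1 hm with rfl | hm
      · rfl
      · exact absurd htl (hdis m hm t htm)
    · obtain ⟨m, ⟨hm, htm⟩, hu⟩ := h2 t (Finset.mem_sdiff.2 ⟨ht, htl⟩)
      refine ⟨m, ⟨Finset.mem_insert_of_mem hm, htm⟩, ?_⟩
      rintro m' ⟨hm', htm'⟩
      rcases Finset.mem_insert.1 hm' with rfl | hm'
      · exact absurd htm' htl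
      · exact hu m' ⟨hm', htm'⟩

theorem erase_mem_tilings {R l : Finset UnitTriangle} {T : Finset (Finset UnitTriangle)}
    (hT : T ∈ tilings R) (hl : l ∈ T) : T.erase l ∈ tilings (R \ l) := by
  have hT' := mem_tilings.1 hT
  obtain ⟨h1, h2⟩ := hT'
  refine mem_tilings.2 ⟨?_, ?_⟩
  · intro m hm
    obtain ⟨hne, hm⟩ := Finset.mem_erase.1 hm
    refine ⟨fun t ht => Finset.mem_sdiff.2 ⟨(h1 m hm).1 ht, fun htl => ?_⟩, (h1 m hm).2⟩
    exact hne (eq_of_mem_tilings hT hm hl ht htl)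
  · intro t ht
    obtain ⟨htR, htl⟩ := Finset.mem_sdiff.1 ht
    obtain ⟨m, ⟨hm, htm⟩, hu⟩ := h2 t htR
    refine ⟨m, ⟨Finset.mem_erase.2 ⟨?_, hm⟩, htm⟩, ?_⟩
    · rintro rfl; exact htl htm
    · rintro m' ⟨hm', htm'⟩
      exact hu m' ⟨(Finset.mem_erase.1 hm').2, htm'⟩

/-- Expansion of the weighted tiling number along the lozenge covering a given cell. -/
theorem weightedTilingNumber_expand {R : Finset UnitTriangle} {t : UnitTriangle} (ht : t ∈ R) :
    weightedTilingNumber R =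
      ∑ l ∈ lozengesIn R with t ∈ l, lozengeWeight l * weightedTilingNumber (R \ l) := by
  unfold weightedTilingNumber
  simp_rw [Finset.mul_sum]
  rw [Finset.sum_sigma']
  symm
  refine Finset.sum_bij (fun p _ => insert p.1 p.2) ?_ ?_ ?_ ?_
  · rintro ⟨l, T⟩ h
    simp only [Finset.mem_sigma, Finset.mem_filter, lozengesIn, Finset.mem_powerset] at h
    exact (insert_mem_tilings h.1.1.2 h.1.1.1 h.2).2
  · rintro ⟨l, T⟩ h ⟨l', T'⟩ h' heq
    simp only [Finset.mem_sigma, Finset.mem_filter, lozengesIn, Finset.mem_powerset] at h h'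
    obtain ⟨hn, hi⟩ := insert_mem_tilings h.1.1.2 h.1.1.1 h.2
    obtain ⟨hn', hi'⟩ := insert_mem_tilings h'.1.1.2 h'.1.1.1 h'.2
    simp only at heq
    have e : l = l' := eq_of_mem_tilings hi (Finset.mem_insert_self _ _)
      (heq ▸ Finset.mem_insert_self _ _) h.1.2 h'.1.2
    subst e
    have : T = T' := by
      rw [← Finset.erase_insert hn, heq, Finset.erase_insert hn']
    rw [this]
  · intro T hT
    obtain ⟨h1, h2⟩ := mem_tilings.1 hT
    obtain ⟨l, ⟨hl, htl⟩, -⟩ := h2 t ht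
    refine ⟨⟨l, T.erase l⟩, ?_, Finset.insert_erase hl⟩
    simp only [Finset.mem_sigma, Finset.mem_filter, lozengesIn, Finset.mem_powerset]
    exact ⟨⟨h1 l hl, htl⟩, erase_mem_tilings hT hl⟩
  · rintro ⟨l, T⟩ h
    simp only [Finset.mem_sigma, Finset.mem_filter, lozengesIn, Finset.mem_powerset] at h
    rw [Finset.prod_insert (insert_mem_tilings h.1.1.2 h.1.1.1 h.2).1]

theorem isLozenge_iff {l : Finset UnitTriangle} : IsLozenge l ↔ ∃ X j : ℤ, Odd (X + j) ∧
    (l = {(X, j), (X - 1, j)} ∨ l = {(X, j), (X + 1, j)} ∨ l = {(X, j), (X, j - 1)}) := by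
  constructor
  · rintro ⟨⟨X, j⟩, -, h, h'⟩
    exact ⟨X, j, h, h'⟩
  · rintro ⟨X, j, h, h'⟩
    refine ⟨(X, j), ?_, h, h'⟩
    rcases h' with rfl | rfl | rfl <;> simp

/-- The weight of a vertical lozenge in column `X`. -/
def columnWeight (X : ℤ) : ℚ := if X = 0 then 1 / 2 else 1

theorem lozengeWeight_vertical {X j : ℤ} (h : Odd (X + j)) :
    lozengeWeight {(X, j), (X, j - 1)} = columnWeight X := by
  unfold lozengeWeight columnWeight
  refine if_congr ?_ rfl rfl
  constructor
  · rintro ⟨u, hu, hup, h0, -⟩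
    simp only [Finset.mem_insert, Finset.mem_singleton] at hu
    rcases hu with rfl | rfl <;> simpa using h0
  · rintro rfl
    exact ⟨(0, j), by simp, h, rfl, rfl⟩

theorem lozengeWeight_horizontal {X Y j : ℤ} :
    lozengeWeight {(X, j), (Y, j)} = 1 := by
  unfold lozengeWeight
  refine if_neg ?_
  rintro ⟨u, hu, -, -, h2⟩
  have h3 : (u.1, u.2 - 1) ∈ ({(X, j), (Y, j)} : Finset UnitTriangle) := by
    rw [h2]; simp
  simp only [Finset.mem_insert, Finset.mem_singleton, Prod.ext_iff] at hu h3
  omega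

theorem pair_inj_of_mem {t a b : UnitTriangle} (h : ({t, a} : Finset UnitTriangle) = {t, b}) :
    a = b := by
  have h1 : a ∈ ({t, b} : Finset UnitTriangle) := h ▸ by simp
  have h2 : b ∈ ({t, a} : Finset UnitTriangle) := h ▸ by simp
  simp only [Finset.mem_insert, Finset.mem_singleton] at h1 h2
  rcases h1 with rfl | rfl
  · rcases h2 with rfl | rfl <;> rfl
  · rfl

theorem lozengesIn_down {R : Finset UnitTriangle} {X j : ℤ} (hd : Even (X + j))
    (ht : (X, j) ∈ R) :
    {l ∈ lozengesIn R | (X, j) ∈ l} =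
      ({(X - 1, j), (X + 1, j), (X, j + 1)} ∩ R).image (fun v => {(X, j), v}) := by
  ext l
  simp only [lozengesIn, Finset.mem_filter, Finset.mem_powerset, Finset.mem_image,
    Finset.mem_inter, isLozenge_iff]
  rw [Int.even_iff] at hd
  constructor
  · rintro ⟨⟨hlR, Y, i, ho, h⟩, hl⟩
    rw [Int.odd_iff] at ho
    rcases h with rfl | rfl | rfl <;>
      simp only [Finset.mem_insert, Finset.mem_singleton, Prod.mk.injEq] at hl <;>
      refine ⟨(Y, i), ⟨?_, hlR (by simp)⟩, ?_⟩ <;> 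
      first
      | (simp only [Finset.mem_insert, Finset.mem_singleton, Prod.mk.injEq]; omega)
      | (rw [Finset.pair_comm]; congr 1; ext v; simp only [Finset.mem_singleton, Prod.ext_iff]; omega)
  · rintro ⟨v, ⟨hv, hvR⟩, rfl⟩
    refine ⟨⟨by simp [Finset.insert_subset_iff, ht, hvR], ?_⟩, by simp⟩
    simp only [Finset.mem_insert, Finset.mem_singleton] at hv
    rcases hv with rfl | rfl | rfl
    · exact ⟨X - 1, j, by rw [Int.odd_iff]; omega, Or.inr (Or.inl (by rw [Finset.pair_comm]; simp))⟩
    · exact ⟨X + 1, j, by rw [Int.odd_iff]; omega, Or.inl (by rw [Finset.pair_comm]; simp)⟩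
    · exact ⟨X, j + 1, by rw [Int.odd_iff]; omega,
        Or.inr (Or.inr (by rw [Finset.pair_comm]; simp))⟩

theorem lozengesIn_up {R : Finset UnitTriangle} {X j : ℤ} (hd : Odd (X + j))
    (ht : (X, j) ∈ R) :
    {l ∈ lozengesIn R | (X, j) ∈ l} =
      ({(X - 1, j), (X + 1, j), (X, j - 1)} ∩ R).image (fun v => {(X, j), v}) := by
  ext l
  simp only [lozengesIn, Finset.mem_filter, Finset.mem_powerset, Finset.mem_image,
    Finset.mem_inter, isLozenge_iff]
  constructor
  · rintro ⟨⟨hlR, Y, i, ho, h⟩, hl⟩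
    rw [Int.odd_iff] at ho hd
    have hYX : Y = X ∧ i = j := by
      rcases h with rfl | rfl | rfl <;>
      simp only [Finset.mem_insert, Finset.mem_singleton, Prod.mk.injEq] at hl <;> omega
    obtain ⟨rfl, rfl⟩ := hYX
    rcases h with rfl | rfl | rfl
    · exact ⟨(Y - 1, i), ⟨by simp, hlR (by simp)⟩, rfl⟩
    · exact ⟨(Y + 1, i), ⟨by simp, hlR (by simp)⟩, rfl⟩
    · exact ⟨(Y, i - 1), ⟨by simp, hlR (by simp)⟩, rfl⟩
  · rintro ⟨v, ⟨hv, hvR⟩, rfl⟩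
    refine ⟨⟨by simp [Finset.insert_subset_iff, ht, hvR], X, j, hd, ?_⟩, by simp⟩
    simp only [Finset.mem_insert, Finset.mem_singleton] at hv
    rcases hv with rfl | rfl | rfl <;> simp

/-- Expansion at a down-pointing triangle. -/
theorem weightedTilingNumber_expand_down {R : Finset UnitTriangle} {X j : ℤ} (hd : Even (X + j))
    (ht : (X, j) ∈ R) :
    weightedTilingNumber R =
      (if (X - 1, j) ∈ R then weightedTilingNumber (R \ {(X, j), (X - 1, j)}) else 0) +
      (if (X + 1, j) ∈ R then weightedTilingNumber (R \ {(X, j), (X + 1, j)}) else 0) +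
      (if (X, j + 1) ∈ R then
        columnWeight X * weightedTilingNumber (R \ {(X, j), (X, j + 1)}) else 0) := by
  rw [weightedTilingNumber_expand ht, lozengesIn_down hd ht,
    Finset.sum_image (fun a _ b _ h => pair_inj_of_mem h),
    ← Finset.filter_mem_eq_inter, Finset.sum_filter, Finset.sum_insert, Finset.sum_pair]
  · rw [lozengeWeight_horizontal, lozengeWeight_horizontal, one_mul, one_mul,
      Finset.pair_comm (X, j) (X, j + 1)]
    have := lozengeWeight_vertical (X := X) (j := j + 1)
      (by rw [Int.even_iff] at hd; rw [Int.odd_iff]; omega)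
    rw [add_sub_cancel_right] at this
    rw [this, add_assoc]
  · simp
  · simp; omega

/-- Expansion at an up-pointing triangle. -/
theorem weightedTilingNumber_expand_up {R : Finset UnitTriangle} {X j : ℤ} (hd : Odd (X + j))
    (ht : (X, j) ∈ R) :
    weightedTilingNumber R =
      (if (X - 1, j) ∈ R then weightedTilingNumber (R \ {(X, j), (X - 1, j)}) else 0) +
      (if (X + 1, j) ∈ R then weightedTilingNumber (R \ {(X, j), (X + 1, j)}) else 0) +
      (if (X, j - 1) ∈ R then
        columnWeight X * weightedTilingNumber (R \ {(X, j), (X, j - 1)}) else 0) := by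
  rw [weightedTilingNumber_expand ht, lozengesIn_up hd ht,
    Finset.sum_image (fun a _ b _ h => pair_inj_of_mem h),
    ← Finset.filter_mem_eq_inter, Finset.sum_filter, Finset.sum_insert, Finset.sum_pair]
  · rw [lozengeWeight_horizontal, lozengeWeight_horizontal, one_mul, one_mul,
      lozengeWeight_vertical hd, add_assoc]
  · simp
  · simp; omega

/-! ### Balance, reflection, splitting along a level -/

/-- A region with a tiling has as many up-pointing as down-pointing triangles. -/
theorem sum_orientation_eq_zero {R : Finset UnitTriangle} (h : weightedTilingNumber R ≠ 0) :
    ∑ c ∈ R, (if IsUp c then (1 : ℤ) else -1) = 0 := by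
  induction hn : R.card using Nat.strong_induction_on generalizing R with
  | _ n ih =>
    rcases R.eq_empty_or_nonempty with rfl | ⟨t, ht⟩
    · simp
    · rw [weightedTilingNumber_expand ht] at h
      obtain ⟨l, hl, hne⟩ := Finset.exists_ne_zero_of_sum_ne_zero h
      simp only [Finset.mem_filter, lozengesIn, Finset.mem_powerset] at hl
      have hlt : (R \ l).card < n := by
        rw [← hn]
        exact Finset.card_lt_card ⟨Finset.sdiff_subset, fun hh =>
          (Finset.mem_sdiff.1 (hh ht)).2 hl.2⟩
      have h0 := ih _ hlt (right_ne_zero_of_mul hne) rfl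
      rw [← Finset.sum_sdiff hl.1.1, h0, zero_add]
      obtain ⟨X, j, ho, hX⟩ := isLozenge_iff.1 hl.1.2
      rw [Int.odd_iff] at ho
      rcases hX with rfl | rfl | rfl <;> rw [Finset.sum_pair (by simp [Prod.ext_iff]; try omega)] <;>
        simp only [IsUp, Int.odd_iff] <;> rw [if_pos ho, if_neg (by omega)] <;> norm_num

/-- Expansion at a cell `t` and at its image `f t` gives sums over corresponding lozenges, so
induction on the number of cells suffices and no bijection between tilings has to be built. -/
theorem weightedTilingNumber_map (f : UnitTriangle ↪ UnitTriangle)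
    (hf : ∀ l, IsLozenge (l.map f) ↔ IsLozenge l)
    (hw : ∀ l, IsLozenge l → lozengeWeight (l.map f) = lozengeWeight l) (R : Finset UnitTriangle) :
    weightedTilingNumber (R.map f) = weightedTilingNumber R := by
  induction hn : R.card using Nat.strong_induction_on generalizing R with
  | _ n ih =>
    rcases R.eq_empty_or_nonempty with rfl | ⟨t, ht⟩
    · simp
    · rw [weightedTilingNumber_expand ht,
        weightedTilingNumber_expand (Finset.mem_map_of_mem f ht)]
      have key : ({l ∈ lozengesIn (R.map f) | f t ∈ l} : Finset _) =
          {l ∈ lozengesIn R | t ∈ l}.image (Finset.map f) := by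
        ext l
        simp only [lozengesIn, Finset.mem_filter, Finset.mem_powerset, Finset.mem_image]
        constructor
        · rintro ⟨⟨h1, h2⟩, h3⟩
          obtain ⟨m, hm, rfl⟩ := Finset.subset_map_iff.1 h1
          exact ⟨m, ⟨⟨hm, (hf m).1 h2⟩, by simpa using h3⟩, rfl⟩
        · rintro ⟨m, ⟨⟨h1, h2⟩, h3⟩, rfl⟩
          exact ⟨⟨Finset.map_subset_map.2 h1, (hf m).2 h2⟩, Finset.mem_map_of_mem f h3⟩
      rw [key, Finset.sum_image (fun a _ b _ h => Finset.map_injective f h)]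
      refine Finset.sum_congr rfl fun l hl => ?_
      simp only [Finset.mem_filter, lozengesIn, Finset.mem_powerset] at hl
      have hlt : (R \ l).card < n := by
        rw [← hn]
        exact Finset.card_lt_card ⟨Finset.sdiff_subset, fun hh =>
          (Finset.mem_sdiff.1 (hh ht)).2 hl.2⟩
      have : R.map f \ l.map f = (R \ l).map f := by
        ext c; simp only [Finset.mem_sdiff, Finset.mem_map]; 
        constructor
        · rintro ⟨⟨a, ha, rfl⟩, h⟩
          exact ⟨a, ⟨ha, fun hal => h ⟨a, hal, rfl⟩⟩, rfl⟩
        · rintro ⟨a, ⟨ha, h⟩, rfl⟩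
          refine ⟨⟨a, ha, rfl⟩, ?_⟩
          rintro ⟨b, hb, he⟩
          exact h (f.injective he ▸ hb)
      rw [this, hw l hl.1.2, ih _ hlt _ rfl]

/-- Reflection in the level `q`. -/
def levelReflection (q : ℤ) : UnitTriangle ↪ UnitTriangle :=
  ⟨fun c => (c.1, 2 * q - 1 - c.2), fun a b h => by
    simp only [Prod.mk.injEq] at h
    ext <;> omega⟩

theorem levelReflection_apply (q X j : ℤ) : levelReflection q (X, j) = (X, 2 * q - 1 - j) := rfl

theorem map_levelReflection_map (q : ℤ) (l : Finset UnitTriangle) :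
    (l.map (levelReflection q)).map (levelReflection q) = l := by
  rw [Finset.map_map]
  convert Finset.map_refl using 2
  ext ⟨X, j⟩ <;> simp [levelReflection_apply]

/-- The reflection exchanges up- and down-pointing triangles and keeps columns. A vertical lozenge
therefore stays vertical in its column, and the weight 1/2 in column 0 is preserved. In terms of
cell centres the zigzag is just the condition `0 ≤ X`, which is also preserved. -/
theorem isLozenge_map_levelReflection (q : ℤ) {l : Finset UnitTriangle} (hl : IsLozenge l) :
    IsLozenge (l.map (levelReflection q)) ∧
      lozengeWeight (l.map (levelReflection q)) = lozengeWeight l := by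
  obtain ⟨X, j, ho, h⟩ := isLozenge_iff.1 hl
  have ho' := Int.odd_iff.1 ho
  rcases h with rfl | rfl | rfl <;>
    simp only [Finset.map_insert, Finset.map_singleton, levelReflection_apply]
  · refine ⟨isLozenge_iff.2 ⟨X - 1, 2 * q - 1 - j, by rw [Int.odd_iff]; omega, Or.inr (Or.inl ?_)⟩,
      ?_⟩
    · rw [Finset.pair_comm]; simp
    · rw [lozengeWeight_horizontal, lozengeWeight_horizontal]
  · refine ⟨isLozenge_iff.2 ⟨X + 1, 2 * q - 1 - j, by rw [Int.odd_iff]; omega, Or.inl ?_⟩,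
      ?_⟩
    · rw [Finset.pair_comm]; simp
    · rw [lozengeWeight_horizontal, lozengeWeight_horizontal]
  · have e : ({(X, 2 * q - 1 - j), (X, 2 * q - 1 - (j - 1))} : Finset UnitTriangle) =
        {(X, 2 * q - j), (X, 2 * q - j - 1)} := by
      rw [Finset.pair_comm, show 2 * q - 1 - j = 2 * q - j - 1 by ring,
        show 2 * q - 1 - (j - 1) = 2 * q - j by ring]
    have h1 : Odd (X + (2 * q - j)) := by rw [Int.odd_iff]; omega
    rw [e, lozengeWeight_vertical h1, lozengeWeight_vertical ho]
    exact ⟨isLozenge_iff.2 ⟨X, _, h1, Or.inr (Or.inr rfl)⟩, rfl⟩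

theorem weightedTilingNumber_reflect (q : ℤ) (R : Finset UnitTriangle) :
    weightedTilingNumber (R.map (levelReflection q)) = weightedTilingNumber R :=
  weightedTilingNumber_map _ (fun l => ⟨fun h => by
    simpa [map_levelReflection_map] using (isLozenge_map_levelReflection q h).1,
    fun h => (isLozenge_map_levelReflection q h).1⟩)
    (fun _ hl => (isLozenge_map_levelReflection q hl).2) R

/-- The part of `R` above level `L`, without the up-pointing triangles on `L` in the columns `S`. -/
def abovePart (R : Finset UnitTriangle) (L : ℤ) (S : Finset ℤ) : Finset UnitTriangle :=
  {c ∈ R | L ≤ c.2 ∧ ¬ (c.2 = L ∧ c.1 ∈ S)}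

/-- The part of `R` below level `L`, without the down-pointing triangles under `L` in the
columns `S`. -/
def belowPart (R : Finset UnitTriangle) (L : ℤ) (S : Finset ℤ) : Finset UnitTriangle :=
  {c ∈ R | c.2 < L ∧ ¬ (c.2 = L - 1 ∧ c.1 ∈ S)}

/-- The vertical lozenge in column `X` centred on level `L`. -/
def verticalLozenge (L X : ℤ) : Finset UnitTriangle := {(X, L), (X, L - 1)}

theorem verticalLozenge_injective (L : ℤ) : Function.Injective (verticalLozenge L) := by
  intro X Y h
  have : (X, L) ∈ verticalLozenge L Y := h ▸ by simp [verticalLozenge]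
  simp only [verticalLozenge, Finset.mem_insert, Finset.mem_singleton, Prod.mk.injEq] at this
  omega

/-- The columns in which a vertical lozenge of `R` centred on level `L` can lie. -/
def crossingColumns (R : Finset UnitTriangle) (L : ℤ) : Finset ℤ :=
  (R.image Prod.fst).filter fun X => Odd (X + L) ∧ (X, L) ∈ R ∧ (X, L - 1) ∈ R

theorem mem_crossingColumns {R : Finset UnitTriangle} {L X : ℤ} :
    X ∈ crossingColumns R L ↔ Odd (X + L) ∧ (X, L) ∈ R ∧ (X, L - 1) ∈ R := by
  unfold crossingColumns
  simp only [Finset.mem_filter, Finset.mem_image, Prod.exists, exists_and_right, exists_eq_right,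
    and_iff_right_iff_imp]
  rintro ⟨-, h, -⟩
  exact ⟨L, h⟩

/-- Only the vertical lozenge whose up-pointing triangle lies in row `L` has cells on both sides of
the level. -/
theorem lozenge_above_below_or_crossing {l : Finset UnitTriangle} (hl : IsLozenge l) (L : ℤ) :
    (∀ c ∈ l, L ≤ c.2) ∨ (∀ c ∈ l, c.2 < L) ∨ ∃ X, Odd (X + L) ∧ l = verticalLozenge L X := by
  obtain ⟨X, j, ho, h⟩ := isLozenge_iff.1 hl
  rcases lt_trichotomy j L with hj | rfl | hj
  · right; left
    rcases h with rfl | rfl | rfl <;> simp <;> omega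
  · rcases h with rfl | rfl | rfl
    · left; simp
    · left; simp
    · right; right; exact ⟨X, ho, rfl⟩
  · left
    rcases h with rfl | rfl | rfl <;> simp <;> omega

theorem union_mem_tilings {R : Finset UnitTriangle} {L : ℤ} {S : Finset ℤ}
    (hS : S ⊆ crossingColumns R L) {T₁ T₂ : Finset (Finset UnitTriangle)}
    (h₁ : T₁ ∈ tilings (abovePart R L S)) (h₂ : T₂ ∈ tilings (belowPart R L S)) :
    T₁ ∪ T₂ ∪ S.image (verticalLozenge L) ∈ tilings R := by
  obtain ⟨a1, a2⟩ := mem_tilings.1 h₁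
  obtain ⟨b1, b2⟩ := mem_tilings.1 h₂
  have a3 : ∀ l ∈ T₁, ∀ c ∈ l, c ∈ abovePart R L S := fun l hl c hc => (a1 l hl).1 hc
  have b3 : ∀ l ∈ T₂, ∀ c ∈ l, c ∈ belowPart R L S := fun l hl c hc => (b1 l hl).1 hc
  simp only [abovePart, Finset.mem_filter] at a3 a2
  simp only [belowPart, Finset.mem_filter] at b3 b2
  have hS' : ∀ X ∈ S, Odd (X + L) ∧ (X, L) ∈ R ∧ (X, L - 1) ∈ R :=
    fun X hX => mem_crossingColumns.1 (hS hX)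
  have v3 : ∀ X, ∀ c ∈ verticalLozenge L X, c.1 = X ∧ (c.2 = L ∨ c.2 = L - 1) := by
    intro X c hc
    simp only [verticalLozenge, Finset.mem_insert, Finset.mem_singleton] at hc
    rcases hc with rfl | rfl <;> simp
  refine mem_tilings.2 ⟨?_, ?_⟩
  · intro l hl
    simp only [Finset.mem_union, Finset.mem_image] at hl
    rcases hl with (hl | hl) | ⟨X, hX, rfl⟩
    · exact ⟨fun c hc => (a3 l hl c hc).1, (a1 l hl).2⟩
    · exact ⟨fun c hc => (b3 l hl c hc).1, (b1 l hl).2⟩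
    · obtain ⟨o, h1, h2⟩ := hS' X hX
      refine ⟨?_, isLozenge_iff.2 ⟨X, L, o, Or.inr (Or.inr rfl)⟩⟩
      simp [verticalLozenge, Finset.insert_subset_iff, h1, h2]
  · rintro ⟨X, j⟩ ht
    simp only [Finset.mem_union, Finset.mem_image]
    by_cases hj : L ≤ j
    · by_cases hX : j = L ∧ X ∈ S
      · obtain ⟨rfl, hX⟩ := hX
        refine ⟨verticalLozenge j X, ⟨Or.inr ⟨X, hX, rfl⟩, by simp [verticalLozenge]⟩, ?_⟩
        rintro m ⟨(hm | hm) | ⟨Y, hY, rfl⟩, htm⟩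
        · exact absurd ⟨rfl, hX⟩ (a3 m hm _ htm).2.2
        · exact absurd (b3 m hm _ htm).2.1 (by simp)
        · rw [show X = Y from (v3 Y _ htm).1]
      · obtain ⟨l, ⟨hl, htl⟩, hu⟩ := a2 (X, j) ⟨ht, hj, hX⟩
        refine ⟨l, ⟨Or.inl (Or.inl hl), htl⟩, ?_⟩
        rintro m ⟨(hm | hm) | ⟨Y, hY, rfl⟩, htm⟩
        · exact hu m ⟨hm, htm⟩
        · exact absurd (b3 m hm _ htm).2.1 (by simpa using hj)
        · have := v3 Y _ htm
          simp only at this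
          exact absurd ⟨by omega, this.1 ▸ hY⟩ hX
    · by_cases hX : j = L - 1 ∧ X ∈ S
      · obtain ⟨rfl, hX⟩ := hX
        refine ⟨verticalLozenge L X, ⟨Or.inr ⟨X, hX, rfl⟩, by simp [verticalLozenge]⟩, ?_⟩
        rintro m ⟨(hm | hm) | ⟨Y, hY, rfl⟩, htm⟩
        · exact absurd (a3 m hm _ htm).2.1 (by simp)
        · exact absurd ⟨rfl, hX⟩ (b3 m hm _ htm).2.2
        · rw [show X = Y from (v3 Y _ htm).1]
      · obtain ⟨l, ⟨hl, htl⟩, hu⟩ := b2 (X, j) ⟨ht, by simpa using hj, hX⟩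
        refine ⟨l, ⟨Or.inl (Or.inr hl), htl⟩, ?_⟩
        rintro m ⟨(hm | hm) | ⟨Y, hY, rfl⟩, htm⟩
        · exact absurd (a3 m hm _ htm).2.1 (by simpa using hj)
        · exact hu m ⟨hm, htm⟩
        · have := v3 Y _ htm
          simp only at this
          exact absurd ⟨by omega, this.1 ▸ hY⟩ hX

theorem filter_above_mem_tilings {R : Finset UnitTriangle} {L : ℤ}
    {T : Finset (Finset UnitTriangle)} (hT : T ∈ tilings R) :
    {l ∈ T | ∀ c ∈ l, L ≤ c.2} ∈
      tilings (abovePart R L {X ∈ crossingColumns R L | verticalLozenge L X ∈ T}) := by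
  obtain ⟨h1, h2⟩ := mem_tilings.1 hT
  refine mem_tilings.2 ⟨?_, ?_⟩
  · intro l hl
    simp only [Finset.mem_filter] at hl
    refine ⟨fun c hc => ?_, (h1 l hl.1).2⟩
    simp only [abovePart, Finset.mem_filter]
    refine ⟨(h1 l hl.1).1 hc, hl.2 c hc, ?_⟩
    rintro ⟨rfl, -, hv⟩
    have : l = verticalLozenge c.2 c.1 :=
      eq_of_mem_tilings hT hl.1 hv hc (by simp [verticalLozenge])
    have := hl.2 (c.1, c.2 - 1) (by rw [this]; simp [verticalLozenge])
    simp at this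
  · rintro ⟨X, j⟩ ht
    simp only [abovePart, Finset.mem_filter, not_and] at ht
    obtain ⟨l, ⟨hl, htl⟩, hu⟩ := h2 _ ht.1
    refine ⟨l, ⟨Finset.mem_filter.2 ⟨hl, ?_⟩, htl⟩, fun m hm =>
      hu m ⟨(Finset.mem_filter.1 hm.1).1, hm.2⟩⟩
    rcases lozenge_above_below_or_crossing (h1 l hl).2 L with h | h | ⟨Y, hY, rfl⟩
    · exact h
    · exact absurd ht.2.1 (not_le.2 (h _ htl))
    · exfalso
      have hsub := (h1 _ hl).1
      have e1 : (Y, L) ∈ R := hsub (by simp [verticalLozenge])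
      have e2 : (Y, L - 1) ∈ R := hsub (by simp [verticalLozenge])
      have hj := ht.2.1
      simp only [verticalLozenge, Finset.mem_insert, Finset.mem_singleton, Prod.mk.injEq] at htl
      obtain ⟨rfl, rfl⟩ : X = Y ∧ j = L := by omega
      exact ht.2.2 rfl (mem_crossingColumns.2 ⟨hY, e1, e2⟩) hl

theorem filter_below_mem_tilings {R : Finset UnitTriangle} {L : ℤ}
    {T : Finset (Finset UnitTriangle)} (hT : T ∈ tilings R) :
    {l ∈ T | ∀ c ∈ l, c.2 < L} ∈
      tilings (belowPart R L {X ∈ crossingColumns R L | verticalLozenge L X ∈ T}) := by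
  obtain ⟨h1, h2⟩ := mem_tilings.1 hT
  refine mem_tilings.2 ⟨?_, ?_⟩
  · intro l hl
    simp only [Finset.mem_filter] at hl
    refine ⟨fun c hc => ?_, (h1 l hl.1).2⟩
    simp only [belowPart, Finset.mem_filter]
    refine ⟨(h1 l hl.1).1 hc, hl.2 c hc, ?_⟩
    rintro ⟨he, -, hv⟩
    have : l = verticalLozenge L c.1 :=
      eq_of_mem_tilings hT hl.1 hv hc (by simp [verticalLozenge, Prod.ext_iff, he])
    have := hl.2 (c.1, L) (by rw [this]; simp [verticalLozenge])
    simp at this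
  · rintro ⟨X, j⟩ ht
    simp only [belowPart, Finset.mem_filter, not_and] at ht
    obtain ⟨l, ⟨hl, htl⟩, hu⟩ := h2 _ ht.1
    refine ⟨l, ⟨Finset.mem_filter.2 ⟨hl, ?_⟩, htl⟩, fun m hm =>
      hu m ⟨(Finset.mem_filter.1 hm.1).1, hm.2⟩⟩
    rcases lozenge_above_below_or_crossing (h1 l hl).2 L with h | h | ⟨Y, hY, rfl⟩
    · exact absurd ht.2.1 (not_lt.2 (h _ htl))
    · exact h
    · exfalso
      have hsub := (h1 _ hl).1
      have e1 : (Y, L) ∈ R := hsub (by simp [verticalLozenge])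
      have e2 : (Y, L - 1) ∈ R := hsub (by simp [verticalLozenge])
      have hj := ht.2.1
      simp only [verticalLozenge, Finset.mem_insert, Finset.mem_singleton, Prod.mk.injEq] at htl
      obtain ⟨rfl, rfl⟩ : X = Y ∧ j = L - 1 := by omega
      exact ht.2.2 rfl (mem_crossingColumns.2 ⟨hY, e1, e2⟩) hl

/-- A tiling is determined by its vertical lozenges centred on a level, and by its parts above and
below that level. -/
theorem weightedTilingNumber_split (R : Finset UnitTriangle) (L : ℤ) :
    weightedTilingNumber R = ∑ S ∈ (crossingColumns R L).powerset, (∏ X ∈ S, columnWeight X) *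
      weightedTilingNumber (abovePart R L S) * weightedTilingNumber (belowPart R L S) := by
  -- The three classes of lozenges are told apart by two predicates, lying above and lying below the
  -- level: a crossing lozenge satisfies neither, the others exactly one. This makes the
  -- decomposition of a tiling unique.
  have hv2 : ∀ {S : Finset ℤ}, ∀ m ∈ S.image (verticalLozenge L),
      (¬ ∀ c ∈ m, L ≤ c.2) ∧ (¬ ∀ c ∈ m, c.2 < L) := by
    intro S m hm
    obtain ⟨X, -, rfl⟩ := Finset.mem_image.1 hm
    constructor <;> intro h
    · have := h (X, L - 1) (by simp [verticalLozenge]); simp at this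
    · have := h (X, L) (by simp [verticalLozenge]); simp at this
  have ha2 : ∀ {S : Finset ℤ} {T}, T ∈ tilings (abovePart R L S) → ∀ m ∈ T,
      (∀ c ∈ m, L ≤ c.2) ∧ ¬ ∀ c ∈ m, c.2 < L := by
    intro S T hT m hm
    have h1 := (mem_tilings.1 hT).1 m hm
    have h2 : ∀ c ∈ m, L ≤ c.2 := fun c hc => (Finset.mem_filter.1 (h1.1 hc)).2.1
    refine ⟨h2, fun h => ?_⟩
    obtain ⟨c, hc⟩ := h1.2.nonempty
    exact absurd (h c hc) (not_lt.2 (h2 c hc))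
  have hb2 : ∀ {S : Finset ℤ} {T}, T ∈ tilings (belowPart R L S) → ∀ m ∈ T,
      (¬ ∀ c ∈ m, L ≤ c.2) ∧ ∀ c ∈ m, c.2 < L := by
    intro S T hT m hm
    have h1 := (mem_tilings.1 hT).1 m hm
    have h2 : ∀ c ∈ m, c.2 < L := fun c hc => (Finset.mem_filter.1 (h1.1 hc)).2.1
    refine ⟨fun h => ?_, h2⟩
    obtain ⟨c, hc⟩ := h1.2.nonempty
    exact absurd (h2 c hc) (not_lt.2 (h c hc))
  unfold weightedTilingNumber
  simp_rw [mul_assoc, Finset.sum_mul_sum, ← Finset.sum_product', Finset.mul_sum]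
  rw [Finset.sum_sigma']
  symm
  -- Gluing and cutting are mutually inverse: a tiling corresponds to the columns of its crossing
  -- lozenges, its lozenges above the level and its lozenges below it.
  refine Finset.sum_bij' (fun p _ => p.2.1 ∪ p.2.2 ∪ p.1.image (verticalLozenge L))
    (fun T _ => ⟨{X ∈ crossingColumns R L | verticalLozenge L X ∈ T},
      ({l ∈ T | ∀ c ∈ l, L ≤ c.2}, {l ∈ T | ∀ c ∈ l, c.2 < L})⟩) ?_ ?_ ?_ ?_ ?_
  · rintro ⟨S, T₁, T₂⟩ h
    simp only [Finset.mem_sigma, Finset.mem_powerset, Finset.mem_product] at h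
    exact union_mem_tilings h.1 h.2.1 h.2.2
  · intro T hT
    simp only [Finset.mem_sigma, Finset.mem_powerset, Finset.mem_product]
    exact ⟨Finset.filter_subset _ _, filter_above_mem_tilings hT, filter_below_mem_tilings hT⟩
  · rintro ⟨S, T₁, T₂⟩ h
    simp only [Finset.mem_sigma, Finset.mem_powerset, Finset.mem_product] at h
    have e1 : {X ∈ crossingColumns R L | verticalLozenge L X ∈
        T₁ ∪ T₂ ∪ S.image (verticalLozenge L)} = S := by
      ext X
      simp only [Finset.mem_filter, Finset.mem_union]
      constructor
      · rintro ⟨-, (hX | hX) | hX⟩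
        · exact absurd (ha2 h.2.1 _ hX).1 (hv2 (S := {X}) _ (by simp)).1
        · exact absurd (hb2 h.2.2 _ hX).2 (hv2 (S := {X}) _ (by simp)).2
        · obtain ⟨Y, hY, e⟩ := Finset.mem_image.1 hX
          exact verticalLozenge_injective L e ▸ hY
      · intro hX
        exact ⟨h.1 hX, Or.inr (Finset.mem_image_of_mem _ hX)⟩
    have e2 : {l ∈ T₁ ∪ T₂ ∪ S.image (verticalLozenge L) | ∀ c ∈ l, L ≤ c.2} = T₁ := by
      ext l
      simp only [Finset.mem_filter, Finset.mem_union]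
      constructor
      · rintro ⟨(hX | hX) | hX, hl⟩
        · exact hX
        · exact absurd hl (hb2 h.2.2 _ hX).1
        · exact absurd hl (hv2 _ hX).1
      · intro hX
        exact ⟨Or.inl (Or.inl hX), (ha2 h.2.1 _ hX).1⟩
    have e3 : {l ∈ T₁ ∪ T₂ ∪ S.image (verticalLozenge L) | ∀ c ∈ l, c.2 < L} = T₂ := by
      ext l
      simp only [Finset.mem_filter, Finset.mem_union]
      constructor
      · rintro ⟨(hX | hX) | hX, hl⟩
        · exact absurd hl (ha2 h.2.1 _ hX).2
        · exact hX
        · exact absurd hl (hv2 _ hX).2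
      · intro hX
        exact ⟨Or.inl (Or.inr hX), (hb2 h.2.2 _ hX).2⟩
    rw [e1, e2, e3]
  · intro T hT
    obtain ⟨h1, h2⟩ := mem_tilings.1 hT
    ext l
    simp only [Finset.mem_union, Finset.mem_filter, Finset.mem_image]
    constructor
    · rintro ((h | h) | ⟨X, hX, rfl⟩)
      · exact h.1
      · exact h.1
      · exact hX.2
    · intro hl
      rcases lozenge_above_below_or_crossing (h1 l hl).2 L with h | h | ⟨Y, hY, rfl⟩
      · exact Or.inl (Or.inl ⟨hl, h⟩)
      · exact Or.inl (Or.inr ⟨hl, h⟩)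
      · have hsub := (h1 _ hl).1
        exact Or.inr ⟨Y, ⟨mem_crossingColumns.2 ⟨hY, hsub (by simp [verticalLozenge]),
          hsub (by simp [verticalLozenge])⟩, hl⟩, rfl⟩
  · rintro ⟨S, T₁, T₂⟩ h
    simp only [Finset.mem_sigma, Finset.mem_powerset, Finset.mem_product] at h
    rw [Finset.prod_union, Finset.prod_union, Finset.prod_image
      (fun a _ b _ e => verticalLozenge_injective L e), mul_comm]
    · congr 1
      refine Finset.prod_congr rfl fun X hX => ?_
      exact (lozengeWeight_vertical (mem_crossingColumns.1 (h.1 hX)).1).symm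
    · rw [Finset.disjoint_left]
      exact fun l hl hl' => (hb2 h.2.2 _ hl').1 (ha2 h.2.1 _ hl).1
    · rw [Finset.disjoint_left]
      intro l hl hl'
      rcases Finset.mem_union.1 hl with hl | hl
      · exact (hv2 _ hl').1 (ha2 h.2.1 _ hl).1
      · exact (hv2 _ hl').2 (hb2 h.2.2 _ hl).2

/-! ### Tilings of the lowest row -/

theorem columnWeight_of_ne {X : ℤ} (h : X ≠ 0) : columnWeight X = 1 := if_neg h

/-- The cells of row `j` with first coordinate in `[p, q)`. -/
noncomputable def rowSegment (j p q : ℤ) : Finset UnitTriangle := Finset.Ico p q ×ˢ {j}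

theorem mem_rowSegment {j p q : ℤ} {c : UnitTriangle} :
    c ∈ rowSegment j p q ↔ p ≤ c.1 ∧ c.1 < q ∧ c.2 = j := by
  rw [rowSegment, Finset.mem_product, Finset.mem_Ico, Finset.mem_singleton, and_assoc]

/-- A segment of even length of the lowest row starting with an up-pointing triangle without left
neighbour is tiled in exactly one way. -/
theorem weightedTilingNumber_forced_right {j : ℤ} (i : ℕ) : ∀ (p : ℤ) (R : Finset UnitTriangle),
    Odd (p + j) → (∀ X, p ≤ X → X < p + 2 * i → (X, j) ∈ R ∧ (X, j - 1) ∉ R) → (p - 1, j) ∉ R →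
    weightedTilingNumber R = weightedTilingNumber (R \ rowSegment j p (p + 2 * i)) := by
  induction i with
  | zero =>
    intro p R _ _ _
    congr 1
    ext c; simp only [Finset.mem_sdiff, mem_rowSegment]; push_cast; grind
  | succ i ih =>
    intro p R hp hR hl
    push_cast at hR
    have h0 := hR p le_rfl (by omega)
    have h1 := hR (p + 1) (by omega) (by omega)
    -- The up-pointing triangle at `p` has neither a left nor a lower neighbour, so it is joined to
    -- `p + 1`; the same situation then recurs at `p + 2`.
    rw [weightedTilingNumber_expand_up hp h0.1, if_neg hl, if_pos h1.1, if_neg h0.2, zero_add,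
      add_zero, ih (p + 2)]
    · congr 1
      ext ⟨X, k⟩
      simp only [Finset.mem_sdiff, mem_rowSegment, Finset.mem_insert, Finset.mem_singleton,
        Prod.mk.injEq]
      push_cast
      by_cases hX : (X, k) ∈ R <;> simp only [hX, true_and, false_and] ; omega
    · rw [Int.odd_iff] at *; omega
    · intro X hX hX'
      have := hR X (by omega) (by omega)
      simp only [Finset.mem_sdiff, Finset.mem_insert, Finset.mem_singleton, Prod.mk.injEq, this,
        true_and, false_and, not_false_eq_true, and_true]
      omega
    · simp; intro _ _; omega

/-- A segment of even length of the lowest row ending with an up-pointing triangle without right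
neighbour is tiled in exactly one way. -/
theorem weightedTilingNumber_forced_left {j : ℤ} (i : ℕ) : ∀ (q : ℤ) (R : Finset UnitTriangle),
    Even (q + j) → (∀ X, q - 2 * i ≤ X → X < q → (X, j) ∈ R ∧ (X, j - 1) ∉ R) → (q, j) ∉ R →
    weightedTilingNumber R = weightedTilingNumber (R \ rowSegment j (q - 2 * i) q) := by
  induction i with
  | zero =>
    intro p R _ _ _
    congr 1
    ext c; simp only [Finset.mem_sdiff, mem_rowSegment]; push_cast; grind
  | succ i ih =>
    intro q R hq hR hl
    push_cast at hR
    have h0 := hR (q - 1) (by omega) (by omega)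
    have h1 := hR (q - 1 - 1) (by omega) (by omega)
    rw [weightedTilingNumber_expand_up (by rw [Int.odd_iff]; rw [Int.even_iff] at hq; omega) h0.1,
      if_neg (show (q - 1 + 1, j) ∉ R by simpa using hl), if_pos h1.1, if_neg h0.2,
      add_zero, add_zero, ih (q - 2)]
    · congr 1
      ext ⟨X, k⟩
      simp only [Finset.mem_sdiff, mem_rowSegment, Finset.mem_insert, Finset.mem_singleton,
        Prod.mk.injEq]
      push_cast
      by_cases hX : (X, k) ∈ R <;> simp only [hX, true_and, false_and] ; omega
    · rw [Int.even_iff] at *; omega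
    · intro X hX hX'
      have := hR X (by omega) (by omega)
      simp only [Finset.mem_sdiff, Finset.mem_insert, Finset.mem_singleton, Prod.mk.injEq, this,
        true_and, false_and, not_false_eq_true, and_true]
      omega
    · simp; intro _; omega

/-- The down-pointing triangles `p, p + 2, …, p + 2i`. -/
def evenSteps (p : ℤ) (i : ℕ) : Finset ℤ :=
  (Finset.range (i + 1)).image fun t : ℕ => p + 2 * (t : ℤ)

theorem mem_evenSteps {p : ℤ} {i : ℕ} {X : ℤ} :
    X ∈ evenSteps p i ↔ p ≤ X ∧ X ≤ p + 2 * i ∧ Even (X - p) := by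
  simp only [evenSteps, Finset.mem_image, Finset.mem_range]
  constructor
  · rintro ⟨t, ht, rfl⟩
    exact ⟨by omega, by omega, by rw [Int.even_iff]; omega⟩
  · rintro ⟨h1, h2, h3⟩
    rw [Int.even_iff] at h3
    exact ⟨((X - p) / 2).toNat, by omega, by omega⟩

theorem sum_evenSteps_succ (p : ℤ) (i : ℕ) (f : ℤ → ℚ) :
    ∑ X ∈ evenSteps p (i + 1), f X = f p + ∑ X ∈ evenSteps (p + 2) i, f X := by
  have : evenSteps p (i + 1) = insert p (evenSteps (p + 2) i) := by
    ext X
    simp only [Finset.mem_insert, mem_evenSteps, Int.even_iff]; push_cast; omega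
  rw [this, Finset.sum_insert]
  simp [mem_evenSteps]

/-- In a segment of the lowest row that starts and ends with down-pointing triangles and is
bounded by missing triangles, exactly one down-pointing triangle is covered by a vertical
lozenge. -/
theorem weightedTilingNumber_segment {j : ℤ} (i : ℕ) : ∀ (p : ℤ) (R : Finset UnitTriangle),
    Even (p + j) → (∀ X, p ≤ X → X ≤ p + 2 * i → (X, j) ∈ R ∧ (X, j - 1) ∉ R) → (p - 1, j) ∉ R →
    (p + 2 * i + 1, j) ∉ R → (∀ X ∈ evenSteps p i, (X, j + 1) ∈ R) →
    weightedTilingNumber R = ∑ X ∈ evenSteps p i, columnWeight X *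
      weightedTilingNumber (R \ insert (X, j + 1) (rowSegment j p (p + 2 * i + 1))) := by
  induction i with
  | zero =>
    intro p R hp hR hl hr hv
    have h0 := hR p le_rfl (by simp)
    have h1 := hv p (by simp [mem_evenSteps])
    have : evenSteps p 0 = {p} := by simp [evenSteps]
    rw [weightedTilingNumber_expand_down hp h0.1, if_neg hl, if_neg (by simpa using hr),
      if_pos h1, this, Finset.sum_singleton, zero_add, zero_add]
    congr 2
    ext ⟨X, k⟩
    simp only [Finset.mem_sdiff, mem_rowSegment, Finset.mem_insert, Finset.mem_singleton,
      Prod.mk.injEq]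
    push_cast
    by_cases hX : (X, k) ∈ R <;> simp only [hX, true_and, false_and] ; omega
  | succ i ih =>
    intro p R hp hR hl hr hv
    push_cast at hR hr
    have h0 := hR p le_rfl (by omega)
    have h1 := hR (p + 1) (by omega) (by omega)
    have h2 := hv p (by rw [mem_evenSteps]; simp; omega)
    -- The leftmost down-pointing triangle is either covered by a vertical lozenge, and then the
    -- rest of the segment is forced, or joined to `p + 1`, and then the segment starts at `p + 2`.
    rw [weightedTilingNumber_expand_down hp h0.1, if_neg hl, if_pos h1.1, if_pos h2,
      sum_evenSteps_succ, zero_add, add_comm]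
    rw [Int.even_iff] at hp
    congr 1
    · congr 1
      rw [weightedTilingNumber_forced_right (j := j) (i + 1) (p + 1)]
      · congr 1
        ext ⟨X, k⟩
        simp only [Finset.mem_sdiff, mem_rowSegment, Finset.mem_insert, Finset.mem_singleton,
          Prod.mk.injEq]
        push_cast
        by_cases hX : (X, k) ∈ R <;> simp only [hX, true_and, false_and] ; omega
      · rw [Int.odd_iff]; omega
      · intro X hX hX'
        push_cast at hX'
        have := hR X (by omega) (by omega)
        simp only [Finset.mem_sdiff, Finset.mem_insert, Finset.mem_singleton, Prod.mk.injEq, this,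
          true_and, false_and, not_false_eq_true, and_true]
        omega
      · simp
    · rw [ih (p + 2)]
      · refine Finset.sum_congr rfl fun Y hY => ?_
        rw [mem_evenSteps] at hY
        congr 2
        ext ⟨X, k⟩
        simp only [Finset.mem_sdiff, mem_rowSegment, Finset.mem_insert, Finset.mem_singleton,
          Prod.mk.injEq]
        push_cast
        by_cases hX : (X, k) ∈ R <;> simp only [hX, true_and, false_and] ; omega
      · rw [Int.even_iff]; omega
      · intro X hX hX'
        have := hR X (by omega) (by omega)
        simp only [Finset.mem_sdiff, Finset.mem_insert, Finset.mem_singleton, Prod.mk.injEq, this,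
          true_and, false_and, not_false_eq_true, and_true]
        omega
      · simp; intro _ _; omega
      · rw [show p + 2 + 2 * (i : ℤ) + 1 = p + 2 * (i + 1) + 1 by ring]
        simp [hr]
      · intro X hX
        have h3 := hv X (by rw [mem_evenSteps, Int.even_iff] at *; push_cast; omega)
        simp only [Finset.mem_sdiff, h3, Finset.mem_insert, Finset.mem_singleton, Prod.mk.injEq,
          true_and]
        omega

theorem sum_piFinset_succ {n : ℕ} (s : Fin (n + 1) → Finset ℤ) (f : (Fin (n + 1) → ℤ) → ℚ) :
    ∑ v ∈ Fintype.piFinset s, f v =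
      ∑ x ∈ s 0, ∑ v ∈ Fintype.piFinset (fun i => s i.succ), f (Fin.cons x v) := by
  rw [← Finset.sum_product']
  refine Finset.sum_bij' (fun v _ => (v 0, Fin.tail v)) (fun p _ => Fin.cons p.1 p.2) ?_ ?_ ?_ ?_ ?_
  · intro v hv
    rw [Fintype.mem_piFinset] at hv
    simp [Fin.tail, hv]
  · rintro ⟨x, v⟩ h
    simp only [Finset.mem_product, Fintype.mem_piFinset] at h ⊢
    exact Fin.cases (by simpa using h.1) (fun i => by simpa using h.2 i)
  · intro v _; simp
  · intro v _; simp
  · intro v _; simp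

/-- Simultaneous expansion along finitely many segments of the lowest row. -/
theorem weightedTilingNumber_segments {j : ℤ} {n : ℕ} : ∀ (p : Fin n → ℤ) (i : Fin n → ℕ)
    (R : Finset UnitTriangle), (∀ a, Even (p a + j)) →
    (∀ a, ∀ X, p a ≤ X → X ≤ p a + 2 * i a → (X, j) ∈ R ∧ (X, j - 1) ∉ R) →
    (∀ a, (p a - 1, j) ∉ R) → (∀ a, (p a + 2 * i a + 1, j) ∉ R) →
    (∀ a, ∀ X ∈ evenSteps (p a) (i a), (X, j + 1) ∈ R) →
    (∀ a b, a < b → p a + 2 * i a < p b) →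
    weightedTilingNumber R = ∑ v ∈ Fintype.piFinset fun a => evenSteps (p a) (i a),
      (∏ a, columnWeight (v a)) * weightedTilingNumber {c ∈ R | ¬ ∃ a, c = (v a, j + 1) ∨
        c ∈ rowSegment j (p a) (p a + 2 * i a + 1)} := by
  induction n with
  | zero =>
    intro p i R _ _ _ _ _ _
    simp
  | succ n ih =>
    intro p i R hp hR hl hr hv hpi
    rw [weightedTilingNumber_segment (i 0) (p 0) R (hp 0) (hR 0) (hl 0) (hr 0) (hv 0),
      sum_piFinset_succ]
    refine Finset.sum_congr rfl fun Y hY => ?_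
    rw [mem_evenSteps] at hY
    rw [ih (fun a => p a.succ) (fun a => i a.succ), Finset.mul_sum]
    · refine Finset.sum_congr rfl fun v _ => ?_
      rw [Fin.prod_univ_succ, ← mul_assoc]
      simp only [Fin.cons_zero, Fin.cons_succ]
      congr 2
      ext c
      simp only [Finset.mem_filter, Finset.mem_sdiff, Finset.mem_insert, Fin.exists_fin_succ,
        Fin.cons_zero, Fin.cons_succ]
      rw [and_assoc, ← not_or]
    · exact fun a => hp a.succ
    · intro a X hX hX'
      have h1 := hR a.succ X hX hX'
      have h2 := hpi 0 a.succ (Fin.succ_pos a)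
      simp only [Finset.mem_sdiff, Finset.mem_insert, mem_rowSegment, Prod.mk.injEq, h1,
        true_and, false_and, not_false_eq_true, and_true]
      omega
    · intro a h
      exact hl a.succ (Finset.mem_sdiff.1 h).1
    · intro a h
      exact hr a.succ (Finset.mem_sdiff.1 h).1
    · intro a X hX
      have h1 := hv a.succ X hX
      have h2 := hpi 0 a.succ (Fin.succ_pos a)
      rw [mem_evenSteps] at hX
      simp only [Finset.mem_sdiff, Finset.mem_insert, mem_rowSegment, Prod.mk.injEq, h1,
        true_and]
      omega
    · exact fun a b hab => hpi a.succ b.succ (Fin.succ_lt_succ_iff.2 hab)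

/-! ### Trapezoids with unit dents -/

/-- The trapezoid bounded by the levels `l` and `h`, by the zigzag on the left and by a northeastern
side on the right, without the up-pointing triangles on its base in the columns `D`. -/
noncomputable def trapezoid (c l h : ℤ) (D : Finset ℤ) : Finset UnitTriangle :=
  {u ∈ Finset.Ico 0 (c - l) ×ˢ Finset.Ico l h | u.1 + u.2 < c ∧ ¬ (u.2 = l ∧ u.1 ∈ D)}

theorem mem_trapezoid {c l h : ℤ} {D : Finset ℤ} {u : UnitTriangle} : u ∈ trapezoid c l h D ↔
    0 ≤ u.1 ∧ l ≤ u.2 ∧ u.2 < h ∧ u.1 + u.2 < c ∧ ¬ (u.2 = l ∧ u.1 ∈ D) := by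
  simp only [trapezoid, Finset.mem_filter, Finset.mem_product, Finset.mem_Ico]
  constructor
  · rintro ⟨⟨⟨h1, h2⟩, h3, h4⟩, h5⟩; exact ⟨h1, h3, h4, h5⟩
  · rintro ⟨h1, h3, h4, h5⟩; exact ⟨⟨⟨h1, by omega⟩, h3, h4⟩, h5⟩

theorem exists_consecutive {n : ℕ} (d : Fin (n + 1) → ℤ) {X : ℤ} (h0 : d 0 ≤ X)
    (h1 : X < d (Fin.last n)) : ∃ a : Fin n, d a.castSucc ≤ X ∧ X < d a.succ := by
  by_contra! hne
  have : ∀ i, d i ≤ X := fun i => Fin.induction h0 (fun a ha => hne a ha) i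
  exact absurd h1 (not_lt.2 (this _))

/-- The positions interlacing with `d`. -/
def interlacing {n : ℕ} (d : Fin (n + 1) → ℤ) (a : Fin n) : Finset ℤ :=
  evenSteps (d a.castSucc + 1) ((d a.succ - d a.castSucc - 2) / 2).toNat

/-- All dents on one level have the same parity, so the halved difference in `interlacing` is exact,
and strict monotonicity makes it non-negative. -/
theorem mem_interlacing {n : ℕ} {d : Fin (n + 1) → ℤ} (hd : StrictMono d) {r : ℤ}
    (hr : ∀ i, Odd (d i + r)) {a : Fin n} {X : ℤ} :
    X ∈ interlacing d a ↔ d a.castSucc < X ∧ X < d a.succ ∧ Even (X + r) := by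
  have h1 := hd (Fin.castSucc_lt_succ (i := a))
  have h2 := hr a.castSucc
  have h3 := hr a.succ
  rw [Int.odd_iff] at h2 h3
  rw [interlacing, mem_evenSteps, Int.even_iff, Int.even_iff]
  omega

/-- Outside the extreme dents the lowest row is forced. On the right it ends with an up-pointing
triangle at the northeastern side. On the left, for odd `l`, it starts with an up-pointing triangle
at the zigzag; the value `d₀ = -1` stands for a fictitious dent just outside the trapezoid, and then
nothing is left over on that side. -/
theorem weightedTilingNumber_outer_segments {c l h d₀ d₁ : ℤ} {D : Finset ℤ}
    {R : Finset UnitTriangle} (hc : Even c) (hodd₀ : Odd (d₀ + l)) (hodd₁ : Odd (d₁ + l))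
    (h0 : d₀ = -1 ∨ (0 ≤ d₀ ∧ Odd l)) (h0l : d₀ ≤ d₁) (hlast : d₁ + l < c)
    (hmem : ∀ u, u ∈ R ↔ u ∈ trapezoid c (l + 1) h D ∨
      (u.2 = l ∧ 0 ≤ u.1 ∧ u.1 + l < c ∧ (u.1 < d₀ ∨ d₁ < u.1))) :
    weightedTilingNumber R = weightedTilingNumber (trapezoid c (l + 1) h D) := by
  simp only [mem_trapezoid] at hmem
  rw [Int.odd_iff] at h0 hodd₀ hodd₁
  rw [Int.even_iff] at hc
  rw [weightedTilingNumber_forced_left (j := l) ((c - l - d₁ - 1) / 2).toNat (c - l)]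
  · rw [show c - l - 2 * (((c - l - d₁ - 1) / 2).toNat : ℤ) = d₁ + 1 by omega]
    by_cases hd0 : d₀ = -1
    · congr 1
      ext ⟨X, k⟩
      simp only [Finset.mem_sdiff, hmem, mem_rowSegment, mem_trapezoid]
      by_cases hD : X ∈ D <;> simp only [hD, and_true, and_false, not_false_eq_true] <;> omega
    · rw [weightedTilingNumber_forced_right (j := l) (d₀ / 2).toNat 0]
      · rw [show 0 + 2 * ((d₀ / 2).toNat : ℤ) = d₀ by omega]
        congr 1
        ext ⟨X, k⟩
        simp only [Finset.mem_sdiff, hmem, mem_rowSegment, mem_trapezoid]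
        by_cases hD : X ∈ D <;> simp only [hD, and_true, and_false, not_false_eq_true] <;> omega
      · rw [Int.odd_iff]; omega
      · intro X hX hX'
        simp only [Finset.mem_sdiff, hmem, mem_rowSegment]
        grind
      · simp only [Finset.mem_sdiff, hmem, mem_rowSegment]
        omega
  · rw [Int.even_iff]; omega
  · intro X hX hX'
    simp only [hmem]
    grind
  · simp only [hmem]
    omega

theorem mem_trapezoid_sdiff_segments {n : ℕ} {c l h : ℤ} {d : Fin (n + 1) → ℤ} (v : Fin n → ℤ)
    (hd : StrictMono d) (hl : l < h) (u : UnitTriangle) :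
    u ∈ {u ∈ trapezoid c l h (Finset.univ.image d) | ¬ ∃ a : Fin n, u = (v a, l + 1) ∨
        u ∈ rowSegment l (d a.castSucc + 1)
          (d a.castSucc + 1 + (d a.succ - d a.castSucc - 2) + 1)} ↔
      u ∈ trapezoid c (l + 1) h (Finset.univ.image v) ∨
        (u.2 = l ∧ 0 ≤ u.1 ∧ u.1 + l < c ∧ (u.1 < d 0 ∨ d (Fin.last n) < u.1)) := by
  have hlow : ∀ i, d 0 ≤ d i := fun i => hd.monotone (Fin.zero_le i)
  have hhigh : ∀ i, d i ≤ d (Fin.last n) := fun i => hd.monotone (Fin.le_last i)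
  revert u
  rintro ⟨X, k⟩
  simp only [Finset.mem_filter, mem_trapezoid, Finset.mem_image, Finset.mem_univ,
    true_and, mem_rowSegment, Prod.mk.injEq]
  constructor
  · rintro ⟨⟨h1, h2, h3, h4, h5⟩, h6⟩
    by_cases hk : k = l
    · right
      refine ⟨hk, h1, by omega, ?_⟩
      by_contra! hcon
      have hX : X ≠ d (Fin.last n) := fun e => h5 ⟨hk, _, e.symm⟩
      obtain ⟨a, ha1, ha2⟩ := exists_consecutive d hcon.1 (lt_of_le_of_ne hcon.2 hX)
      have hX : X ≠ d a.castSucc := fun e => h5 ⟨hk, _, e.symm⟩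
      exact h6 ⟨a, Or.inr (by omega)⟩
    · left
      refine ⟨h1, by omega, h3, h4, ?_⟩
      rintro ⟨h7, a, rfl⟩
      exact h6 ⟨a, Or.inl ⟨rfl, h7⟩⟩
  · rintro (⟨h1, h2, h3, h4, h5⟩ | ⟨h1, h2, h3, h4⟩)
    · refine ⟨⟨h1, by omega, h3, h4, by omega⟩, ?_⟩
      rintro ⟨a, ⟨rfl, h6⟩ | h6⟩
      · exact h5 ⟨h6, a, rfl⟩
      · omega
    · refine ⟨⟨h2, by omega, by omega, by omega, ?_⟩, ?_⟩
      · rintro ⟨-, i, rfl⟩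
        have := hlow i; have := hhigh i; omega
      · rintro ⟨a, h5 | h5⟩
        · omega
        · have := hlow a.castSucc; have := hhigh a.succ; omega

/-- Removal of the lowest row of a trapezoid with dents: the vertical lozenges on the next level
interlace with the dents. -/
theorem weightedTilingNumber_trapezoid_row {n : ℕ} {c l h : ℤ} {d : Fin (n + 1) → ℤ}
    (hd : StrictMono d) (hc : Even c) (hodd : ∀ i, Odd (d i + l))
    (h0 : d 0 = -1 ∨ (0 ≤ d 0 ∧ Odd l))
    (hlast : d (Fin.last n) + l < c) (hl : l < h) (hh : l + 1 < h ∨ n = 0) :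
    weightedTilingNumber (trapezoid c l h (Finset.univ.image d)) =
      ∑ v ∈ Fintype.piFinset (interlacing d), (∏ a, columnWeight (v a)) *
        weightedTilingNumber (trapezoid c (l + 1) h (Finset.univ.image v)) := by
  have h0' := h0
  rw [Int.odd_iff] at h0
  have hs : ∀ a : Fin n, 2 * (((d a.succ - d a.castSucc - 2) / 2).toNat : ℤ) =
      d a.succ - d a.castSucc - 2 := by
    intro a
    have h1 := hd (Fin.castSucc_lt_succ (i := a))
    have h2 := hodd a.castSucc
    have h3 := hodd a.succ
    rw [Int.odd_iff] at h2 h3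
    omega
  have hlow : ∀ i, d 0 ≤ d i := fun i => hd.monotone (Fin.zero_le i)
  have hhigh : ∀ i, d i ≤ d (Fin.last n) := fun i => hd.monotone (Fin.le_last i)
  have hbetween : ∀ (a : Fin n) (i : Fin (n + 1)), ¬ (d a.castSucc < d i ∧ d i < d a.succ) := by
    rintro a i ⟨h1, h2⟩
    have h1 := hd.lt_iff_lt.1 h1
    have h2 := hd.lt_iff_lt.1 h2
    rw [Fin.lt_def] at h1 h2
    simp at h1 h2
    omega
  -- A gap between two dents needs a next row to receive its vertical lozenge; its index shows `n ≠
  -- 0`, so that row exists.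
  have hh' : ∀ a : Fin n, l + 1 < h := fun a => hh.resolve_right (by have := a.2; omega)
  rw [weightedTilingNumber_segments (j := l) (fun a => d a.castSucc + 1)
    (fun a => ((d a.succ - d a.castSucc - 2) / 2).toNat)]
  · refine Finset.sum_congr rfl fun v _ => ?_
    simp only [hs]
    refine congrArg _ ?_
    exact weightedTilingNumber_outer_segments hc (hodd 0) (hodd _) h0' (hlow _) hlast
      (mem_trapezoid_sdiff_segments v hd hl)
  · intro a
    have := hodd a.castSucc
    rw [Int.odd_iff] at this
    rw [Int.even_iff]; omega
  · intro a X hX hX'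
    rw [hs] at hX'
    have h1 := hlow a.castSucc; have h2 := hhigh a.succ
    simp only [mem_trapezoid, Finset.mem_image, Finset.mem_univ, true_and]
    refine ⟨⟨by omega, le_rfl, hl, by omega, ?_⟩, by omega⟩
    rintro ⟨i, rfl⟩
    exact hbetween a i (by omega)
  · intro a
    simp only [mem_trapezoid, Finset.mem_image, Finset.mem_univ, true_and]
    rintro ⟨-, -, -, -, h5⟩
    exact h5 ⟨a.castSucc, by ring⟩
  · intro a
    rw [hs]
    simp only [mem_trapezoid, Finset.mem_image, Finset.mem_univ, true_and]
    rintro ⟨-, -, -, -, h5⟩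
    exact h5 ⟨a.succ, by ring⟩
  · intro a X hX
    have h3 := (mem_interlacing hd hodd).1 hX
    have h1 := hlow a.castSucc; have h2 := hhigh a.succ
    have := hh' a
    simp only [mem_trapezoid]
    omega
  · intro a b hab
    rw [hs]
    have := hd.monotone (show a.succ ≤ b.castSucc from hab)
    omega

/-! ### Central factorials -/

/-- The even central factorial `∏_{i<j} (e² - (2i+1)²)`. -/
def centralEven (j : ℕ) (e : ℚ) : ℚ := ∏ i ∈ Finset.range j, (e ^ 2 - (2 * i + 1) ^ 2)

/-- The odd central factorial `e ∏_{i<j} (e² - (2i+2)²)`. -/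
def centralOdd (j : ℕ) (e : ℚ) : ℚ := e * ∏ i ∈ Finset.range j, (e ^ 2 - (2 * i + 2) ^ 2)

theorem centralEven_succ (j : ℕ) (e : ℚ) :
    centralEven (j + 1) e = centralEven j e * (e ^ 2 - (2 * j + 1) ^ 2) := by
  simp [centralEven, Finset.prod_range_succ]

theorem centralOdd_succ (j : ℕ) (e : ℚ) :
    centralOdd (j + 1) e = centralOdd j e * (e ^ 2 - (2 * j + 2) ^ 2) := by
  simp [centralOdd, Finset.prod_range_succ, mul_assoc]

/-- A shift by ±1 turns a central factorial of one kind into one of the other kind times a linear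
factor. In the difference of the two shifts the linear factors combine to a constant, so each kind
is a constant multiple of a discrete antiderivative of the other with step 2. This makes the sums
over interlacing positions telescope. -/
theorem centralOdd_add_one (j : ℕ) (e : ℚ) :
    centralOdd j (e + 1) = centralEven j e * (e + 2 * j + 1) := by
  induction j with
  | zero => simp [centralOdd, centralEven]
  | succ j ih => rw [centralOdd_succ, centralEven_succ, ih]; push_cast; ring

theorem centralOdd_sub_one (j : ℕ) (e : ℚ) :
    centralOdd j (e - 1) = centralEven j e * (e - 2 * j - 1) := by
  induction j with
  | zero => simp [centralOdd, centralEven]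
  | succ j ih => rw [centralOdd_succ, centralEven_succ, ih]; push_cast; ring

theorem centralEven_add_one (j : ℕ) (e : ℚ) :
    centralEven (j + 1) (e + 1) = centralOdd j e * (e + 2 * j + 2) := by
  induction j with
  | zero => simp [centralOdd, centralEven]; ring
  | succ j ih => rw [centralEven_succ, ih, centralOdd_succ]; push_cast; ring

theorem centralEven_sub_one (j : ℕ) (e : ℚ) :
    centralEven (j + 1) (e - 1) = centralOdd j e * (e - 2 * j - 2) := by
  induction j with
  | zero => simp [centralOdd, centralEven]; ring
  | succ j ih => rw [centralEven_succ, ih, centralOdd_succ]; push_cast; ring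

theorem sum_evenSteps_telescope (f : ℚ → ℚ) (i : ℕ) : ∀ p : ℤ,
    ∑ X ∈ evenSteps p i, (f (X + 1) - f (X - 1)) = f ((p + 2 * i + 1 : ℤ)) - f ((p - 1 : ℤ)) := by
  induction i with
  | zero => intro p; simp [evenSteps]
  | succ i ih =>
    intro p
    rw [sum_evenSteps_succ, ih]
    push_cast
    ring_nf

theorem sum_interlacing_telescope {n : ℕ} {d : Fin (n + 1) → ℤ} (hd : StrictMono d) {r : ℤ}
    (hr : ∀ i, Odd (d i + r)) (a : Fin n) (f : ℚ → ℚ) :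
    ∑ X ∈ interlacing d a, (f (X + 1) - f (X - 1)) = f (d a.succ) - f (d a.castSucc) := by
  have h1 := hd (Fin.castSucc_lt_succ (i := a))
  have h2 := hr a.castSucc
  have h3 := hr a.succ
  rw [Int.odd_iff] at h2 h3
  rw [interlacing, sum_evenSteps_telescope]
  congr 3 <;> omega

theorem sum_interlacing_centralOdd {n : ℕ} {d : Fin (n + 1) → ℤ} (hd : StrictMono d) {r : ℤ}
    (hr : ∀ i, Odd (d i + r)) (a : Fin n) (j : ℕ) :
    ∑ X ∈ interlacing d a, centralOdd j X =
      1 / (2 * (2 * j + 2)) * (centralEven (j + 1) (d a.succ) - centralEven (j + 1) (d a.castSucc)) := by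
  rw [← sum_interlacing_telescope hd hr, Finset.mul_sum]
  refine Finset.sum_congr rfl fun X _ => ?_
  rw [centralEven_add_one, centralEven_sub_one]
  have : (2 * j + 2 : ℚ) ≠ 0 := by positivity
  field_simp
  ring

theorem sum_interlacing_centralEven {n : ℕ} {d : Fin (n + 1) → ℤ} (hd : StrictMono d) {r : ℤ}
    (hr : ∀ i, Odd (d i + r)) (a : Fin n) (j : ℕ) :
    ∑ X ∈ interlacing d a, centralEven j X =
      1 / (2 * (2 * j + 1)) * (centralOdd j (d a.succ) - centralOdd j (d a.castSucc)) := by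
  rw [← sum_interlacing_telescope hd hr, Finset.mul_sum]
  refine Finset.sum_congr rfl fun X _ => ?_
  rw [centralOdd_add_one, centralOdd_sub_one]
  have : (2 * j + 1 : ℚ) ≠ 0 := by positivity
  field_simp
  ring

/-- The telescoping sum over the gap after the fictitious dent -1 has the lower boundary term
`centralOdd j (-1) = -(2j+1) * centralEven j 0`. After normalisation it contributes half of
`centralEven j 0`, which is exactly the part of the summand in column 0 that the weight 1/2 takes
away. The later gaps do not contain column 0. -/
theorem sum_interlacing_weighted {n : ℕ} {d : Fin (n + 1) → ℤ} (hd : StrictMono d)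
    (hodd : ∀ i, Odd (d i)) (h0 : d 0 = -1) (a : Fin n) (j : ℕ) :
    ∑ X ∈ interlacing d a, columnWeight X * centralEven j X =
      1 / (2 * (2 * j + 1)) * (centralOdd j (d a.succ) -
        if (a : ℕ) = 0 then 0 else centralOdd j (d a.castSucc)) := by
  have hr : ∀ i, Odd (d i + 0) := by simpa using hodd
  have h1 : ∑ X ∈ interlacing d a, columnWeight X * centralEven j X =
      ∑ X ∈ interlacing d a, centralEven j X -
        ∑ X ∈ interlacing d a, if X = 0 then centralEven j 0 / 2 else 0 := by
    rw [← Finset.sum_sub_distrib]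
    refine Finset.sum_congr rfl fun X _ => ?_
    unfold columnWeight
    split_ifs with h
    · subst h; push_cast; ring
    · ring
  rw [h1, sum_interlacing_centralEven hd hr, Finset.sum_ite_eq']
  have hm : (0 : ℤ) ∈ interlacing d a ↔ (a : ℕ) = 0 := by
    rw [mem_interlacing hd hr]
    constructor
    · rintro ⟨h2, -⟩
      by_contra ha
      have : d 0 < d a.castSucc := hd (by rw [Fin.lt_def]; simp; omega)
      omega
    · intro ha
      have e : a.castSucc = 0 := by ext; simpa using ha
      have h3 : d 0 < d a.succ := hd (Fin.succ_pos a)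
      have h4 := Int.odd_iff.1 (hodd a.succ)
      rw [e]
      exact ⟨by omega, by omega, by simp⟩
  by_cases ha : (a : ℕ) = 0
  · rw [if_pos (hm.2 ha), if_pos ha]
    have e : a.castSucc = 0 := by ext; simpa using ha
    have := centralOdd_sub_one j 0
    rw [e, h0]
    push_cast
    rw [zero_sub] at this
    rw [this]
    have : (2 * j + 1 : ℚ) ≠ 0 := by positivity
    field_simp
    ring
  · rw [if_neg (fun h => ha (hm.1 h)), if_neg ha]
    ring

/-! ### Determinants -/

/-- Row `i` depends on `v i` only, so multilinearity in the rows moves the independent sums inside.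
-/
theorem sum_piFinset_det {n : ℕ} (s : Fin n → Finset ℤ) (g : Fin n → Fin n → ℤ → ℚ) :
    ∑ v ∈ Fintype.piFinset s, Matrix.det (Matrix.of fun i j => g i j (v i)) =
      Matrix.det (Matrix.of fun i j => ∑ X ∈ s i, g i j X) := by
  have := MultilinearMap.map_sum_finset
    (Matrix.detRowAlternating (n := Fin n) (R := ℚ)).toMultilinearMap
    (fun (i : Fin n) (X : ℤ) (j : Fin n) => g i j X) s
  have e : (Matrix.of fun i j => ∑ X ∈ s i, g i j X) =
      fun i => ∑ X ∈ s i, fun j => g i j X := by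
    ext i j
    simp [Finset.sum_apply]
  rw [e]
  exact this.symm

/-- Subtracting from each row its predecessor reduces the constant first column to a single 1 in the
top row; expansion along that column leaves the matrix of differences. -/
theorem det_succ_sub_castSucc {n : ℕ} (g : Fin (n + 1) → Fin (n + 1) → ℚ) (h : ∀ i, g i 0 = 1) :
    Matrix.det (Matrix.of fun i j : Fin n => g i.succ j.succ - g i.castSucc j.succ) =
      Matrix.det (Matrix.of g) := by
  have h1 : Matrix.det (Matrix.of g) = Matrix.det (Matrix.of (Fin.cons (g 0)
      (fun i : Fin n => g i.succ - g i.castSucc)) : Matrix (Fin (n + 1)) (Fin (n + 1)) ℚ) := by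
    refine Matrix.det_eq_of_forall_row_eq_smul_add_pred (fun _ => 1) ?_ ?_
    · intro j; simp
    · intro i j; simp
  rw [h1, Matrix.det_succ_column_zero, Fin.sum_univ_succ]
  simp [h]
  rfl

/-- The same row operations, but the top row is kept as it is, so the size does not drop. This
matches the first gap in `sum_interlacing_weighted`, which has no lower boundary term. -/
theorem det_sub_pred {n : ℕ} (g : Fin n → Fin n → ℚ) (f : Fin n → Fin n → ℚ)
    (hf : ∀ i : Fin n, ∀ j, f i j = g i j - if h : (i : ℕ) = 0 then 0 else
      g ⟨i - 1, by omega⟩ j) :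
    Matrix.det (Matrix.of f) = Matrix.det (Matrix.of g) := by
  cases n with
  | zero => simp
  | succ n =>
    symm
    refine Matrix.det_eq_of_forall_row_eq_smul_add_pred (fun _ => 1) ?_ ?_
    · intro j; simp [hf]
    · intro i j
      simp only [Matrix.of_apply, hf]
      simp only [Fin.val_succ, Nat.add_eq_zero_iff, one_ne_zero, and_false, dite_false, one_mul,
        Nat.add_sub_cancel]
      exact (sub_add_cancel _ _).symm

/-! ### The tiling numbers of trapezoids with unit dents -/

/-- The constant in the product formula for trapezoids of even height. -/
def evenHeightConst (n : ℕ) : ℚ := ∏ i ∈ Finset.range n, (1 / (2 ^ (2 * i + 1) * (2 * i + 1)! : ℚ))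

/-- The constant in the product formula for trapezoids of odd height. -/
def oddHeightConst (n : ℕ) : ℚ := ∏ i ∈ Finset.range n, (1 / (2 ^ (2 * i) * (2 * i)! : ℚ))

theorem evenHeightConst_eq (n : ℕ) :
    evenHeightConst n = oddHeightConst n * ∏ j : Fin n, (1 / (2 * (2 * (j : ℕ) + 1)) : ℚ) := by
  rw [Fin.prod_univ_eq_prod_range (fun j => (1 / (2 * (2 * (j : ℕ) + 1)) : ℚ)), evenHeightConst,
    oddHeightConst, ← Finset.prod_mul_distrib]
  refine Finset.prod_congr rfl fun i _ => ?_
  have : ((2 * i + 1)! : ℚ) = (2 * i + 1) * (2 * i)! := by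
    rw [Nat.factorial_succ]; push_cast; ring
  rw [this, div_mul_div_comm, pow_succ]
  ring_nf

theorem oddHeightConst_succ_eq (n : ℕ) :
    oddHeightConst (n + 1) = evenHeightConst n * ∏ j : Fin n, (1 / (2 * (2 * (j : ℕ) + 2)) : ℚ) := by
  rw [Fin.prod_univ_eq_prod_range (fun j => (1 / (2 * (2 * (j : ℕ) + 2)) : ℚ)), evenHeightConst,
    oddHeightConst, Finset.prod_range_succ', ← Finset.prod_mul_distrib]
  simp only [mul_zero, pow_zero, Nat.factorial_zero, Nat.cast_one, mul_one, div_one]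
  refine Finset.prod_congr rfl fun i _ => ?_
  have : ((2 * (i + 1))! : ℚ) = (2 * i + 2) * (2 * i + 1)! := by
    rw [show 2 * (i + 1) = (2 * i + 1) + 1 by ring, Nat.factorial_succ]; push_cast; ring
  rw [this, div_mul_div_comm, show 2 * (i + 1) = 2 * i + 1 + 1 by ring, pow_succ]
  ring_nf

theorem interlacing_strictMono {n : ℕ} {d : Fin (n + 1) → ℤ} (hd : StrictMono d) {r : ℤ}
    (hr : ∀ i, Odd (d i + r)) {v : Fin n → ℤ} (hv : v ∈ Fintype.piFinset (interlacing d)) :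
    StrictMono v := by
  rw [Fintype.mem_piFinset] at hv
  intro a b hab
  have h1 := (mem_interlacing hd hr).1 (hv a)
  have h2 := (mem_interlacing hd hr).1 (hv b)
  have := hd.monotone (show a.succ ≤ b.castSucc from hab)
  omega

/-- The claim of the determinant formula for trapezoids of even height with `n` dents. -/
def EvenHeightFormula (n : ℕ) : Prop := ∀ (c h : ℤ) (d : Fin n → ℤ), Even c → Even h →
  StrictMono d → (∀ i, Odd (d i)) → (∀ i, 0 ≤ d i) → (∀ i, d i + (h - 2 * n) < c) →
  weightedTilingNumber (trapezoid c (h - 2 * n) h (Finset.univ.image d)) =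
    evenHeightConst n * Matrix.det (Matrix.of fun i j : Fin n => centralOdd j (d i))

/-- The claim of the determinant formula for trapezoids of odd height with `n` dents. -/
def OddHeightFormula (n : ℕ) : Prop := ∀ (c h : ℤ) (d : Fin n → ℤ), Even c → Even h →
  StrictMono d → (∀ i, Even (d i)) → (∀ i, 0 ≤ d i) → (∀ i, d i + (h - 2 * n + 1) < c) →
  weightedTilingNumber (trapezoid c (h - 2 * n + 1) h (Finset.univ.image d)) =
    oddHeightConst n * Matrix.det (Matrix.of fun i j : Fin n => centralEven j (d i))

/-- The `n + 1` dents have `n` gaps, so one row less leaves `n` dents and an even height. The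
crossing lozenges lie strictly to the right of `d 0 ≥ 0`, so none of them has weight 1/2. Summation
produces differences of `centralEven (j + 1)`, and the missing column is the constant `centralEven 0
= 1`. -/
theorem oddHeightFormula_succ {n : ℕ} (ih : EvenHeightFormula n) : OddHeightFormula (n + 1) := by
  intro c h d hc hh hd hev hpos hlt
  push_cast at hlt ⊢
  rw [Int.even_iff] at hh
  have hr : ∀ i, Odd (d i + (h - 2 * (n + 1) + 1)) := by
    intro i
    have := hev i
    rw [Int.even_iff] at this
    rw [Int.odd_iff]; omega
  rw [weightedTilingNumber_trapezoid_row hd hc hr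
    (Or.inr ⟨hpos 0, by rw [Int.odd_iff]; omega⟩) (hlt _) (by omega) (by omega)]
  have key : ∀ v ∈ Fintype.piFinset (interlacing d), (∏ a, columnWeight (v a)) *
      weightedTilingNumber (trapezoid c (h - 2 * (n + 1) + 1 + 1) h (Finset.univ.image v)) =
      evenHeightConst n * Matrix.det (Matrix.of fun i j : Fin n => centralOdd j (v i)) := by
    intro v hv
    have hmono := interlacing_strictMono hd hr hv
    rw [Fintype.mem_piFinset] at hv
    have hv' := fun a => (mem_interlacing hd hr).1 (hv a)
    have hvpos : ∀ a, 0 < v a := fun a => by have := hv' a; have := hpos a.castSucc; omega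
    rw [Finset.prod_eq_one (fun a _ => columnWeight_of_ne (hvpos a).ne'), one_mul,
      show h - 2 * ((n : ℤ) + 1) + 1 + 1 = h - 2 * n by ring]
    refine ih c h v hc (by rw [Int.even_iff]; omega) hmono ?_ (fun a => (hvpos a).le) ?_
    · intro a
      have := (hv' a).2.2
      rw [Int.even_iff] at this
      rw [Int.odd_iff]; omega
    · intro a
      have := (hv' a).2.1
      have := hlt a.succ
      omega
  rw [Finset.sum_congr rfl key, ← Finset.mul_sum, sum_piFinset_det _ (fun _ j X => centralOdd j X)]
  simp only [sum_interlacing_centralOdd hd hr]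
  rw [Matrix.det_mul_row (fun j : Fin n => (1 / (2 * (2 * (j : ℕ) + 2)) : ℚ))
    (fun i j => centralEven (j + 1) (d i.succ) - centralEven (j + 1) (d i.castSucc)),
    ← mul_assoc, ← oddHeightConst_succ_eq]
  congr 1
  exact det_succ_sub_castSucc (fun i j => centralEven j (d i)) (by simp [centralEven])

/-- Here the lowest row starts at the zigzag with a down-pointing triangle, so the part left of the
first dent is a gap as well, and `n` dents again give `n` crossing lozenges. The first of them may
lie in column 0. -/
theorem evenHeightFormula_of_odd {n : ℕ} (hn : 0 < n) (ih : OddHeightFormula n) :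
    EvenHeightFormula n := by
  intro c h d hc hh hd hod hpos hlt
  rw [Int.even_iff] at hh
  have hc' := Int.even_iff.1 hc
  set e : Fin (n + 1) → ℤ := Fin.cons (-1) d with he
  have he0 : e 0 = -1 := rfl
  have hes : ∀ a : Fin n, e a.succ = d a := fun a => rfl
  have hemono : StrictMono e := by
    rw [Fin.strictMono_iff_lt_succ]
    intro a
    rw [hes]
    obtain ⟨m, rfl⟩ : ∃ m, n = m + 1 := ⟨n - 1, by omega⟩
    refine Fin.cases ?_ (fun b => ?_) a
    · have := hpos 0
      rw [Fin.castSucc_zero, he0]; omega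
    · rw [← Fin.succ_castSucc, hes]
      exact hd Fin.castSucc_lt_succ
  have heodd : ∀ i, Odd (e i) := Fin.cases (by rw [he0]; decide) (fun a => hod a)
  have hr : ∀ i, Odd (e i + (h - 2 * n)) := by
    intro i
    have := heodd i
    rw [Int.odd_iff] at this ⊢; omega
  have himg : trapezoid c (h - 2 * n) h (Finset.univ.image d) =
      trapezoid c (h - 2 * n) h (Finset.univ.image e) := by
    ext ⟨X, k⟩
    simp only [mem_trapezoid, Finset.mem_image, Finset.mem_univ, true_and, Fin.exists_fin_succ,
      he0, hes]
    have : ∀ p : Prop, 0 ≤ X → ((-1 = X ∨ p) ↔ p) := fun p hX => by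
      constructor
      · rintro (h | h)
        · omega
        · exact h
      · exact Or.inr
    constructor
    · rintro ⟨h1, h2⟩; rw [this _ h1]; exact ⟨h1, h2⟩
    · rintro ⟨h1, h2⟩; rw [this _ h1] at h2; exact ⟨h1, h2⟩
  have helast : e (Fin.last n) + (h - 2 * n) < c := by
    obtain ⟨m, rfl⟩ : ∃ m, n = m + 1 := ⟨n - 1, by omega⟩
    exact hlt (Fin.last m)
  rw [himg, weightedTilingNumber_trapezoid_row hemono hc hr (Or.inl he0) helast (by omega)
    (by omega)]
  have key : ∀ v ∈ Fintype.piFinset (interlacing e), (∏ a, columnWeight (v a)) *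
      weightedTilingNumber (trapezoid c (h - 2 * n + 1) h (Finset.univ.image v)) =
      oddHeightConst n *
        Matrix.det (Matrix.of fun i j : Fin n => columnWeight (v i) * centralEven j (v i)) := by
    intro v hv
    have hmono := interlacing_strictMono hemono hr hv
    rw [Fintype.mem_piFinset] at hv
    have hv' := fun a => (mem_interlacing hemono hr).1 (hv a)
    have hel : ∀ i, -1 ≤ e i := fun i => he0 ▸ hemono.monotone (Fin.zero_le i)
    have hvpos : ∀ a, 0 ≤ v a := fun a => by have := hv' a; have := hel a.castSucc; omega
    rw [Matrix.det_mul_column (fun i => columnWeight (v i)) (fun i j : Fin n => centralEven j (v i)),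
      ih c h v hc (by rw [Int.even_iff]; omega) hmono ?_ hvpos ?_]
    · rw [mul_left_comm]; rfl
    · intro a
      have := (hv' a).2.2
      rw [Int.even_iff] at this ⊢; omega
    · intro a
      have := (hv' a).2.1
      have := hlt a
      rw [hes] at *
      omega
  rw [Finset.sum_congr rfl key, ← Finset.mul_sum,
    sum_piFinset_det _ (fun _ j X => columnWeight X * centralEven j X)]
  simp only [sum_interlacing_weighted hemono heodd he0]
  rw [Matrix.det_mul_row (fun j : Fin n => (1 / (2 * (2 * (j : ℕ) + 1)) : ℚ))
    (fun a j => centralOdd j (e a.succ) - if (a : ℕ) = 0 then 0 else centralOdd j (e a.castSucc)),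
    ← mul_assoc, ← evenHeightConst_eq]
  congr 1
  refine det_sub_pred (fun i j : Fin n => centralOdd j (d i)) _ ?_
  intro i j
  rw [hes]
  congr 1
  split_ifs with h0
  · rfl
  · have : i.castSucc = (⟨i - 1, by omega⟩ : Fin n).succ := by
      ext; simp; omega
    rw [this, hes]

theorem evenHeightFormula (n : ℕ) : EvenHeightFormula n := by
  induction n with
  | zero =>
    intro c h d _ _ _ _ _ _
    have : trapezoid c (h - 2 * ((0 : ℕ) : ℤ)) h (Finset.univ.image d) = ∅ := by
      ext u; simp [mem_trapezoid]; omega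
    rw [this]
    simp [evenHeightConst]
  | succ n ih => exact evenHeightFormula_of_odd (Nat.succ_pos n) (oddHeightFormula_succ ih)

theorem oddHeightFormula (n : ℕ) : OddHeightFormula n := by
  cases n with
  | zero =>
    intro c h d _ _ _ _ _ _
    have : trapezoid c (h - 2 * ((0 : ℕ) : ℤ) + 1) h (Finset.univ.image d) = ∅ := by
      ext u; simp [mem_trapezoid]; omega
    rw [this]
    simp [oddHeightConst]
  | succ n => exact oddHeightFormula_succ (evenHeightFormula n)

/-! ### Product formulas in terms of dent sets -/

/-- The Vandermonde product `∏_{u < v} (v² - u²)` of a set of integers. -/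
def squareVandermonde (D : Finset ℤ) : ℚ :=
  ∏ u ∈ D, ∏ v ∈ D with u < v, ((v : ℚ) ^ 2 - (u : ℚ) ^ 2)

theorem squareVandermonde_image {n : ℕ} {d : Fin n → ℤ} (hd : StrictMono d) :
    squareVandermonde (Finset.univ.image d) =
      Matrix.det (Matrix.vandermonde fun i => (d i : ℚ) ^ 2) := by
  rw [Matrix.det_vandermonde, squareVandermonde, Finset.prod_image (fun a _ b _ h => hd.injective h)]
  refine Finset.prod_congr rfl fun i _ => ?_
  have : ({v ∈ Finset.univ.image d | d i < v} : Finset ℤ) = (Finset.Ioi i).image d := by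
    ext v
    simp only [Finset.mem_filter, Finset.mem_image, Finset.mem_univ, true_and, Finset.mem_Ioi]
    constructor
    · rintro ⟨⟨a, rfl⟩, h⟩
      exact ⟨a, hd.lt_iff_lt.1 h, rfl⟩
    · rintro ⟨a, h, rfl⟩
      exact ⟨⟨a, rfl⟩, hd h⟩
  rw [this, Finset.prod_image (fun a _ b _ h => hd.injective h)]

/-- Column `j` holds a monic polynomial of degree `j` in the square of `d i`; unitriangular column
operations reduce these to powers, whatever the roots are. -/
theorem det_monic_products {n : ℕ} (d : Fin n → ℤ) (r : ℕ → ℚ) :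
    Matrix.det (Matrix.of fun i j : Fin n => ∏ t ∈ Finset.range j, ((d i : ℚ) ^ 2 - r t)) =
      Matrix.det (Matrix.vandermonde fun i => (d i : ℚ) ^ 2) := by
  rw [Matrix.det_eval_matrixOfPolynomials_eq_det_vandermonde _
    (fun j : Fin n => ∏ t ∈ Finset.range j, (Polynomial.X - Polynomial.C (r t)))]
  · congr 1
    ext i j
    simp [Polynomial.eval_prod]
  · intro i
    rw [Polynomial.natDegree_finsetProd_X_sub_C_eq_card]
    simp
  · intro i
    exact Polynomial.monic_prod_X_sub_C _ _

theorem image_orderEmbOfFin {k : ℕ} {S : Finset ℤ} (hS : S.card = k) :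
    Finset.univ.image (S.orderEmbOfFin hS) = S := by
  ext X
  rw [← Finset.mem_coe (s := S), ← S.range_orderEmbOfFin hS]
  simp

/-- Trapezoids of even height `2n` with `n` dents. -/
theorem weightedTilingNumber_even_height {c h : ℤ} {D : Finset ℤ} (hc : Even c) (hh : Even h)
    (hodd : ∀ X ∈ D, Odd X) (hpos : ∀ X ∈ D, 0 ≤ X) (hlt : ∀ X ∈ D, X + (h - 2 * D.card) < c) :
    weightedTilingNumber (trapezoid c (h - 2 * D.card) h D) =
      evenHeightConst D.card * ((∏ X ∈ D, (X : ℚ)) * squareVandermonde D) := by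
  set d := D.orderEmbOfFin rfl
  have himg : Finset.univ.image d = D := image_orderEmbOfFin rfl
  have hm : ∀ i, d i ∈ D := fun i => D.orderEmbOfFin_mem rfl i
  have key := evenHeightFormula D.card c h d hc hh d.strictMono (fun i => hodd _ (hm i))
    (fun i => hpos _ (hm i)) (fun i => hlt _ (hm i))
  rw [himg] at key
  rw [key]
  congr 1
  simp only [centralOdd]
  rw [Matrix.det_mul_column (fun i => (d i : ℚ))
    (fun i j => ∏ t ∈ Finset.range j, ((d i : ℚ) ^ 2 - (2 * t + 2) ^ 2))]
  have h1 := det_monic_products d (fun t => (2 * (t : ℚ) + 2) ^ 2)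
  have h2 := squareVandermonde_image d.strictMono
  rw [himg] at h2
  rw [h2, ← h1]
  congr 1
  conv_rhs => rw [← himg, Finset.prod_image (fun a _ b _ h => d.injective h)]

/-- Trapezoids of odd height `2n - 1` with `n` dents. -/
theorem weightedTilingNumber_odd_height {c h : ℤ} {D : Finset ℤ} (hc : Even c) (hh : Even h)
    (heven : ∀ X ∈ D, Even X) (hpos : ∀ X ∈ D, 0 ≤ X)
    (hlt : ∀ X ∈ D, X + (h - 2 * D.card + 1) < c) :
    weightedTilingNumber (trapezoid c (h - 2 * D.card + 1) h D) =
      oddHeightConst D.card * squareVandermonde D := by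
  set d := D.orderEmbOfFin rfl
  have himg : Finset.univ.image d = D := image_orderEmbOfFin rfl
  have hm : ∀ i, d i ∈ D := fun i => D.orderEmbOfFin_mem rfl i
  have key := oddHeightFormula D.card c h d hc hh d.strictMono (fun i => heven _ (hm i))
    (fun i => hpos _ (hm i)) (fun i => hlt _ (hm i))
  rw [himg] at key
  rw [key]
  congr 1
  have h1 := det_monic_products d (fun t => (2 * (t : ℚ) + 1) ^ 2)
  have h2 := squareVandermonde_image d.strictMono
  rw [himg] at h2
  rw [h2, ← h1]
  rfl

theorem squareVandermonde_pos {D : Finset ℤ} (hpos : ∀ X ∈ D, 0 ≤ X) : 0 < squareVandermonde D := by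
  refine Finset.prod_pos fun u hu => Finset.prod_pos fun v hv => ?_
  have h1 : (0 : ℚ) ≤ u := by exact_mod_cast hpos u hu
  have h2 : (u : ℚ) < v := by exact_mod_cast (Finset.mem_filter.1 hv).2
  nlinarith

theorem squareVandermonde_union {S A : Finset ℤ} (h : ∀ s ∈ S, ∀ a ∈ A, s < a) :
    squareVandermonde (S ∪ A) = squareVandermonde S * squareVandermonde A *
      ∏ s ∈ S, ∏ a ∈ A, ((a : ℚ) ^ 2 - (s : ℚ) ^ 2) := by
  have hdis : Disjoint S A := by
    rw [Finset.disjoint_left]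
    exact fun x hx hx' => lt_irrefl _ (h x hx x hx')
  unfold squareVandermonde
  rw [Finset.prod_union hdis]
  have h1 : ∀ u ∈ S, ∏ v ∈ S ∪ A with u < v, ((v : ℚ) ^ 2 - (u : ℚ) ^ 2) =
      (∏ v ∈ S with u < v, ((v : ℚ) ^ 2 - (u : ℚ) ^ 2)) * ∏ a ∈ A, ((a : ℚ) ^ 2 - (u : ℚ) ^ 2) := by
    intro u hu
    rw [Finset.filter_union, Finset.prod_union (Finset.disjoint_filter_filter hdis),
      Finset.filter_true_of_mem (h u hu)]
  have h2 : ∀ u ∈ A, ∏ v ∈ S ∪ A with u < v, ((v : ℚ) ^ 2 - (u : ℚ) ^ 2) =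
      ∏ v ∈ A with u < v, ((v : ℚ) ^ 2 - (u : ℚ) ^ 2) := by
    intro u hu
    rw [Finset.filter_union, Finset.filter_false_of_mem (fun s hs => (h s hs u hu).not_gt),
      Finset.empty_union]
  rw [Finset.prod_congr rfl h1, Finset.prod_congr rfl h2, Finset.prod_mul_distrib]
  ring

/-- The number of dents is determined by the trapezoid. -/
theorem card_eq_of_trapezoid_ne_zero {c l h : ℤ} {D D' : Finset ℤ} (hlh : l < h)
    (hD : ∀ X ∈ D, Odd (X + l) ∧ 0 ≤ X ∧ X + l < c)
    (hD' : ∀ X ∈ D', Odd (X + l) ∧ 0 ≤ X ∧ X + l < c)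
    (h1 : weightedTilingNumber (trapezoid c l h D) ≠ 0)
    (h2 : weightedTilingNumber (trapezoid c l h D') ≠ 0) : D.card = D'.card := by
  -- Each dent takes one up-pointing triangle from the undented trapezoid, so the surplus of
  -- up-pointing triangles there equals the number of dents of any tileable version.
  have key : ∀ D : Finset ℤ, (∀ X ∈ D, Odd (X + l) ∧ 0 ≤ X ∧ X + l < c) →
      ∑ u ∈ trapezoid c l h ∅, (if IsUp u then (1 : ℤ) else -1) =
        ∑ u ∈ trapezoid c l h D, (if IsUp u then (1 : ℤ) else -1) + D.card := by
    intro D hD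
    have : trapezoid c l h ∅ = trapezoid c l h D ∪ D.image (fun X => (X, l)) := by
      ext ⟨X, k⟩
      simp only [Finset.mem_union, mem_trapezoid, Finset.mem_image, Prod.mk.injEq,
        Finset.notMem_empty, and_false, not_false_eq_true, and_true]
      constructor
      · rintro ⟨h1, h2, h3, h4⟩
        by_cases hX : l = k ∧ X ∈ D
        · exact Or.inr ⟨X, hX.2, rfl, hX.1⟩
        · exact Or.inl ⟨h1, h2, h3, h4, fun h => hX ⟨h.1.symm, h.2⟩⟩
      · rintro (⟨h1, h2, h3, h4, -⟩ | ⟨X, hX, rfl, rfl⟩)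
        · exact ⟨h1, h2, h3, h4⟩
        · have := hD X hX
          exact ⟨this.2.1, le_rfl, hlh, this.2.2⟩
    rw [this, Finset.sum_union, Finset.sum_image (fun a _ b _ h => by simpa using h)]
    · congr 1
      rw [Finset.sum_congr rfl (fun X hX => if_pos (show IsUp (X, l) from (hD X hX).1))]
      simp
    · rw [Finset.disjoint_left]
      rintro u hu hu'
      obtain ⟨X, hX, rfl⟩ := Finset.mem_image.1 hu'
      exact (mem_trapezoid.1 hu).2.2.2.2 ⟨rfl, hX⟩
  have e1 := key D hD
  have e2 := key D' hD'
  rw [sum_orientation_eq_zero h1] at e1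
  rw [sum_orientation_eq_zero h2] at e2
  omega

/-! ### Removing triangles along the base -/

/-- A down-pointing triangle without left and right neighbours can only be joined to the triangle
above it. Away from column 0 this lozenge has weight 1. -/
theorem weightedTilingNumber_forced_vertical {j : ℤ} (F : Finset ℤ) : ∀ (R : Finset UnitTriangle),
    (∀ X ∈ F, X ≠ 0 ∧ Even (X + j) ∧ (X, j) ∈ R ∧ (X, j + 1) ∈ R ∧ (X - 1, j) ∉ R ∧
      (X + 1, j) ∉ R) →
    weightedTilingNumber R =
      weightedTilingNumber {c ∈ R | ¬ (c.1 ∈ F ∧ (c.2 = j ∨ c.2 = j + 1))} := by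
  induction F using Finset.induction_on with
  | empty => intro R _; simp
  | insert X F hXF ih =>
    intro R hR
    obtain ⟨h0, h1, h2, h3, h4, h5⟩ := hR X (Finset.mem_insert_self _ _)
    rw [weightedTilingNumber_expand_down h1 h2, if_neg h4, if_neg h5, if_pos h3,
      columnWeight_of_ne h0, zero_add, zero_add, one_mul, ih]
    · congr 1
      ext ⟨Y, k⟩
      simp only [Finset.mem_filter, Finset.mem_sdiff, Finset.mem_insert, Finset.mem_singleton,
        Prod.mk.injEq]
      grind
    · intro Y hY
      obtain ⟨g0, g1, g2, g3, g4, g5⟩ := hR Y (Finset.mem_insert_of_mem hY)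
      have : Y ≠ X := fun e => hXF (e ▸ hY)
      refine ⟨g0, g1, ?_, ?_, fun h => g4 (Finset.mem_sdiff.1 h).1,
        fun h => g5 (Finset.mem_sdiff.1 h).1⟩ <;> simp [g2, g3, this]

/-- If the up-pointing unit triangles on the base of an up-pointing triangle are missing, the rest
of that triangle is tiled by vertical lozenges. -/
theorem weightedTilingNumber_fill (n : ℕ) : ∀ (l L : ℤ) (R : Finset UnitTriangle), Even (l + L) →
    -1 ≤ l → (∀ u, InUpTriangle l (l + 2 * n) L u → (u ∈ R ↔ ¬ (u.2 = L ∧ Odd (u.1 + u.2)))) →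
    weightedTilingNumber R = weightedTilingNumber {u ∈ R | ¬ InUpTriangle l (l + 2 * n) L u} := by
  induction n with
  | zero =>
    intro l L R _ _ _
    congr 1
    symm
    refine Finset.filter_true_of_mem fun u _ => ?_
    unfold InUpTriangle
    push_cast
    omega
  | succ n ih =>
    intro l L R hlL hl hR
    rw [Int.even_iff] at hlL
    simp only [InUpTriangle, Int.odd_iff] at hR ih ⊢
    push_cast at hR ⊢
    -- The columns of the `n` down-pointing triangles in the lowest row of the triangle of side `n +
    -- 1`. Since `-1 ≤ l` they are positive, so no weight 1/2 occurs.
    have hF : ∀ X, X ∈ (Finset.range n).image (fun t : ℕ => l + 2 + 2 * (t : ℤ)) ↔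
        l + 2 ≤ X ∧ X < l + 2 + 2 * n ∧ (X + L) % 2 = 0 := by
      intro X
      simp only [Finset.mem_image, Finset.mem_range]
      constructor
      · rintro ⟨t, ht, rfl⟩; omega
      · rintro ⟨h1, h2, h3⟩
        exact ⟨((X - l - 2) / 2).toNat, by omega, by omega⟩
    -- The forced vertical lozenges use up the up-pointing triangles on the base of the triangle of
    -- side `n` one row higher, with left end `l + 1`; the situation repeats there.
    rw [weightedTilingNumber_forced_vertical (j := L)
      ((Finset.range n).image (fun t : ℕ => l + 2 + 2 * (t : ℤ))),
      ih (l + 1) (L + 1)]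
    · congr 1
      ext ⟨X, k⟩
      simp only [Finset.mem_filter, hF]
      by_cases hX : (X, k) ∈ R
      · have := fun hh => (hR (X, k) hh).1 hX
        simp only at this
        simp only [hX, true_and]
        omega
      · simp [hX]
    · rw [Int.even_iff]; omega
    · omega
    · rintro ⟨X, k⟩ hu
      simp only [Finset.mem_filter, hF]
      rw [hR (X, k) (by simp only at *; omega)]
      simp only at *
      omega
    · intro X hX
      rw [hF] at hX
      refine ⟨by omega, by rw [Int.even_iff]; omega, ?_, ?_, ?_, ?_⟩ <;>
        rw [hR _ (by simp only; omega)] <;> try rw [not_not]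
      all_goals simp only [true_and]
      all_goals omega

/-- Simultaneous removal of finitely many triangles along a level. -/
theorem weightedTilingNumber_fill_many {ι : Type*} [DecidableEq ι] (K : Finset ι) (l : ι → ℤ)
    (n : ι → ℕ) (L : ℤ) : ∀ (R : Finset UnitTriangle),
    (∀ k ∈ K, Even (l k + L) ∧ -1 ≤ l k) →
    (∀ k ∈ K, ∀ m ∈ K, k ≠ m → l k + 2 * n k ≤ l m ∨ l m + 2 * n m ≤ l k) →
    (∀ k ∈ K, ∀ u, InUpTriangle (l k) (l k + 2 * n k) L u →
      (u ∈ R ↔ ¬ (u.2 = L ∧ Odd (u.1 + u.2)))) →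
    weightedTilingNumber R = weightedTilingNumber
      {u ∈ R | ¬ ∃ k ∈ K, InUpTriangle (l k) (l k + 2 * n k) L u} := by
  induction K using Finset.induction_on with
  | empty => intro R _ _ _; simp
  | insert k K hkK ih =>
    intro R h1 h2 h3
    rw [weightedTilingNumber_fill (n k) (l k) L R (h1 k (Finset.mem_insert_self _ _)).1
      (h1 k (Finset.mem_insert_self _ _)).2 (h3 k (Finset.mem_insert_self _ _)), ih]
    · congr 1
      ext u
      simp only [Finset.mem_filter, Finset.exists_mem_insert, not_or, and_assoc]
    · exact fun m hm => h1 m (Finset.mem_insert_of_mem hm)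
    · exact fun m hm m' hm' => h2 m (Finset.mem_insert_of_mem hm) m' (Finset.mem_insert_of_mem hm')
    · intro m hm u hu
      rw [← h3 m (Finset.mem_insert_of_mem hm) u hu, Finset.mem_filter, and_iff_left_iff_imp]
      intro _ hu'
      have := h2 k (Finset.mem_insert_self _ _) m (Finset.mem_insert_of_mem hm)
        (fun e => hkK (e ▸ hm))
      unfold InUpTriangle at hu hu'
      omega

/-! ### A Hankel determinant -/

/-- The rising factorial `x (x + 1) ⋯ (x + n - 1)`. -/
def rising (x : ℚ) (n : ℕ) : ℚ := ∏ t ∈ Finset.range n, (x + t)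

theorem rising_succ' (x : ℚ) (n : ℕ) : rising x (n + 1) = x * rising (x + 1) n := by
  rw [rising, rising, Finset.prod_range_succ', mul_comm]
  congr 1
  · simp
  · refine Finset.prod_congr rfl fun t _ => ?_
    push_cast; ring

theorem rising_succ (x : ℚ) (n : ℕ) : rising x (n + 1) = rising x n * (x + n) := by
  rw [rising, rising, Finset.prod_range_succ]

/-- The Hankel determinant of a sequence with `u (n + 1) / u n = (a + n) / (b + n)`. -/
theorem det_hankel (k : ℕ) : ∀ (u : ℕ → ℚ) (a b : ℚ), (∀ n : ℕ, b + n ≠ 0) →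
    (∀ n : ℕ, u (n + 1) * (b + n) = (a + n) * u n) →
    Matrix.det (Matrix.of fun i j : Fin k => u (i + j)) =
      ∏ i ∈ Finset.range k, (u 0 * i ! * rising a i * rising (b - a) i /
        (rising b (2 * i) * rising (b + i - 1) i)) := by
  induction k with
  | zero => intro u a b _ _; simp
  | succ k ih =>
    intro u a b hb hu
    -- Row `i + 1` minus `(a + i)/(b + i)` times row `i` of the Hankel matrix. The multiplier makes
    -- the first column vanish below the top; the factor in `B` is the difference `(a+i+j)/(b+i+j) -
    -- (a+i)/(b+i)`.
    set B : Matrix (Fin (k + 1)) (Fin (k + 1)) ℚ := Matrix.of (Fin.cons (fun j => u j)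
      (fun (i : Fin k) (j : Fin (k + 1)) => u (i + j) * (j * (b - a)) / ((b + i + j) * (b + i))))
      with hB
    have hstep : ∀ n : ℕ, u (n + 1) = (a + n) / (b + n) * u n := by
      intro n
      have := hb n
      rw [div_mul_eq_mul_div, eq_div_iff this, hu]
    have h1 : Matrix.det (Matrix.of fun i j : Fin (k + 1) => u (i + j)) = Matrix.det B := by
      refine Matrix.det_eq_of_forall_row_eq_smul_add_pred
        (fun i : Fin k => (a + (i : ℕ)) / (b + (i : ℕ))) ?_ ?_
      · intro j; simp [hB]
      · intro i j
        simp only [Matrix.of_apply, hB, Fin.cons_succ, Fin.val_succ, Fin.val_castSucc]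
        rw [show (i : ℕ) + 1 + j = (i + j) + 1 by ring, hstep]
        have e1 := hb (i + j)
        have e2 := hb i
        push_cast at e1 ⊢
        have e3 : b + (i : ℚ) + j ≠ 0 := by rw [add_assoc]; exact e1
        field_simp
        ring
    -- After removal of the row factors `(b - a)/(b + i)` and the column factors `j + 1` the minor
    -- is again a Hankel matrix, of the sequence `u (n + 1) / (b + n + 1)`. Its quotients have the
    -- same form, with parameters `a + 1` and `b + 2`.
    have h2 : Matrix.det B = u 0 * Matrix.det (Matrix.of fun i j : Fin k =>
        ((b - a) / (b + (i : ℕ))) * (((j : ℕ) + 1 : ℚ) * (u (i + j + 1) / (b + (i + j : ℕ) + 1)))) := by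
      rw [Matrix.det_succ_column_zero, Fin.sum_univ_succ]
      rw [Finset.sum_eq_zero, add_zero]
      · simp only [Fin.val_zero, pow_zero, one_mul]
        congr 1
        · congr 1
          ext i j
          simp only [Matrix.submatrix_apply, Fin.succAbove_zero, hB, Matrix.of_apply, Fin.cons_succ,
            Fin.val_succ]
          rw [show (i : ℕ) + (j + 1) = i + j + 1 by ring]
          have e1 := hb (i + j + 1)
          have e2 := hb i
          push_cast at e1 ⊢
          have e3 : b + (i : ℚ) + ((j : ℚ) + 1) ≠ 0 := by convert e1 using 1; ring
          have e4 : b + ((i : ℚ) + j) + 1 ≠ 0 := by convert e1 using 1; ring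
          field_simp
          ring
      · intro i _
        simp [hB]
    rw [h1, h2, Matrix.det_mul_column (fun i : Fin k => (b - a) / (b + (i : ℕ)))
      (fun i j : Fin k => ((j : ℕ) + 1 : ℚ) * (u (i + j + 1) / (b + (i + j : ℕ) + 1)))]
    have h3 := Matrix.det_mul_row (fun j : Fin k => ((j : ℕ) + 1 : ℚ))
      (Matrix.of fun i j : Fin k => u (i + j + 1) / (b + (i + j : ℕ) + 1))
    have h4 := ih (fun n => u (n + 1) / (b + n + 1)) (a + 1) (b + 2) (fun n => by
        have := hb (n + 2); push_cast at this; rw [add_assoc, add_comm 2]; exact this) (fun n => by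
        have e1 := hb (n + 1); have e2 := hb (n + 2)
        have := hu (n + 1)
        push_cast at e1 e2 this ⊢
        have e3 : b + (n + 1) + 1 ≠ 0 := by convert e2 using 1; ring
        have e4 : b + n + 1 ≠ 0 := by convert e1 using 1; ring
        field_simp
        linear_combination (b + n + 2) * this)
    have h5 : Matrix.det (fun i j : Fin k => ((j : ℕ) + 1 : ℚ) * (u (i + j + 1) /
        (b + (i + j : ℕ) + 1))) = (∏ j : Fin k, ((j : ℕ) + 1 : ℚ)) * Matrix.det
        (Matrix.of fun i j : Fin k => u (i + j + 1) / (b + (i + j : ℕ) + 1)) := h3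
    rw [h5, h4, Finset.prod_range_succ', Fin.prod_univ_eq_prod_range (fun j => ((j : ℕ) + 1 : ℚ)),
      Fin.prod_univ_eq_prod_range (fun i => (b - a) / (b + (i : ℕ))), ← Finset.prod_mul_distrib,
      ← Finset.prod_mul_distrib, mul_comm]
    congr 1
    · refine Finset.prod_congr rfl fun i _ => ?_
      have e0 := hb 0
      have e1 := hb 1
      have e2 := hb i
      have e5 : rising (b + 2) (2 * i) ≠ 0 := by
        refine Finset.prod_ne_zero_iff.2 fun t _ => ?_
        have := hb (t + 2); push_cast at this; convert this using 1; ring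
      have e6 : rising (b + i + 1) i ≠ 0 := by
        refine Finset.prod_ne_zero_iff.2 fun t _ => ?_
        have := hb (i + t + 1); push_cast at this; convert this using 1; ring
      have hu0 := hstep 0
      rw [show 2 * (i + 1) = 2 * i + 1 + 1 by ring, rising_succ' b, rising_succ' (b + 1),
        rising_succ' (b - a), rising_succ' a, Nat.factorial_succ]
      push_cast
      rw [show b + ((i : ℚ) + 1) - 1 = b + i by ring, rising_succ' (b + i),
        show b + 2 + (i : ℚ) - 1 = b + i + 1 by ring, show b + 1 + 1 = b + 2 by ring,
        show b + 2 - (a + 1) = b - a + 1 by ring, hu0]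
      push_cast at e0 e1 ⊢
      rw [add_zero] at e0
      simp only [add_zero]
      field_simp
    · simp [rising]

/-! ### Sums over subsets -/

theorem det_products_sub {k : ℕ} (f : Fin k → ℤ) (r : ℕ → ℚ) :
    Matrix.det (Matrix.of fun i j : Fin k => ∏ t ∈ Finset.range j, (r t - (f i : ℚ) ^ 2)) =
      (∏ j : Fin k, (-1) ^ (j : ℕ)) * Matrix.det (Matrix.vandermonde fun i => (f i : ℚ) ^ 2) := by
  rw [← det_monic_products f r, ← Matrix.det_mul_row]
  congr 1
  ext i j
  simp only [Matrix.of_apply]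
  conv_rhs => rw [← Finset.card_range (j : ℕ), ← Finset.prod_const, Finset.card_range,
    ← Finset.prod_mul_distrib]
  refine Finset.prod_congr rfl fun t _ => ?_
  ring

/-- A map from `k` indices onto a set of `k` elements is injective, hence the increasing enumeration
of that set composed with a unique permutation. -/
theorem sum_fiber_eq_sum_perm {k : ℕ} {S P : Finset ℤ} (hS : S.card = k) (hP : S ⊆ P)
    (F : (Fin k → ℤ) → ℚ) :
    ∑ f ∈ Fintype.piFinset (fun _ : Fin k => P) with Finset.univ.image f = S, F f =
      ∑ σ : Equiv.Perm (Fin k), F (fun i => S.orderEmbOfFin hS (σ i)) := by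
  symm
  have himg := image_orderEmbOfFin hS
  refine Finset.sum_bij (fun σ _ i => S.orderEmbOfFin hS (σ i)) ?_ ?_ ?_ ?_
  · intro σ _
    simp only [Finset.mem_filter, Fintype.mem_piFinset]
    refine ⟨fun i => hP (S.orderEmbOfFin_mem hS _), ?_⟩
    refine Eq.trans ?_ himg
    ext X
    simp only [Finset.mem_image, Finset.mem_univ, true_and]
    exact ⟨fun ⟨i, hi⟩ => ⟨σ i, hi⟩, fun ⟨i, hi⟩ => ⟨σ.symm i, by simpa using hi⟩⟩
  · intro σ _ τ _ h
    ext i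
    have := congrFun h i
    simpa using congrArg Fin.val ((S.orderEmbOfFin hS).injective this)
  · intro f hf
    simp only [Finset.mem_filter, Fintype.mem_piFinset] at hf
    have hfS : ∀ i, f i ∈ Finset.univ.image (S.orderEmbOfFin hS) := fun i => by
      rw [himg, ← hf.2]; exact Finset.mem_image_of_mem _ (Finset.mem_univ i)
    have hinj : Function.Injective f := by
      have : Set.InjOn f (Finset.univ : Finset (Fin k)) :=
        Finset.card_image_iff.1 (by rw [hf.2, hS]; simp)
      simpa using this
    choose g hg using fun i => Finset.mem_image.1 (hfS i)
    have hginj : Function.Injective g := fun i j h => hinj (by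
      rw [← (hg i).2, ← (hg j).2, h])
    refine ⟨Equiv.ofBijective g (Finite.injective_iff_bijective.1 hginj), Finset.mem_univ _, ?_⟩
    funext i
    exact (hg i).2
  · intro σ _; rfl

/-- Discrete Andréief identity for the squares of Vandermonde products. -/
theorem sum_squareVandermonde_sq (k : ℕ) (P : Finset ℤ) (w : ℤ → ℚ) (a b : ℕ → ℚ) :
    ∑ S ∈ P.powersetCard k, (∏ s ∈ S, w s) * squareVandermonde S ^ 2 =
      Matrix.det (Matrix.of fun i j : Fin k => ∑ s ∈ P, w s *
        ((∏ t ∈ Finset.range i, (a t - (s : ℚ) ^ 2)) *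
          ∏ t ∈ Finset.range j, (b t - (s : ℚ) ^ 2))) := by
  rw [← sum_piFinset_det (fun _ => P)]
  -- The sign caused by factors of the form `r - s²` in place of `s² - r`. It appears once for each
  -- of the two bases, hence squared.
  set ε : ℚ := ∏ j : Fin k, (-1) ^ (j : ℕ) with hε
  have hε2 : ε * ε = 1 := by
    rw [hε, ← Finset.prod_mul_distrib]
    refine Finset.prod_eq_one fun j _ => ?_
    rw [← mul_pow]; simp
  have h1 : ∀ f : Fin k → ℤ, Matrix.det (Matrix.of fun i j : Fin k => w (f i) *
        ((∏ t ∈ Finset.range i, (a t - (f i : ℚ) ^ 2)) *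
          ∏ t ∈ Finset.range j, (b t - (f i : ℚ) ^ 2))) =
      (∏ i, w (f i)) * (∏ i : Fin k, ∏ t ∈ Finset.range i, (a t - (f i : ℚ) ^ 2)) *
        (ε * Matrix.det (Matrix.vandermonde fun i => (f i : ℚ) ^ 2)) := by
    intro f
    rw [hε, ← det_products_sub f b, ← Finset.prod_mul_distrib, ← Matrix.det_mul_column]
    congr 1
    ext i j
    simp only [Matrix.of_apply]
    ring
  simp only [h1]
  -- The Vandermonde determinant vanishes unless `f` is injective, so only maps onto sets of `k`
  -- elements contribute.
  have h2 : ∀ f ∈ Fintype.piFinset (fun _ : Fin k => P), ((∏ i, w (f i)) *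
      (∏ i : Fin k, ∏ t ∈ Finset.range i, (a t - (f i : ℚ) ^ 2)) *
        (ε * Matrix.det (Matrix.vandermonde fun i => (f i : ℚ) ^ 2)) ≠ 0) →
      Finset.univ.image f ∈ P.powersetCard k := by
    intro f hf hne
    have hinj : Function.Injective f := by
      have h3 : Matrix.det (Matrix.vandermonde fun i => (f i : ℚ) ^ 2) ≠ 0 := by
        intro h; exact hne (by rw [h]; ring)
      rw [Matrix.det_vandermonde_ne_zero_iff] at h3
      intro i j hij
      exact h3 (by simp [hij])
    rw [Finset.mem_powersetCard]
    constructor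
    · rw [Fintype.mem_piFinset] at hf
      intro X hX
      obtain ⟨i, -, rfl⟩ := Finset.mem_image.1 hX
      exact hf i
    · rw [Finset.card_image_of_injective _ hinj]; simp
  rw [← Finset.sum_filter_of_ne h2, ← Finset.sum_fiberwise_of_maps_to (t := P.powersetCard k)
    (g := fun f => Finset.univ.image f) (fun f hf => (Finset.mem_filter.1 hf).2)]
  refine Finset.sum_congr rfl fun S hS => ?_
  obtain ⟨hSP, hSk⟩ := Finset.mem_powersetCard.1 hS
  have h3 : ({f ∈ ({f ∈ Fintype.piFinset (fun _ : Fin k => P) |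
      Finset.univ.image f ∈ P.powersetCard k} : Finset (Fin k → ℤ)) |
      Finset.univ.image f = S} : Finset (Fin k → ℤ)) =
      {f ∈ Fintype.piFinset (fun _ : Fin k => P) | Finset.univ.image f = S} := by
    ext f
    simp only [Finset.mem_filter]
    exact ⟨fun h => ⟨h.1.1, h.2⟩, fun h => ⟨⟨h.1, h.2 ▸ hS⟩, h.2⟩⟩
  rw [h3, sum_fiber_eq_sum_perm hSk hSP]
  set e := S.orderEmbOfFin hSk
  have himg : Finset.univ.image e = S := image_orderEmbOfFin hSk
  have hV := squareVandermonde_image e.strictMono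
  rw [himg] at hV
  have hw : ∀ σ : Equiv.Perm (Fin k), ∏ i, w (e (σ i)) = ∏ s ∈ S, w s := by
    intro σ
    rw [Equiv.prod_comp σ (fun i => w (e i)), ← himg,
      Finset.prod_image (fun a _ b _ h => e.injective h)]
  have hdet : ∀ σ : Equiv.Perm (Fin k),
      Matrix.det (Matrix.vandermonde fun i => (e (σ i) : ℚ) ^ 2) =
        ((Equiv.Perm.sign σ : ℤ) : ℚ) * squareVandermonde S := by
    intro σ
    rw [hV, ← Matrix.det_permute σ]
    rfl
  -- Within one fibre the signed sum over permutations of the row factors is the Leibniz expansion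
  -- of the determinant of the basis `a`; it supplies the second Vandermonde factor.
  have hφ := det_products_sub e a
  rw [← hV, Matrix.det_apply'] at hφ
  simp only [hw, hdet, Matrix.of_apply] at hφ ⊢
  have : ∀ σ : Equiv.Perm (Fin k), (∏ s ∈ S, w s) *
      (∏ i : Fin k, ∏ t ∈ Finset.range i, (a t - (e (σ i) : ℚ) ^ 2)) *
        (ε * (((Equiv.Perm.sign σ : ℤ) : ℚ) * squareVandermonde S)) =
      (∏ s ∈ S, w s) * ε * squareVandermonde S * (((Equiv.Perm.sign σ : ℤ) : ℚ) *
        ∏ i : Fin k, ∏ t ∈ Finset.range i, (a t - (e (σ i) : ℚ) ^ 2)) := fun σ => by ring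
  simp only [this]
  rw [← Finset.mul_sum, hφ]
  linear_combination (-(∏ s ∈ S, w s) * squareVandermonde S ^ 2) * hε2

/-! ### Moments -/

/-- Compare coefficients in (1-X)^(-(a+1)) · (1-X)^(-(b+1)) = (1-X)^(-(a+b+2)). -/
theorem sum_antidiagonal_choose (a b M : ℕ) :
    ∑ p ∈ Finset.HasAntidiagonal.antidiagonal M, ((a + p.1).choose a * (b + p.2).choose b : ℚ) =
      (a + b + 1 + M).choose (a + b + 1) := by
  have h : (PowerSeries.invOneSubPow ℚ (a + 1)).val * (PowerSeries.invOneSubPow ℚ (b + 1)).val =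
      (PowerSeries.invOneSubPow ℚ (a + b + 1 + 1)).val := by
    rw [← Units.val_mul, ← PowerSeries.invOneSubPow_add, show a + 1 + (b + 1) = a + b + 1 + 1 by ring]
  have h2 := congrArg (PowerSeries.coeff M) h
  rw [PowerSeries.coeff_mul] at h2
  simpa [PowerSeries.invOneSubPow_val_succ_eq_mk_add_choose] using h2

theorem rising_natCast (i N : ℕ) : rising (i + 1) N = N ! * (N + i).choose N := by
  have h := Nat.ascFactorial_eq_factorial_mul_choose i N
  rw [add_comm i N] at h
  rw [← Nat.cast_mul, ← h]
  clear h
  induction N with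
  | zero => simp [rising]
  | succ N ih => rw [rising_succ, ih, Nat.ascFactorial_succ]; push_cast; ring

theorem sum_rising (M N : ℕ) :
    ∑ i ∈ Finset.range (M + 1), rising (i + 1) N * rising ((M - i : ℕ) + 1) N =
      (N ! : ℚ) ^ 2 * (2 * N + 1 + M).choose (2 * N + 1) := by
  have h := sum_antidiagonal_choose N N M
  rw [Finset.Nat.sum_antidiagonal_eq_sum_range_succ_mk, ← two_mul] at h
  rw [← h, Finset.mul_sum]
  refine Finset.sum_congr rfl fun i _ => ?_
  rw [rising_natCast, rising_natCast]
  ring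

/-- The weights `∏_{t<N} ((c + 2t)² - s²)`. -/
def gapProduct (N : ℕ) (c s : ℚ) : ℚ := ∏ t ∈ Finset.range N, ((c + 2 * t) ^ 2 - s ^ 2)

theorem gapProduct_eq_rising (N : ℕ) (c s p q : ℚ) (hp : c - s = 2 * p) (hq : c + s = 2 * q) :
    gapProduct N c s = 4 ^ N * (rising p N * rising q N) := by
  unfold gapProduct rising
  rw [← Finset.prod_mul_distrib, ← Finset.card_range N, ← Finset.prod_const, Finset.card_range,
    ← Finset.prod_mul_distrib]
  refine Finset.prod_congr rfl fun t _ => ?_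
  have : c = p + q := by linarith
  have : s = q - p := by linarith
  subst c s
  ring

theorem choose_eq_div (a b : ℕ) : ((a + b).choose a : ℚ) = (a + b)! / (a ! * b !) := by
  rw [Nat.cast_add_choose]

/-- Moments over `{0, 2, …, 2m}`, with weight `1/2` at the origin. -/
theorem sum_gapProduct_even (m N : ℕ) :
    ∑ u ∈ Finset.range (m + 1), columnWeight (2 * (u : ℤ)) * gapProduct N (2 * (m + 1 : ℕ)) (2 * u) =
      1 / 2 * 4 ^ N * (N ! : ℚ) ^ 2 * (2 * m + 2 * N + 1)! / ((2 * N + 1)! * (2 * m)!) := by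
  have h := sum_rising (2 * m) N
  set f : ℕ → ℚ := fun i => rising (i + 1) N * rising ((2 * m - i : ℕ) + 1) N with hf
  have hsym : ∀ i ≤ 2 * m, f (2 * m - i) = f i := by
    intro i hi
    simp only [hf]
    rw [show 2 * m - (2 * m - i) = i by omega, mul_comm]
  have hg : ∀ u ≤ m, gapProduct N (2 * (m + 1 : ℕ)) (2 * u) = 4 ^ N * f (m + u) := by
    intro u hu
    rw [gapProduct_eq_rising N _ _ ((2 * m - (m + u) : ℕ) + 1) ((m + u : ℕ) + 1), mul_comm (rising _ _)]
    · rw [show 2 * m - (m + u) = m - u by omega, Nat.cast_sub hu]; push_cast; ring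
    · push_cast; ring
  -- The convolution is symmetric about its middle term `i = m`. Folded there, every `u > 0` is met
  -- twice and `u = 0` once, which is what the weight 1/2 at the origin records.
  have h1 : ∑ i ∈ Finset.range (2 * m + 1), f i = 2 * ∑ u ∈ Finset.range (m + 1),
      columnWeight (2 * (u : ℤ)) * f (m + u) := by
    rw [show 2 * m + 1 = m + (m + 1) by ring, Finset.sum_range_add, ← Finset.sum_range_reflect]
    rw [Finset.sum_range_succ', Finset.sum_range_succ' (fun u => columnWeight (2 * (u : ℤ)) * f (m + u))]
    have e1 : ∀ u ∈ Finset.range m, f (m - 1 - u) = f (m + (u + 1)) := by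
      intro u hu
      rw [Finset.mem_range] at hu
      rw [← hsym (m + (u + 1)) (by omega)]
      congr 1; omega
    have e2 : ∀ u ∈ Finset.range m, columnWeight (2 * ((u + 1 : ℕ) : ℤ)) * f (m + (u + 1)) =
        f (m + (u + 1)) := by
      intro u _
      rw [columnWeight_of_ne (by push_cast; omega), one_mul]
    rw [Finset.sum_congr rfl e1, Finset.sum_congr rfl e2]
    simp [columnWeight]
    ring
  rw [Finset.sum_congr rfl (fun u hu => by
    rw [hg u (by rw [Finset.mem_range] at hu; omega), mul_left_comm]), ← Finset.mul_sum]
  rw [h] at h1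
  rw [choose_eq_div, show 2 * N + 1 + 2 * m = 2 * m + 2 * N + 1 by ring] at h1
  have h2 : ∑ u ∈ Finset.range (m + 1), columnWeight (2 * (u : ℤ)) * f (m + u) =
      1 / 2 * ((N ! : ℚ) ^ 2 * ((2 * m + 2 * N + 1)! / ((2 * N + 1)! * (2 * m)!))) := by
    rw [h1]; ring
  rw [h2]
  ring

/-- The symmetric convolution now has the even number `2m + 2` of terms and no middle term, so the
sum is one half of it without any weight. -/
theorem sum_gapProduct_odd_aux (m N : ℕ) :
    ∑ u ∈ Finset.range (m + 1), gapProduct N (2 * (m + 1 : ℕ) + 1) (2 * u + 1) =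
      1 / 2 * 4 ^ N * (N ! : ℚ) ^ 2 * (2 * m + 2 * N + 2)! / ((2 * N + 1)! * (2 * m + 1)!) := by
  have h := sum_rising (2 * m + 1) N
  set f : ℕ → ℚ := fun i => rising (i + 1) N * rising ((2 * m + 1 - i : ℕ) + 1) N with hf
  have hsym : ∀ i ≤ 2 * m + 1, f (2 * m + 1 - i) = f i := by
    intro i hi
    simp only [hf]
    rw [show 2 * m + 1 - (2 * m + 1 - i) = i by omega, mul_comm]
  have hg : ∀ u ≤ m, gapProduct N (2 * (m + 1 : ℕ) + 1) (2 * u + 1) = 4 ^ N * f (m + 1 + u) := by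
    intro u hu
    rw [gapProduct_eq_rising N _ _ ((2 * m + 1 - (m + 1 + u) : ℕ) + 1) ((m + 1 + u : ℕ) + 1),
      mul_comm (rising _ _)]
    · rw [show 2 * m + 1 - (m + 1 + u) = m - u by omega, Nat.cast_sub hu]; push_cast; ring
    · push_cast; ring
  have h1 : ∑ i ∈ Finset.range (2 * m + 1 + 1), f i = 2 * ∑ u ∈ Finset.range (m + 1),
      f (m + 1 + u) := by
    rw [show 2 * m + 1 + 1 = (m + 1) + (m + 1) by ring, Finset.sum_range_add,
      ← Finset.sum_range_reflect]
    have e1 : ∀ u ∈ Finset.range (m + 1), f (m + 1 - 1 - u) = f (m + 1 + u) := by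
      intro u hu
      rw [Finset.mem_range] at hu
      rw [← hsym (m + 1 + u) (by omega)]
      congr 1; omega
    rw [Finset.sum_congr rfl e1]
    ring
  rw [Finset.sum_congr rfl (fun u hu => by
    rw [hg u (by rw [Finset.mem_range] at hu; omega)]), ← Finset.mul_sum]
  rw [h] at h1
  rw [choose_eq_div, show 2 * N + 1 + (2 * m + 1) = 2 * m + 2 * N + 2 by ring] at h1
  have h2 : ∑ u ∈ Finset.range (m + 1), f (m + 1 + u) =
      1 / 2 * ((N ! : ℚ) ^ 2 * ((2 * m + 2 * N + 2)! / ((2 * N + 1)! * (2 * m + 1)!))) := by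
    rw [h1]; ring
  rw [h2]
  ring

/-- Second moments over `{1, 3, …, 2m + 1}`. -/
theorem sum_gapProduct_odd (m N : ℕ) :
    ∑ u ∈ Finset.range (m + 1), (2 * u + 1 : ℚ) ^ 2 * gapProduct N (2 * (m + 1 : ℕ) + 1) (2 * u + 1) =
      1 / 2 * 4 ^ N * (N ! : ℚ) ^ 2 * (2 * m + 2 * N + 3)! /
        ((2 * N + 1)! * (2 * N + 3) * (2 * m)!) := by
  -- With C = 2(m+1+N)+1 the next base after the factors of the gap product, s² = C² - (C² - s²)
  -- reduces the second moment to two unweighted sums, with `N` and `N + 1` factors.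
  have h1 : ∀ u : ℕ, (2 * u + 1 : ℚ) ^ 2 * gapProduct N (2 * (m + 1 : ℕ) + 1) (2 * u + 1) =
      (2 * (m + 1 + N) + 1) ^ 2 * gapProduct N (2 * (m + 1 : ℕ) + 1) (2 * u + 1) -
        gapProduct (N + 1) (2 * (m + 1 : ℕ) + 1) (2 * u + 1) := by
    intro u
    have : gapProduct (N + 1) (2 * (m + 1 : ℕ) + 1) (2 * u + 1) =
        gapProduct N (2 * (m + 1 : ℕ) + 1) (2 * u + 1) *
          ((2 * (m + 1 : ℕ) + 1 + 2 * N) ^ 2 - (2 * u + 1) ^ 2) := by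
      rw [gapProduct, Finset.prod_range_succ]; rfl
    rw [this]; push_cast; ring
  simp only [h1]
  rw [Finset.sum_sub_distrib, ← Finset.mul_sum, sum_gapProduct_odd_aux, sum_gapProduct_odd_aux]
  have f1 : ((N + 1)! : ℚ) = (N + 1) * N ! := by rw [Nat.factorial_succ]; push_cast; ring
  have f2 : ((2 * m + 2 * (N + 1) + 2)! : ℚ) =
      (2 * m + 2 * N + 4) * ((2 * m + 2 * N + 3) * (2 * m + 2 * N + 2)!) := by
    rw [show 2 * m + 2 * (N + 1) + 2 = (2 * m + 2 * N + 2) + 1 + 1 by ring, Nat.factorial_succ,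
      Nat.factorial_succ]; push_cast; ring
  have f3 : ((2 * (N + 1) + 1)! : ℚ) = (2 * N + 3) * ((2 * N + 2) * (2 * N + 1)!) := by
    rw [show 2 * (N + 1) + 1 = (2 * N + 1) + 1 + 1 by ring, Nat.factorial_succ,
      Nat.factorial_succ]; push_cast; ring
  have f4 : ((2 * m + 2 * N + 3)! : ℚ) = (2 * m + 2 * N + 3) * (2 * m + 2 * N + 2)! := by
    rw [Nat.factorial_succ]; push_cast; ring
  have f5 : ((2 * m + 1)! : ℚ) = (2 * m + 1) * (2 * m)! := by
    rw [Nat.factorial_succ]; push_cast; ring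
  rw [f1, f2, f3, f4, f5]
  have g1 : ((2 * N + 1)! : ℚ) ≠ 0 := by positivity
  have g2 : ((2 * m)! : ℚ) ≠ 0 := by positivity
  have g3 : (2 * N + 3 : ℚ) ≠ 0 := by positivity
  have g4 : (2 * m + 1 : ℚ) ≠ 0 := by positivity
  have g5 : (2 * N + 2 : ℚ) ≠ 0 := by positivity
  rw [pow_succ]
  field_simp
  ring

/-! ### Evaluation of the sums over subsets -/

/-- One Andréief basis prolongs the progression of the gap product upwards by `i` factors, the other
downwards by `j`. The integrand of each matrix entry is thus a single gap product with `N + i + j`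
factors. -/
theorem gapProduct_extend (i j N : ℕ) (c s : ℚ) :
    gapProduct N c s * ((∏ t ∈ Finset.range i, ((c + 2 * N + 2 * t) ^ 2 - s ^ 2)) *
      ∏ t ∈ Finset.range j, ((c - 2 - 2 * t) ^ 2 - s ^ 2)) =
      gapProduct (j + N + i) (c - 2 * j) s := by
  unfold gapProduct
  rw [Finset.prod_range_add, Finset.prod_range_add,
    ← Finset.prod_range_reflect (fun t => ((c - 2 * j + 2 * (t : ℕ)) ^ 2 - s ^ 2))]
  have h1 : ∀ t ∈ Finset.range j, ((c - 2 * j + 2 * ((j - 1 - t : ℕ) : ℚ)) ^ 2 - s ^ 2) =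
      ((c - 2 - 2 * t) ^ 2 - s ^ 2) := by
    intro t ht
    rw [Finset.mem_range] at ht
    rw [Nat.sub_sub, Nat.cast_sub (by omega)]
    push_cast; ring
  rw [Finset.prod_congr rfl h1]
  have h2 : ∀ t ∈ Finset.range N, ((c - 2 * j + 2 * ((j + t : ℕ) : ℚ)) ^ 2 - s ^ 2) =
      ((c + 2 * t) ^ 2 - s ^ 2) := by
    intro t _; push_cast; ring
  have h3 : ∀ t ∈ Finset.range i, ((c - 2 * j + 2 * ((j + N + t : ℕ) : ℚ)) ^ 2 - s ^ 2) =
      ((c + 2 * N + 2 * t) ^ 2 - s ^ 2) := by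
    intro t _; push_cast; ring
  rw [Finset.prod_congr rfl h2, Finset.prod_congr rfl h3]
  ring

theorem gapProduct_eq_zero {N t : ℕ} (ht : t < N) {c s : ℚ} (h : c + 2 * t = s) :
    gapProduct N c s = 0 :=
  Finset.prod_eq_zero (Finset.mem_range.2 ht) (by rw [h, sub_self])

/-- The set `{0, 2, …, 2(m - 1)}`. -/
def evenPoints (m : ℕ) : Finset ℤ := (Finset.range m).image fun u : ℕ => 2 * (u : ℤ)

/-- The set `{1, 3, …, 2m - 1}`. -/
def oddPoints (m : ℕ) : Finset ℤ := (Finset.range m).image fun u : ℕ => 2 * (u : ℤ) + 1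

/-- The `j` lower factors vanish at the `j` largest points, so the moment formula applies with `m -
j` points and the progression starting right after them. In the numerator `(2m+2N+2i-1)!` the index
`j` cancels, so a row factor and a column factor split off and the rest depends on `i + j` only. -/
theorem evenPoints_entry {m j : ℕ} (hj : j < m) (N i : ℕ) :
    ∑ s ∈ evenPoints m, columnWeight s * gapProduct N (2 * m) s *
      ((∏ t ∈ Finset.range i, ((2 * m + 2 * N + 2 * t : ℚ) ^ 2 - (s : ℚ) ^ 2)) *
        ∏ t ∈ Finset.range j, ((2 * m - 2 - 2 * t : ℚ) ^ 2 - (s : ℚ) ^ 2)) =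
      ((2 * m + 2 * N + 2 * i - 1)! : ℚ) * ((1 / (2 * (m - 1 - j))! : ℚ) *
        (1 / 2 * 4 ^ (N + (i + j)) * ((N + (i + j))! : ℚ) ^ 2 / (2 * (N + (i + j)) + 1)!)) := by
  obtain ⟨m', rfl⟩ : ∃ m', m = m' + 1 + j := ⟨m - 1 - j, by omega⟩
  rw [evenPoints, Finset.sum_image (fun a _ b _ h => by simpa using h)]
  simp only [mul_assoc (columnWeight _), gapProduct_extend]
  rw [Finset.sum_range_add, Finset.sum_eq_zero (s := Finset.range j), add_zero]
  · have h := sum_gapProduct_even m' (N + (i + j))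
    rw [show 2 * (m' + 1 + j) + 2 * N + 2 * i - 1 = 2 * m' + 2 * (N + (i + j)) + 1 by omega,
      show m' + 1 + j - 1 - j = m' by omega]
    have e : ∀ u ∈ Finset.range (m' + 1), columnWeight (2 * (u : ℤ)) *
        gapProduct (j + N + i) (2 * ((m' + 1 + j : ℕ) : ℚ) - 2 * j) ((2 * (u : ℤ) : ℤ) : ℚ) =
        columnWeight (2 * (u : ℤ)) * gapProduct (N + (i + j)) (2 * (m' + 1 : ℕ)) (2 * u) := by
      intro u _
      rw [show j + N + i = N + (i + j) by ring]
      push_cast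
      ring_nf
    rw [Finset.sum_congr rfl e, h]
    have g1 : ((2 * (N + (i + j)) + 1)! : ℚ) ≠ 0 := by positivity
    have g2 : ((2 * m')! : ℚ) ≠ 0 := by positivity
    field_simp
  · intro u hu
    rw [Finset.mem_range] at hu
    rw [gapProduct_eq_zero (t := u) (by omega), mul_zero]
    push_cast; ring

theorem oddPoints_entry {m j : ℕ} (hj : j < m) (N i : ℕ) :
    ∑ s ∈ oddPoints m, (s : ℚ) ^ 2 * gapProduct N (2 * m + 1) s *
      ((∏ t ∈ Finset.range i, ((2 * m + 1 + 2 * N + 2 * t : ℚ) ^ 2 - (s : ℚ) ^ 2)) *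
        ∏ t ∈ Finset.range j, ((2 * m + 1 - 2 - 2 * t : ℚ) ^ 2 - (s : ℚ) ^ 2)) =
      ((2 * m + 2 * N + 2 * i + 1)! : ℚ) * ((1 / (2 * (m - 1 - j))! : ℚ) *
        (1 / 2 * 4 ^ (N + (i + j)) * ((N + (i + j))! : ℚ) ^ 2 /
          ((2 * (N + (i + j)) + 1)! * (2 * (N + (i + j) : ℕ) + 3)))) := by
  obtain ⟨m', rfl⟩ : ∃ m', m = m' + 1 + j := ⟨m - 1 - j, by omega⟩
  rw [oddPoints, Finset.sum_image (fun a _ b _ h => by simpa using h)]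
  simp only [mul_assoc (_ ^ 2), gapProduct_extend]
  rw [Finset.sum_range_add, Finset.sum_eq_zero (s := Finset.range j), add_zero]
  · have h := sum_gapProduct_odd m' (N + (i + j))
    rw [show 2 * (m' + 1 + j) + 2 * N + 2 * i + 1 = 2 * m' + 2 * (N + (i + j)) + 3 by omega,
      show m' + 1 + j - 1 - j = m' by omega]
    have e : ∀ u ∈ Finset.range (m' + 1), (((2 * (u : ℤ) + 1 : ℤ)) : ℚ) ^ 2 *
        gapProduct (j + N + i) (2 * ((m' + 1 + j : ℕ) : ℚ) + 1 - 2 * j)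
          ((2 * (u : ℤ) + 1 : ℤ) : ℚ) =
        (2 * u + 1 : ℚ) ^ 2 * gapProduct (N + (i + j)) (2 * (m' + 1 : ℕ) + 1) (2 * u + 1) := by
      intro u _
      rw [show j + N + i = N + (i + j) by ring]
      push_cast
      ring_nf
    rw [Finset.sum_congr rfl e, h]
    have g1 : ((2 * (N + (i + j)) + 1)! : ℚ) ≠ 0 := by positivity
    have g2 : ((2 * m')! : ℚ) ≠ 0 := by positivity
    have g3 : (2 * (N + (i + j) : ℕ) + 3 : ℚ) ≠ 0 := by positivity
    field_simp
  · intro u hu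
    rw [Finset.mem_range] at hu
    rw [gapProduct_eq_zero (t := u) (by omega), mul_zero]
    push_cast; ring

theorem rising_nat_add_one (n k : ℕ) : rising (n + 1) k = (n + k)! / n ! := by
  induction k with
  | zero => simp [rising, Nat.factorial_ne_zero]
  | succ k ih =>
    rw [rising_succ, ih, ← add_assoc, Nat.factorial_succ]; push_cast; ring

theorem rising_nat_add_half (n k : ℕ) :
    rising (n + 1 / 2) k = (2 * (n + k))! * n ! / (4 ^ k * (n + k)! * (2 * n)!) := by
  induction k with
  | zero =>
    have h1 : ((2 * n)! : ℚ) ≠ 0 := by positivity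
    have h2 : (n ! : ℚ) ≠ 0 := by positivity
    simp [rising]
    field_simp
  | succ k ih =>
    have e1 : ((2 * (n + (k + 1)))! : ℚ) =
        (2 * (n + k) + 2) * ((2 * (n + k) + 1) * (2 * (n + k))!) := by
      rw [show 2 * (n + (k + 1)) = 2 * (n + k) + 1 + 1 by ring, Nat.factorial_succ,
        Nat.factorial_succ]; push_cast; ring
    have e2 : ((n + (k + 1))! : ℚ) = (n + k + 1) * (n + k)! := by
      rw [← add_assoc, Nat.factorial_succ]; push_cast; ring
    rw [rising_succ, ih, e1, e2, pow_succ]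
    have h1 : ((2 * n)! : ℚ) ≠ 0 := by positivity
    have h2 : ((n + k)! : ℚ) ≠ 0 := by positivity
    have h3 : (n + k + 1 : ℚ) ≠ 0 := by positivity
    field_simp
    ring

theorem det_column_row {k : ℕ} (α β : Fin k → ℚ) (M : Fin k → Fin k → ℚ) :
    Matrix.det (Matrix.of fun i j => α i * (β j * M i j)) =
      (∏ i, α i) * ((∏ j, β j) * Matrix.det (Matrix.of M)) := by
  rw [Matrix.det_mul_column α (fun i j => β j * M i j)]
  congr 1
  exact Matrix.det_mul_row β (Matrix.of M)

/-- The sequence `u` has quotients `(N+1+n)/(N+3/2+n)`, so `det_hankel` applies; rising factorials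
at half-integers turn into quotients of factorials. The bound `k ≤ m` ensures that every column
index is below the number of points. -/
theorem sum_evenPoints {k m : ℕ} (hk : k ≤ m) (N : ℕ) :
    ∑ S ∈ (evenPoints m).powersetCard k,
      (∏ s ∈ S, columnWeight s * gapProduct N (2 * m) s) * squareVandermonde S ^ 2 =
      ∏ i ∈ Finset.range k, (((2 * m + 2 * N + 2 * i - 1)! : ℚ) / (2 * (m - 1 - i))! *
        (2 ^ (2 * N + 4 * i) * (N + 2 * i)! * (N + 2 * i + 1)! * (2 * i)! * (2 * N + 2 * i)! /
          ((2 * N + 4 * i)! * (2 * N + 4 * i + 2)!))) := by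
  rw [sum_squareVandermonde_sq k _ _ (fun t => (2 * m + 2 * N + 2 * t : ℚ) ^ 2)
    (fun t => (2 * m - 2 - 2 * t : ℚ) ^ 2)]
  simp only [evenPoints_entry (lt_of_lt_of_le (Fin.is_lt _) hk)]
  set u : ℕ → ℚ := fun n => 1 / 2 * 4 ^ (N + n) * ((N + n)! : ℚ) ^ 2 / (2 * (N + n) + 1)! with hu
  rw [det_column_row (fun i : Fin k => ((2 * m + 2 * N + 2 * (i : ℕ) - 1)! : ℚ))
    (fun j : Fin k => (1 / (2 * (m - 1 - (j : ℕ)))! : ℚ)) (fun i j => u (i + j)),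
    det_hankel k u (N + 1) (N + 3 / 2), ← mul_assoc,
    Fin.prod_univ_eq_prod_range (fun i => ((2 * m + 2 * N + 2 * (i : ℕ) - 1)! : ℚ)),
    Fin.prod_univ_eq_prod_range (fun j => (1 / (2 * (m - 1 - (j : ℕ)))! : ℚ)),
    ← Finset.prod_mul_distrib, ← Finset.prod_mul_distrib]
  · refine Finset.prod_congr rfl fun i _ => ?_
    rw [mul_one_div]
    congr 1
    have e1 : (N : ℚ) + 3 / 2 = ((N + 1 : ℕ) : ℚ) + 1 / 2 := by push_cast; ring
    have e2 : (N : ℚ) + 3 / 2 + i - 1 = ((N + i : ℕ) : ℚ) + 1 / 2 := by push_cast; ring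
    have e3 : (N : ℚ) + 3 / 2 - (N + 1) = ((0 : ℕ) : ℚ) + 1 / 2 := by push_cast; ring
    rw [e2, e3, e1, rising_nat_add_half, rising_nat_add_half, rising_nat_add_half,
      rising_nat_add_one]
    simp only [hu, add_zero, zero_add, Nat.factorial_zero, mul_zero]
    have f1 : ((2 * (N + 1 + 2 * i))! : ℚ) = (2 * N + 4 * i + 2)! := by congr 2; ring
    have f2 : ((N + 1 + 2 * i)! : ℚ) = (N + 2 * i + 1)! := by congr 2; ring
    have f3 : ((2 * (N + i + i))! : ℚ) = (2 * N + 4 * i)! := by congr 2; ring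
    have f4 : ((N + i + i)! : ℚ) = (N + 2 * i)! := by congr 2; ring
    have f5 : ((2 * (N + i))! : ℚ) = (2 * N + 2 * i)! := by congr 2; ring
    have f6 : ((2 * (N + 1))! : ℚ) = (2 * N + 2) * (2 * N + 1)! := by
      rw [show 2 * (N + 1) = 2 * N + 1 + 1 by ring, Nat.factorial_succ]; push_cast; ring
    have f7 : ((N + 1)! : ℚ) = (N + 1) * N ! := by rw [Nat.factorial_succ]; push_cast; ring
    have f8 : (2 : ℚ) ^ (2 * N + 4 * i) = 4 ^ N * (4 ^ i * 4 ^ i) := by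
      rw [show (4 : ℚ) = 2 ^ 2 by norm_num, ← pow_mul, ← pow_mul, ← pow_add, ← pow_add]
      congr 1; ring
    rw [f1, f2, f3, f4, f5, f6, f7, f8, pow_mul, show (4 : ℚ) ^ 2 = 4 * 4 by norm_num, mul_pow]
    have g1 : ((2 * N + 1)! : ℚ) ≠ 0 := by positivity
    have g2 : (N ! : ℚ) ≠ 0 := by positivity
    have g3 : ((N + i)! : ℚ) ≠ 0 := by positivity
    have g4 : ((N + 2 * i)! : ℚ) ≠ 0 := by positivity
    have g5 : ((N + 2 * i + 1)! : ℚ) ≠ 0 := by positivity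
    have g6 : ((2 * N + 4 * i)! : ℚ) ≠ 0 := by positivity
    have g7 : ((2 * N + 4 * i + 2)! : ℚ) ≠ 0 := by positivity
    have g8 : ((2 * N + 2 * i)! : ℚ) ≠ 0 := by positivity
    have g9 : (i ! : ℚ) ≠ 0 := by positivity
    have g10 : (N + 1 : ℚ) ≠ 0 := by positivity
    have g11 : (2 * N + 2 : ℚ) ≠ 0 := by positivity
    simp only [Nat.cast_one]
    field_simp
  · intro n; positivity
  · intro n
    simp only [hu]
    have f1 : ((N + (n + 1))! : ℚ) = (N + n + 1) * (N + n)! := by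
      rw [← add_assoc, Nat.factorial_succ]; push_cast; ring
    have f2 : ((2 * (N + (n + 1)) + 1)! : ℚ) =
        (2 * N + 2 * n + 3) * ((2 * N + 2 * n + 2) * (2 * (N + n) + 1)!) := by
      rw [show 2 * (N + (n + 1)) + 1 = 2 * (N + n) + 1 + 1 + 1 by ring, Nat.factorial_succ,
        Nat.factorial_succ]; push_cast; ring
    rw [f1, f2, ← add_assoc, pow_succ]
    have g1 : ((2 * (N + n) + 1)! : ℚ) ≠ 0 := by positivity
    have g2 : (2 * N + 2 * n + 3 : ℚ) ≠ 0 := by positivity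
    have g3 : (2 * N + 2 * n + 2 : ℚ) ≠ 0 := by positivity
    field_simp
    ring

/-- The second moment divides the moment by one more linear factor, which changes the quotients to
`(N+1+n)/(N+5/2+n)`. -/
theorem sum_oddPoints {k m : ℕ} (hk : k ≤ m) (N : ℕ) :
    ∑ S ∈ (oddPoints m).powersetCard k,
      (∏ s ∈ S, (s : ℚ) ^ 2 * gapProduct N (2 * m + 1) s) * squareVandermonde S ^ 2 =
      ∏ i ∈ Finset.range k, (((2 * m + 2 * N + 2 * i + 1)! : ℚ) / (2 * (m - 1 - i))! *
        (2 ^ (2 * N + 4 * i) * (N + 2 * i)! * (N + 2 * i + 1)! * (2 * i + 1)! *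
          (2 * N + 2 * i + 1)! / ((2 * N + 4 * i + 1)! * (2 * N + 4 * i + 3)!))) := by
  rw [sum_squareVandermonde_sq k _ _ (fun t => (2 * m + 1 + 2 * N + 2 * t : ℚ) ^ 2)
    (fun t => (2 * m + 1 - 2 - 2 * t : ℚ) ^ 2)]
  simp only [oddPoints_entry (lt_of_lt_of_le (Fin.is_lt _) hk)]
  set u : ℕ → ℚ := fun n => 1 / 2 * 4 ^ (N + n) * ((N + n)! : ℚ) ^ 2 /
    ((2 * (N + n) + 1)! * (2 * (N + n : ℕ) + 3)) with hu
  rw [det_column_row (fun i : Fin k => ((2 * m + 2 * N + 2 * (i : ℕ) + 1)! : ℚ))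
    (fun j : Fin k => (1 / (2 * (m - 1 - (j : ℕ)))! : ℚ)) (fun i j => u (i + j)),
    det_hankel k u (N + 1) (N + 5 / 2), ← mul_assoc,
    Fin.prod_univ_eq_prod_range (fun i => ((2 * m + 2 * N + 2 * (i : ℕ) + 1)! : ℚ)),
    Fin.prod_univ_eq_prod_range (fun j => (1 / (2 * (m - 1 - (j : ℕ)))! : ℚ)),
    ← Finset.prod_mul_distrib, ← Finset.prod_mul_distrib]
  · refine Finset.prod_congr rfl fun i _ => ?_
    rw [mul_one_div]
    congr 1
    have e1 : (N : ℚ) + 5 / 2 = ((N + 2 : ℕ) : ℚ) + 1 / 2 := by push_cast; ring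
    have e2 : (N : ℚ) + 5 / 2 + i - 1 = ((N + i + 1 : ℕ) : ℚ) + 1 / 2 := by push_cast; ring
    have e3 : (N : ℚ) + 5 / 2 - (N + 1) = ((1 : ℕ) : ℚ) + 1 / 2 := by push_cast; ring
    rw [e2, e3, e1, rising_nat_add_half, rising_nat_add_half, rising_nat_add_half,
      rising_nat_add_one]
    simp only [hu, add_zero, Nat.factorial_one, mul_one]
    have f1 : ((2 * (N + 2 + 2 * i))! : ℚ) = (2 * N + 4 * i + 4) * (2 * N + 4 * i + 3)! := by
      rw [show 2 * (N + 2 + 2 * i) = 2 * N + 4 * i + 3 + 1 by ring, Nat.factorial_succ]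
      push_cast; ring
    have f2 : ((N + 2 + 2 * i)! : ℚ) = (N + 2 * i + 2) * (N + 2 * i + 1)! := by
      rw [show N + 2 + 2 * i = N + 2 * i + 1 + 1 by ring, Nat.factorial_succ]
      push_cast; ring
    have f3 : ((2 * (N + i + 1 + i))! : ℚ) = (2 * N + 4 * i + 2) * (2 * N + 4 * i + 1)! := by
      rw [show 2 * (N + i + 1 + i) = 2 * N + 4 * i + 1 + 1 by ring, Nat.factorial_succ]
      push_cast; ring
    have f4 : ((N + i + 1 + i)! : ℚ) = (N + 2 * i + 1) * (N + 2 * i)! := by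
      rw [show N + i + 1 + i = N + 2 * i + 1 by ring, Nat.factorial_succ]
      push_cast; ring
    have f5 : ((2 * (N + i + 1))! : ℚ) = (2 * N + 2 * i + 2) * (2 * N + 2 * i + 1)! := by
      rw [show 2 * (N + i + 1) = 2 * N + 2 * i + 1 + 1 by ring, Nat.factorial_succ]
      push_cast; ring
    have f6 : ((2 * (N + 2))! : ℚ) = (2 * N + 4) * ((2 * N + 3) * ((2 * N + 2) * (2 * N + 1)!)) := by
      rw [show 2 * (N + 2) = 2 * N + 1 + 1 + 1 + 1 by ring, Nat.factorial_succ, Nat.factorial_succ,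
        Nat.factorial_succ]; push_cast; ring
    have f7 : ((N + 2)! : ℚ) = (N + 2) * ((N + 1) * N !) := by
      rw [Nat.factorial_succ, Nat.factorial_succ]; push_cast; ring
    have f8 : (2 : ℚ) ^ (2 * N + 4 * i) = 4 ^ N * (4 ^ i * 4 ^ i) := by
      rw [show (4 : ℚ) = 2 ^ 2 by norm_num, ← pow_mul, ← pow_mul, ← pow_add, ← pow_add]
      congr 1; ring
    have f9 : ((N + i + 1)! : ℚ) = (N + i + 1) * (N + i)! := by
      rw [Nat.factorial_succ]; push_cast; ring
    have f10 : ((2 * (1 + i))! : ℚ) = (2 * i + 2) * (2 * i + 1)! := by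
      rw [show 2 * (1 + i) = 2 * i + 1 + 1 by ring, Nat.factorial_succ]; push_cast; ring
    have f11 : ((1 + i)! : ℚ) = (i + 1) * i ! := by
      rw [add_comm, Nat.factorial_succ]; push_cast; ring
    have f12 : ((N + 2 * i + 1)! : ℚ) = (N + 2 * i + 1) * (N + 2 * i)! := by
      rw [Nat.factorial_succ]; push_cast; ring
    have f13 : ((2 : ℕ)! : ℚ) = 2 := by norm_num [Nat.factorial]
    rw [f1, f2, f3, f4, f5, f6, f7, f8, f9, f10, f11, f12, f13, pow_mul,
      show (4 : ℚ) ^ 2 = 4 * 4 by norm_num, mul_pow]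
    have g1 : ((2 * N + 1)! : ℚ) ≠ 0 := by positivity
    have g2 : (N ! : ℚ) ≠ 0 := by positivity
    have g3 : ((N + i)! : ℚ) ≠ 0 := by positivity
    have g4 : ((N + 2 * i)! : ℚ) ≠ 0 := by positivity
    have g6 : ((2 * N + 4 * i + 1)! : ℚ) ≠ 0 := by positivity
    have g7 : ((2 * N + 4 * i + 3)! : ℚ) ≠ 0 := by positivity
    have g8 : ((2 * N + 2 * i + 1)! : ℚ) ≠ 0 := by positivity
    have g9 : (i ! : ℚ) ≠ 0 := by positivity
    have g10 : (N + 1 : ℚ) ≠ 0 := by positivity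
    have g11 : (2 * N + 2 : ℚ) ≠ 0 := by positivity
    have g12 : (2 * N + 3 : ℚ) ≠ 0 := by positivity
    have g13 : (2 * N + 4 : ℚ) ≠ 0 := by positivity
    have g14 : (N + 2 : ℚ) ≠ 0 := by positivity
    have g15 : (N + i + 1 : ℚ) ≠ 0 := by positivity
    have g16 : (i + 1 : ℚ) ≠ 0 := by positivity
    have g17 : (N + 2 * i + 1 : ℚ) ≠ 0 := by positivity
    have g18 : (N + 2 * i + 2 : ℚ) ≠ 0 := by positivity
    have g19 : (2 * N + 4 * i + 4 : ℚ) ≠ 0 := by positivity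
    have g20 : (2 * N + 4 * i + 2 : ℚ) ≠ 0 := by positivity
    have g21 : (2 * N + 2 * i + 2 : ℚ) ≠ 0 := by positivity
    push_cast
    field_simp
    ring
  · intro n; positivity
  · intro n
    simp only [hu]
    have f1 : ((N + (n + 1))! : ℚ) = (N + n + 1) * (N + n)! := by
      rw [← add_assoc, Nat.factorial_succ]; push_cast; ring
    have f2 : ((2 * (N + (n + 1)) + 1)! : ℚ) =
        (2 * N + 2 * n + 3) * ((2 * N + 2 * n + 2) * (2 * (N + n) + 1)!) := by
      rw [show 2 * (N + (n + 1)) + 1 = 2 * (N + n) + 1 + 1 + 1 by ring, Nat.factorial_succ,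
        Nat.factorial_succ]; push_cast; ring
    rw [f1, f2, ← add_assoc, pow_succ]
    push_cast
    have g1 : ((2 * (N + n) + 1)! : ℚ) ≠ 0 := by positivity
    have g2 : (2 * N + 2 * n + 3 : ℚ) ≠ 0 := by positivity
    have g3 : (2 * N + 2 * n + 2 : ℚ) ≠ 0 := by positivity
    have g4 : (2 * (N + n) + 3 : ℚ) ≠ 0 := by positivity
    have g5 : (2 * (N + n + 1) + 3 : ℚ) ≠ 0 := by positivity
    field_simp
    ring

/-! ### Hyperfactorial bookkeeping -/

theorem hyperFac_add_two_mul (N k : ℕ) : (hyperFac (N + 2 * k) : ℚ) =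
    hyperFac N * ∏ i ∈ Finset.range k, ((N + 2 * i)! * (N + 2 * i + 1)! : ℚ) := by
  induction k with
  | zero => simp
  | succ k ih =>
    rw [Finset.prod_range_succ, ← mul_assoc, ← ih, show N + 2 * (k + 1) = N + 2 * k + 1 + 1 by ring,
      hyperFac, hyperFac, Finset.prod_range_succ, Finset.prod_range_succ]
    push_cast
    ring

theorem hyperFac₂_even (n : ℕ) : (hyperFac₂ (2 * n) : ℚ) = ∏ i ∈ Finset.range n, ((2 * i)! : ℚ) := by
  simp [hyperFac₂]

theorem hyperFac₂_odd (n : ℕ) :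
    (hyperFac₂ (2 * n + 1) : ℚ) = ∏ i ∈ Finset.range n, ((2 * i + 1)! : ℚ) := by
  rw [hyperFac₂, show (2 * n + 1) / 2 = n by omega, show (2 * n + 1) % 2 = 1 by omega]
  push_cast
  rfl

theorem hyperFac₂_even_add (n k : ℕ) : (hyperFac₂ (2 * (n + k)) : ℚ) =
    hyperFac₂ (2 * n) * ∏ i ∈ Finset.range k, ((2 * (n + i))! : ℚ) := by
  rw [hyperFac₂_even, hyperFac₂_even, Finset.prod_range_add]

theorem hyperFac₂_odd_add (n k : ℕ) : (hyperFac₂ (2 * (n + k) + 1) : ℚ) =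
    hyperFac₂ (2 * n + 1) * ∏ i ∈ Finset.range k, ((2 * (n + i) + 1)! : ℚ) := by
  rw [hyperFac₂_odd, hyperFac₂_odd, Finset.prod_range_add]

theorem prod_range_two_mul (f : ℕ → ℚ) (k : ℕ) :
    ∏ i ∈ Finset.range (2 * k), f i = ∏ i ∈ Finset.range k, (f (2 * i) * f (2 * i + 1)) := by
  induction k with
  | zero => simp
  | succ k ih =>
    rw [show 2 * (k + 1) = 2 * k + 1 + 1 by ring, Finset.prod_range_succ, Finset.prod_range_succ, ih,
      Finset.prod_range_succ, mul_assoc]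

/-- In reversed order the rising factorials become the quotients of factorials that the sums over
subsets produce as row and column factors. -/
theorem prod_ascFactorial_reflect (x k M : ℕ) :
    ∏ i ∈ Finset.Icc 1 k, ((2 * x + 2 * i - 1).ascFactorial (M + 4 * k - 4 * i + 1) : ℚ) =
      ∏ i ∈ Finset.range k, ((2 * (x + k) + M + 2 * i - 1)! / (2 * (x + k - 1 - i))! : ℚ) := by
  rw [← Finset.prod_range_reflect, ← Finset.Ico_add_one_right_eq_Icc,
    Finset.prod_Ico_eq_prod_range]
  simp only [Nat.add_sub_cancel]
  refine Finset.prod_congr rfl fun i hi => ?_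
  rw [Finset.mem_range] at hi
  have h := Nat.factorial_mul_ascFactorial (2 * x + 2 * i) (M + 4 * k - 4 * (1 + i) + 1)
  rw [show 2 * x + 2 * (1 + i) - 1 = 2 * x + 2 * i + 1 by omega,
    show 2 * (x + k - 1 - (k - 1 - i)) = 2 * x + 2 * i by omega,
    show 2 * (x + k) + M + 2 * (k - 1 - i) - 1 =
      2 * x + 2 * i + (M + 4 * k - 4 * (1 + i) + 1) by omega, ← h]
  push_cast
  have : ((2 * x + 2 * i)! : ℚ) ≠ 0 := by positivity
  field_simp

theorem oddHeightConst_add (n k : ℕ) : oddHeightConst (n + k) = oddHeightConst n *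
    ∏ i ∈ Finset.range k, (1 / (2 ^ (2 * (n + i)) * (2 * (n + i))! : ℚ)) := by
  rw [oddHeightConst, oddHeightConst, Finset.prod_range_add]

theorem evenHeightConst_add (n k : ℕ) : evenHeightConst (n + k) = evenHeightConst n *
    ∏ i ∈ Finset.range k, (1 / (2 ^ (2 * (n + i) + 1) * (2 * (n + i) + 1)! : ℚ)) := by
  rw [evenHeightConst, evenHeightConst, Finset.prod_range_add]

theorem hyperFac₂_ne_zero (n : ℕ) : (hyperFac₂ n : ℚ) ≠ 0 := by
  simp [hyperFac₂, Finset.prod_eq_zero_iff, Nat.factorial_ne_zero]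

theorem hyperFac_ne_zero (n : ℕ) : (hyperFac n : ℚ) ≠ 0 := by
  simp [hyperFac, Finset.prod_eq_zero_iff, Nat.factorial_ne_zero]

/-- Every quotient of hyperfactorials is a product over `i < k`. Once the initial values cancel, the
identity holds for each `i` separately; the power of 2 is absorbed by the two height constants. Here
`p` and `q` stand for the numbers of dents of the two factors K'. -/
theorem even_constant (x k p q : ℕ) :
    oddHeightConst (k + p) * oddHeightConst (k + q) *
      (∏ i ∈ Finset.range k, (((2 * (x + k) + 2 * (p + q) + 2 * i - 1)! : ℚ) /
        (2 * (x + k - 1 - i))! *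
        (2 ^ (2 * (p + q) + 4 * i) * (p + q + 2 * i)! * (p + q + 2 * i + 1)! * (2 * i)! *
          (2 * (p + q) + 2 * i)! / ((2 * (p + q) + 4 * i)! * (2 * (p + q) + 4 * i + 2)!)))) =
    (∏ i ∈ Finset.Icc 1 k,
      ((2 * x + 2 * i - 1).ascFactorial (2 * (p + q) + 4 * k - 4 * i + 1) : ℚ)) *
      ((hyperFac (p + q + 2 * k) * hyperFac₂ (2 * k) * hyperFac₂ (2 * q) * hyperFac₂ (2 * p) *
        hyperFac₂ (2 * (p + q + k))) /
      (hyperFac (p + q) * hyperFac₂ (2 * (q + k)) * hyperFac₂ (2 * (p + k)) *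
        hyperFac₂ (2 * (p + q + 2 * k)))) * (oddHeightConst p * oddHeightConst q) := by
  rw [prod_ascFactorial_reflect, add_comm k p, add_comm k q, oddHeightConst_add,
    oddHeightConst_add, hyperFac_add_two_mul, hyperFac₂_even k, hyperFac₂_even_add (p + q) k,
    hyperFac₂_even_add q k, hyperFac₂_even_add p k, hyperFac₂_even_add (p + q) (2 * k),
    prod_range_two_mul]
  have h1 := hyperFac₂_ne_zero (2 * q)
  have h2 := hyperFac₂_ne_zero (2 * p)
  have h3 := hyperFac₂_ne_zero (2 * (p + q))
  have h4 := hyperFac_ne_zero (p + q)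
  generalize (hyperFac₂ (2 * q) : ℚ) = A at *
  generalize (hyperFac₂ (2 * p) : ℚ) = B at *
  generalize (hyperFac₂ (2 * (p + q)) : ℚ) = C at *
  generalize (hyperFac (p + q) : ℚ) = D at *
  have hpos : ∀ f : ℕ → ℚ, (∀ i, 0 < f i) → ∏ i ∈ Finset.range k, f i ≠ 0 := fun f hf =>
    (Finset.prod_pos fun i _ => hf i).ne'
  have k1 := hpos (fun i => ((2 * (q + i))! : ℚ)) (fun i => by positivity)
  have k2 := hpos (fun i => ((2 * (p + i))! : ℚ)) (fun i => by positivity)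
  have k3 := hpos (fun i => ((2 * (p + q + 2 * i))! * (2 * (p + q + (2 * i + 1)))! : ℚ))
    (fun i => by positivity)
  -- The initial values are cancelled with the products over `i < k` kept as atoms.
  have key : ∀ P₁ P₂ P₃ P₄ P₅ P₆ P₇ P₈ P₉ P₁₀ : ℚ, P₈ ≠ 0 → P₉ ≠ 0 → P₁₀ ≠ 0 →
      P₁ * P₂ * P₃ = P₄ * (P₅ * P₆ * P₇ / (P₈ * P₉ * P₁₀)) →
      oddHeightConst p * P₁ * (oddHeightConst q * P₂) * P₃ =
        P₄ * (D * P₅ * P₆ * A * B * (C * P₇) / (D * (A * P₈) * (B * P₉) * (C * P₁₀))) *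
          (oddHeightConst p * oddHeightConst q) := by
    intro P₁ P₂ P₃ P₄ P₅ P₆ P₇ P₈ P₉ P₁₀ g1 g2 g3 g
    have : D * P₅ * P₆ * A * B * (C * P₇) / (D * (A * P₈) * (B * P₉) * (C * P₁₀)) =
        P₅ * P₆ * P₇ / (P₈ * P₉ * P₁₀) := by field_simp
    rw [this]
    linear_combination (oddHeightConst p * oddHeightConst q) * g
  refine key _ _ _ _ _ _ _ _ _ _ k1 k2 k3 ?_
  simp only [← Finset.prod_mul_distrib, ← Finset.prod_div_distrib]
  refine Finset.prod_congr rfl fun i _ => ?_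
  rw [show 2 * (p + q + (2 * i + 1)) = 2 * (p + q) + 4 * i + 2 by ring,
    show 2 * (p + q + 2 * i) = 2 * (p + q) + 4 * i by ring,
    show 2 * (p + q + i) = 2 * (p + q) + 2 * i by ring,
    show (2 : ℚ) ^ (2 * (p + q) + 4 * i) = 2 ^ (2 * (p + i)) * 2 ^ (2 * (q + i)) by
      rw [← pow_add]; congr 1; ring]
  have g1 : ((2 * (p + i))! : ℚ) ≠ 0 := by positivity
  have g2 : ((2 * (q + i))! : ℚ) ≠ 0 := by positivity
  have g3 : ((2 * (p + q) + 4 * i)! : ℚ) ≠ 0 := by positivity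
  have g4 : ((2 * (p + q) + 4 * i + 2)! : ℚ) ≠ 0 := by positivity
  have g5 : ((2 * (x + k - 1 - i))! : ℚ) ≠ 0 := by positivity
  field_simp

/-- As in the even case, except that each of the two height constants carries one more factor 1/2
per index. The surplus 1/4 for each `i < k` is the origin of the power 1/2^(y-1). -/
theorem odd_constant (x k p q : ℕ) :
    evenHeightConst (k + p) * evenHeightConst (k + q) *
      (∏ i ∈ Finset.range k, (((2 * (x + k) + 2 * (p + q) + 2 * i + 1)! : ℚ) /
        (2 * (x + k - 1 - i))! *
        (2 ^ (2 * (p + q) + 4 * i) * (p + q + 2 * i)! * (p + q + 2 * i + 1)! * (2 * i + 1)! *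
          (2 * (p + q) + 2 * i + 1)! /
            ((2 * (p + q) + 4 * i + 1)! * (2 * (p + q) + 4 * i + 3)!)))) =
    (∏ i ∈ Finset.Icc 1 k,
      ((2 * x + 2 * i - 1).ascFactorial (2 * (p + q) + 2 + 4 * k - 4 * i + 1) : ℚ)) *
      (1 / 2 ^ (2 * k)) *
      ((hyperFac (p + q + 2 * k) * hyperFac₂ (2 * k + 1) * hyperFac₂ (2 * q + 1) *
        hyperFac₂ (2 * p + 1) * hyperFac₂ (2 * (p + q + k) + 1)) /
      (hyperFac (p + q) * hyperFac₂ (2 * (q + k) + 1) * hyperFac₂ (2 * (p + k) + 1) *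
        hyperFac₂ (2 * (p + q + 2 * k) + 1))) * (evenHeightConst p * evenHeightConst q) := by
  rw [prod_ascFactorial_reflect, add_comm k p, add_comm k q, evenHeightConst_add,
    evenHeightConst_add, hyperFac_add_two_mul, hyperFac₂_odd k, hyperFac₂_odd_add (p + q) k,
    hyperFac₂_odd_add q k, hyperFac₂_odd_add p k, hyperFac₂_odd_add (p + q) (2 * k),
    prod_range_two_mul]
  have h1 := hyperFac₂_ne_zero (2 * q + 1)
  have h2 := hyperFac₂_ne_zero (2 * p + 1)
  have h3 := hyperFac₂_ne_zero (2 * (p + q) + 1)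
  have h4 := hyperFac_ne_zero (p + q)
  generalize (hyperFac₂ (2 * q + 1) : ℚ) = A at *
  generalize (hyperFac₂ (2 * p + 1) : ℚ) = B at *
  generalize (hyperFac₂ (2 * (p + q) + 1) : ℚ) = C at *
  generalize (hyperFac (p + q) : ℚ) = D at *
  have hpos : ∀ f : ℕ → ℚ, (∀ i, 0 < f i) → ∏ i ∈ Finset.range k, f i ≠ 0 := fun f hf =>
    (Finset.prod_pos fun i _ => hf i).ne'
  have k1 := hpos (fun i => ((2 * (q + i) + 1)! : ℚ)) (fun i => by positivity)
  have k2 := hpos (fun i => ((2 * (p + i) + 1)! : ℚ)) (fun i => by positivity)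
  have k3 := hpos (fun i => ((2 * (p + q + 2 * i) + 1)! * (2 * (p + q + (2 * i + 1)) + 1)! : ℚ))
    (fun i => by positivity)
  have k4 : (1 / 2 ^ (2 * k) : ℚ) = ∏ i ∈ Finset.range k, (1 / 4 : ℚ) := by
    rw [Finset.prod_const, Finset.card_range, pow_mul, div_pow, one_pow]; norm_num
  rw [k4]
  have key : ∀ P₁ P₂ P₃ P₄ P₅ P₆ P₇ P₈ P₉ P₁₀ P₁₁ : ℚ, P₈ ≠ 0 → P₉ ≠ 0 → P₁₀ ≠ 0 →
      P₁ * P₂ * P₃ = P₄ * P₁₁ * (P₅ * P₆ * P₇ / (P₈ * P₉ * P₁₀)) →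
      evenHeightConst p * P₁ * (evenHeightConst q * P₂) * P₃ =
        P₄ * P₁₁ * (D * P₅ * P₆ * A * B * (C * P₇) / (D * (A * P₈) * (B * P₉) * (C * P₁₀))) *
          (evenHeightConst p * evenHeightConst q) := by
    intro P₁ P₂ P₃ P₄ P₅ P₆ P₇ P₈ P₉ P₁₀ P₁₁ g1 g2 g3 g
    have : D * P₅ * P₆ * A * B * (C * P₇) / (D * (A * P₈) * (B * P₉) * (C * P₁₀)) =
        P₅ * P₆ * P₇ / (P₈ * P₉ * P₁₀) := by field_simp
    rw [this]
    linear_combination (evenHeightConst p * evenHeightConst q) * g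
  refine key _ _ _ _ _ _ _ _ _ _ _ k1 k2 k3 ?_
  simp only [← Finset.prod_mul_distrib, ← Finset.prod_div_distrib]
  refine Finset.prod_congr rfl fun i _ => ?_
  rw [show 2 * (p + q + (2 * i + 1)) + 1 = 2 * (p + q) + 4 * i + 3 by ring,
    show 2 * (p + q + 2 * i) + 1 = 2 * (p + q) + 4 * i + 1 by ring,
    show 2 * (p + q + i) + 1 = 2 * (p + q) + 2 * i + 1 by ring,
    show 2 * (x + k) + (2 * (p + q) + 2) + 2 * i - 1 =
      2 * (x + k) + 2 * (p + q) + 2 * i + 1 by omega,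
    show (2 : ℚ) ^ (2 * (p + q) + 4 * i) = 2 ^ (2 * (p + i)) * 2 ^ (2 * (q + i)) by
      rw [← pow_add]; congr 1; ring, pow_succ, pow_succ]
  have g1 : ((2 * (p + i) + 1)! : ℚ) ≠ 0 := by positivity
  have g2 : ((2 * (q + i) + 1)! : ℚ) ≠ 0 := by positivity
  have g3 : ((2 * (p + q) + 4 * i + 1)! : ℚ) ≠ 0 := by positivity
  have g4 : ((2 * (p + q) + 4 * i + 3)! : ℚ) ≠ 0 := by positivity
  have g5 : ((2 * (x + k - 1 - i))! : ℚ) ≠ 0 := by positivity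
  field_simp
  ring

/-! ### Dents of finitely many triangles -/

/-- The columns of the up-pointing unit triangles on the base of the triangle of side `n` whose
base has left end `l`. -/
def dents (l : ℤ) (n : ℕ) : Finset ℤ := (Finset.range n).image fun t : ℕ => l + 1 + 2 * (t : ℤ)

theorem mem_dents {l X : ℤ} {n : ℕ} : X ∈ dents l n ↔ l < X ∧ X < l + 2 * n ∧ Odd (X - l) := by
  simp only [dents, Finset.mem_image, Finset.mem_range, Int.odd_iff]
  constructor
  · rintro ⟨t, ht, rfl⟩; omega
  · rintro ⟨h1, h2, h3⟩
    exact ⟨((X - l - 1) / 2).toNat, by omega, by omega⟩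

theorem prod_dents (l : ℤ) (n : ℕ) (f : ℤ → ℚ) :
    ∏ X ∈ dents l n, f X = ∏ t ∈ Finset.range n, f (l + 1 + 2 * (t : ℤ)) :=
  Finset.prod_image fun a _ b _ h => by simpa using h

theorem card_dents (l : ℤ) (n : ℕ) : (dents l n).card = n := by
  rw [dents, Finset.card_image_of_injective _ fun a b h => by simpa using h, Finset.card_range]

theorem pairwiseDisjoint_dents {K : Finset ℕ} {l : ℕ → ℤ} {n : ℕ → ℕ}
    (hsep : ∀ k ∈ K, ∀ m ∈ K, k ≠ m → l k + 2 * n k ≤ l m ∨ l m + 2 * n m ≤ l k) :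
    (K : Set ℕ).PairwiseDisjoint fun k => dents (l k) (n k) := by
  intro k hk m hm hkm
  refine Finset.disjoint_left.2 fun X hX hX' => ?_
  have := hsep k hk m hm hkm
  rw [mem_dents] at hX hX'
  omega

/-- Removing the base triangles of some triangles along the base of a trapezoid is the same as
removing these triangles. -/
theorem weightedTilingNumber_trapezoid_fill (K : Finset ℕ) (l : ℕ → ℤ) (n : ℕ → ℕ) {c L h : ℤ}
    {S : Finset ℤ}
    (hl : ∀ k ∈ K, Even (l k + L) ∧ -1 ≤ l k ∧ l k + 2 * n k + L ≤ c ∧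
      (n k = 0 ∨ (n k : ℤ) ≤ h - L))
    (hsep : ∀ k ∈ K, ∀ m ∈ K, k ≠ m → l k + 2 * n k ≤ l m ∨ l m + 2 * n m ≤ l k)
    (hS : ∀ X ∈ S, ∀ k ∈ K, X < l k) :
    weightedTilingNumber (trapezoid c L h (S ∪ K.biUnion fun k => dents (l k) (n k))) =
      weightedTilingNumber {u ∈ trapezoid c L h S |
        ¬ ∃ k ∈ K, InUpTriangle (l k) (l k + 2 * n k) L u} := by
  rw [weightedTilingNumber_fill_many K l n L _ (fun k hk => ⟨(hl k hk).1, (hl k hk).2.1⟩) hsep]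
  · congr 1
    ext ⟨X, j⟩
    simp only [Finset.mem_filter, mem_trapezoid, Finset.mem_union, Finset.mem_biUnion]
    constructor
    · rintro ⟨⟨h1, h2, h3, h4, h5⟩, h6⟩
      exact ⟨⟨h1, h2, h3, h4, fun h => h5 ⟨h.1, Or.inl h.2⟩⟩, h6⟩
    · rintro ⟨⟨h1, h2, h3, h4, h5⟩, h6⟩
      refine ⟨⟨h1, h2, h3, h4, ?_⟩, h6⟩
      rintro ⟨rfl, h7 | ⟨k, hk, h7⟩⟩
      · exact h5 ⟨rfl, h7⟩
      · rw [mem_dents] at h7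
        exact h6 ⟨k, hk, le_rfl, by simp only; omega, by simp only; omega⟩
  · rintro k hk ⟨X, j⟩ hu
    obtain ⟨h1, h2, h3, h4⟩ := hl k hk
    unfold InUpTriangle at hu
    simp only at hu
    have hXS : X ∉ S := fun h => by have := hS X h k hk; omega
    have hbi : j = L → (X ∈ K.biUnion (fun k => dents (l k) (n k)) ↔ Odd (X + j)) := by
      rintro rfl
      rw [Finset.mem_biUnion]
      rw [Int.even_iff] at h1
      constructor
      · rintro ⟨m, hm, hX⟩
        have := (hl m hm).1
        rw [mem_dents, Int.odd_iff] at hX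
        rw [Int.even_iff] at this
        rw [Int.odd_iff]
        omega
      · intro hodd
        rw [Int.odd_iff] at hodd
        refine ⟨k, hk, ?_⟩
        rw [mem_dents, Int.odd_iff]
        omega
    rw [mem_trapezoid, Finset.mem_union]
    simp only [hXS, false_or]
    constructor
    · rintro ⟨-, -, -, -, h⟩ ⟨hj, ho⟩
      exact h ⟨hj, (hbi hj).2 ho⟩
    · intro h
      exact ⟨by omega, by omega, by omega, by omega, fun hh => h ⟨hh.1, (hbi hh.1).1 hh.2⟩⟩

/-! ### Sequences -/

theorem partialSum_zero (a : List ℕ) : partialSum a 0 = 0 := rfl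

theorem partialSum_succ (a : List ℕ) (k : ℕ) :
    partialSum a (k + 1) = partialSum a k + seqTerm a (k + 1) :=
  Finset.sum_Icc_succ_top (by omega) _

theorem partialSum_eq {a : List ℕ} {k : ℕ} (hk : 1 ≤ k) :
    partialSum a k = partialSum a (k - 1) + seqTerm a k := by
  obtain ⟨k, rfl⟩ := Nat.exists_eq_add_of_le' hk
  exact partialSum_succ a k

theorem partialSum_mono (a : List ℕ) : Monotone (partialSum a) :=
  monotone_nat_of_le_succ fun k => by rw [partialSum_succ]; omega

theorem seqTerm_eq_zero {a : List ℕ} {k : ℕ} (hk : a.length < k) : seqTerm a k = 0 :=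
  List.getD_eq_default _ _ (by omega)

theorem partialSum_of_length_le {a : List ℕ} {k : ℕ} (hk : a.length ≤ k) :
    partialSum a k = partialSum a a.length := by
  induction k, hk using Nat.le_induction with
  | base => rfl
  | succ k hk ih => rw [partialSum_succ, ih, seqTerm_eq_zero (by omega), add_zero]

theorem partialSum_length (a : List ℕ) : partialSum a a.length = oddSum a + evenSum a := by
  rw [partialSum, oddSum, evenSum, ← Finset.sum_filter_add_sum_filter_not _ (fun i => Odd i)]
  simp only [Nat.not_odd_iff_even]

theorem seqTerm_le_oddSum {a : List ℕ} {k : ℕ} (hk : k ∈ Finset.Icc 1 a.length) (h : Odd k) :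
    seqTerm a k ≤ oddSum a :=
  Finset.single_le_sum (f := seqTerm a) (fun _ _ => Nat.zero_le _) (Finset.mem_filter.2 ⟨hk, h⟩)

theorem seqTerm_le_evenSum {a : List ℕ} {k : ℕ} (hk : k ∈ Finset.Icc 1 a.length) (h : Even k) :
    seqTerm a k ≤ evenSum a :=
  Finset.single_le_sum (f := seqTerm a) (fun _ _ => Nat.zero_le _) (Finset.mem_filter.2 ⟨hk, h⟩)

theorem seqTerm_descending {a : List ℕ} {m k : ℕ} (hk : 1 ≤ k) (hkm : k ≤ m) :
    seqTerm (descending a m) k = seqTerm a (m + 1 - k) := by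
  rw [seqTerm, descending, List.getD_eq_getElem _ _ (by simp; omega)]
  simp only [List.getElem_reverse, List.getElem_map, List.getElem_range, List.length_map,
    List.length_range]
  congr 1
  omega

theorem seqTerm_modifyHead (f : ℕ → ℕ) (t : List ℕ) (k : ℕ) (hk : 2 ≤ k) :
    seqTerm (t.modifyHead f) k = seqTerm t k := by
  obtain ⟨k, rfl⟩ := Nat.exists_eq_add_of_le' hk
  cases t <;> simp [seqTerm]

theorem seqTerm_modifyHead_one (f : ℕ → ℕ) (t : List ℕ) (ht : 0 < t.length) :
    seqTerm (t.modifyHead f) 1 = f (seqTerm t 1) := by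
  cases t with
  | nil => simp at ht
  | cons _ _ => simp [seqTerm]

theorem length_descending (a : List ℕ) (m : ℕ) : (descending a m).length = m := by
  simp [descending]

/-- The first `k` entries of the reversed sequence are the last `k` of the first `m` entries of `a`.
The additive form avoids truncated subtraction. -/
theorem partialSum_modifyHead_descending (w : ℕ) (a : List ℕ) {m k : ℕ} (hk : 1 ≤ k)
    (hkm : k ≤ m) :
    partialSum ((descending a m).modifyHead (w + ·)) k + partialSum a (m - k) =
      w + partialSum a m := by
  induction k, hk using Nat.le_induction with
  | base =>
    rw [partialSum_succ, partialSum_zero, seqTerm_modifyHead_one _ _ (by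
      rw [length_descending]; omega), zero_add, seqTerm_descending le_rfl hkm,
      partialSum_eq (k := m) hkm, show m + 1 - 1 = m by omega]
    omega
  | succ k hk ih =>
    have := ih (by omega)
    rw [partialSum_succ, seqTerm_modifyHead _ _ _ (by omega), seqTerm_descending (by omega) hkm,
      show m + 1 - (k + 1) = m - k by omega]
    rw [partialSum_eq (k := m - k) (by omega)] at this
    rw [show m - (k + 1) = m - k - 1 by omega]
    omega

theorem seqTerm_append_left (t t' : List ℕ) {k : ℕ} (hk : 1 ≤ k) (hkt : k ≤ t.length) :
    seqTerm (t ++ t') k = seqTerm t k := by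
  rw [seqTerm, seqTerm, List.getD_append _ _ _ _ (by omega)]

theorem seqTerm_append_singleton (t : List ℕ) (z : ℕ) :
    seqTerm (t ++ [z]) (t.length + 1) = z := by
  simp [seqTerm]

theorem partialSum_append_left (t t' : List ℕ) {k : ℕ} (hkt : k ≤ t.length) :
    partialSum (t ++ t') k = partialSum t k :=
  Finset.sum_congr rfl fun i hi => by
    rw [Finset.mem_Icc] at hi
    exact seqTerm_append_left t t' hi.1 (by omega)

/-! ### Trapezoids with triangular dents -/

/-- The indices of the triangles removed from the base of the trapezoid of `t`. -/
def evenIndices (t : List ℕ) : Finset ℕ := {k ∈ Finset.Icc 1 t.length | Even k}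

/-- The columns removed from the base of the trapezoid of `t`. -/
def baseDents (b : ℤ) (t : List ℕ) : Finset ℤ :=
  (evenIndices t).biUnion fun k => dents (-b + 2 * partialSum t (k - 1)) (seqTerm t k)

theorem baseDents_separated (b : ℤ) (t : List ℕ) : ∀ k ∈ evenIndices t, ∀ m ∈ evenIndices t, k ≠ m →
    -b + 2 * (partialSum t (k - 1) : ℤ) + 2 * seqTerm t k ≤ -b + 2 * partialSum t (m - 1) ∨
    -b + 2 * (partialSum t (m - 1) : ℤ) + 2 * seqTerm t m ≤ -b + 2 * partialSum t (k - 1) := by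
  intro k hk m hm hkm
  simp only [evenIndices, Finset.mem_filter, Finset.mem_Icc] at hk hm
  have h1 := partialSum_eq (a := t) hk.1.1
  have h2 := partialSum_eq (a := t) hm.1.1
  rcases lt_or_gt_of_ne hkm with h | h
  · have := partialSum_mono t (show k ≤ m - 1 by omega)
    omega
  · have := partialSum_mono t (show m ≤ k - 1 by omega)
    omega

theorem card_baseDents (b : ℤ) (t : List ℕ) : (baseDents b t).card = evenSum t := by
  rw [baseDents, Finset.card_biUnion (pairwiseDisjoint_dents (baseDents_separated b t))]
  simp only [card_dents]
  rfl

theorem mem_baseDents {b X : ℤ} {t : List ℕ} (h : X ∈ baseDents b t) :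
    -b < X ∧ X < -b + 2 * (evenSum t + oddSum t) ∧ Odd (X + b) := by
  obtain ⟨k, hk, hX⟩ := Finset.mem_biUnion.1 h
  simp only [evenIndices, Finset.mem_filter, Finset.mem_Icc] at hk
  rw [mem_dents, Int.odd_iff] at hX
  have h1 := partialSum_eq (a := t) hk.1.1
  have h2 := partialSum_mono t hk.1.2
  rw [partialSum_length] at h2
  rw [Int.odd_iff]
  omega

/-- Triangular dents are traded for unit dents, which brings the regions of Q' (`b = 0`) and K' (`b
= 1`) within reach of the product formulas. -/
theorem weightedTilingNumber_dentedTrapezoid {b : ℤ} (hb : b = 0 ∨ b = 1) (t : List ℕ) :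
    weightedTilingNumber (dentedTrapezoid b t) =
      weightedTilingNumber
        (trapezoid (2 * (evenSum t + oddSum t)) b (2 * evenSum t) (baseDents b t)) := by
  rw [← Finset.empty_union (baseDents b t), baseDents,
    weightedTilingNumber_trapezoid_fill _ _ _ _ (baseDents_separated b t) (by simp)]
  · congr 1
    ext ⟨X, j⟩
    simp only [dentedTrapezoid, Finset.mem_filter, mem_trapezoid, Finset.mem_product,
      Finset.mem_Ico, Finset.notMem_empty, and_false, not_false_eq_true, and_true]
    have : (∃ k ∈ Finset.Icc 1 t.length, Even k ∧
        InUpTriangle (-b + 2 * partialSum t (k - 1)) (-b + 2 * partialSum t k) b (X, j)) ↔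
        ∃ k ∈ evenIndices t, InUpTriangle (-b + 2 * partialSum t (k - 1))
          (-b + 2 * partialSum t (k - 1) + 2 * seqTerm t k) b (X, j) := by
      simp only [evenIndices, Finset.mem_filter, and_assoc]
      refine exists_congr fun k => and_congr_right fun hk => and_congr_right fun _ => ?_
      rw [partialSum_eq (Finset.mem_Icc.1 hk).1]
      push_cast
      rw [mul_add, ← add_assoc]
    rw [this]
    constructor
    · rintro ⟨⟨⟨h1, h2⟩, h3, h4⟩, h5, h6⟩; exact ⟨⟨h1, h3, h4, h5⟩, h6⟩
    · rintro ⟨⟨h1, h3, h4, h5⟩, h6⟩; exact ⟨⟨⟨h1, by omega⟩, h3, h4⟩, h5, h6⟩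
  · intro k hk
    simp only [evenIndices, Finset.mem_filter] at hk
    have h0 := Finset.mem_Icc.1 hk.1
    have h1 := partialSum_eq (a := t) h0.1
    have h2 := partialSum_mono t h0.2
    have h3 := seqTerm_le_evenSum hk.1 hk.2
    rw [partialSum_length] at h2
    rw [Int.even_iff]
    omega

theorem QWeighted_eq (t : List ℕ) : QWeighted t = evenHeightConst (baseDents 0 t).card *
    ((∏ X ∈ baseDents 0 t, (X : ℚ)) * squareVandermonde (baseDents 0 t)) := by
  rw [QWeighted, QRegion, weightedTilingNumber_dentedTrapezoid (Or.inl rfl)]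
  have h0 : (2 * evenSum t - 2 * (baseDents 0 t).card : ℤ) = 0 := by rw [card_baseDents]; omega
  rw [← weightedTilingNumber_even_height (c := 2 * (evenSum t + oddSum t)) (h := 2 * evenSum t)
    (even_two_mul _) (even_two_mul _), h0]
  · intro X hX; simpa using (mem_baseDents hX).2.2
  · intro X hX; have := (mem_baseDents hX).1; omega
  · intro X hX; have := (mem_baseDents hX).2.1; omega

theorem KWeighted_eq (t : List ℕ) : KWeighted t = oddHeightConst (baseDents 1 t).card *
    squareVandermonde (baseDents 1 t) := by
  rw [KWeighted, KRegion, weightedTilingNumber_dentedTrapezoid (Or.inr rfl)]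
  have h0 : (2 * evenSum t - 2 * (baseDents 1 t).card + 1 : ℤ) = 1 := by
    rw [card_baseDents]; omega
  rw [← weightedTilingNumber_odd_height (c := 2 * (evenSum t + oddSum t)) (h := 2 * evenSum t)
    (even_two_mul _) (even_two_mul _), h0]
  · intro X hX
    have := (mem_baseDents hX).2.2
    rw [Int.odd_iff] at this
    rw [Int.even_iff]; omega
  · intro X hX; have := (mem_baseDents hX).1; omega
  · intro X hX; have := (mem_baseDents hX).2.1; omega

/-! ### The dents of the alternating triangles -/

/-- The indices of the up-pointing triangles. -/
def upIndices (a : List ℕ) : Finset ℕ := {k ∈ Finset.Icc 1 a.length | Odd k}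

/-- The indices of the down-pointing triangles, together with the index `0` of an additional
triangle on their right. -/
def downIndices (a : List ℕ) : Finset ℕ := insert 0 (evenIndices a)

/-- The side of the down-pointing triangle of index `k`. -/
def downSide (z : ℕ) (a : List ℕ) (k : ℕ) : ℕ := if k = 0 then z else seqTerm a k

/-- The columns of the base triangles of the up-pointing triangles. -/
def upDents (r : ℤ) (a : List ℕ) : Finset ℤ :=
  (upIndices a).biUnion fun k => dents (r - 2 * partialSum a k) (seqTerm a k)

/-- The columns of the base triangles of the down-pointing triangles. -/
def downDents (r : ℤ) (z : ℕ) (a : List ℕ) : Finset ℤ :=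
  (downIndices a).biUnion fun k => dents (r - 2 * partialSum a k) (downSide z a k)

theorem upDents_separated (r : ℤ) (a : List ℕ) : ∀ k ∈ upIndices a, ∀ m ∈ upIndices a, k ≠ m →
    r - 2 * (partialSum a k : ℤ) + 2 * seqTerm a k ≤ r - 2 * partialSum a m ∨
    r - 2 * (partialSum a m : ℤ) + 2 * seqTerm a m ≤ r - 2 * partialSum a k := by
  intro k hk m hm hkm
  simp only [upIndices, Finset.mem_filter, Finset.mem_Icc] at hk hm
  have h1 := partialSum_eq (a := a) hk.1.1
  have h2 := partialSum_eq (a := a) hm.1.1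
  rcases lt_or_gt_of_ne hkm with h | h
  · have := partialSum_mono a (show k ≤ m - 1 by omega)
    omega
  · have := partialSum_mono a (show m ≤ k - 1 by omega)
    omega

theorem downDents_separated (r : ℤ) (z : ℕ) (a : List ℕ) :
    ∀ k ∈ downIndices a, ∀ m ∈ downIndices a, k ≠ m →
    r - 2 * (partialSum a k : ℤ) + 2 * downSide z a k ≤ r - 2 * partialSum a m ∨
    r - 2 * (partialSum a m : ℤ) + 2 * downSide z a m ≤ r - 2 * partialSum a k := by
  have key : ∀ k m : ℕ, k < m →
      r - 2 * (partialSum a m : ℤ) + 2 * downSide z a m ≤ r - 2 * partialSum a k := by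
    intro k m h
    have h1 := partialSum_eq (a := a) (show 1 ≤ m by omega)
    have := partialSum_mono a (show k ≤ m - 1 by omega)
    rw [downSide, if_neg (by omega)]
    omega
  intro k _ m _ hkm
  rcases lt_or_gt_of_ne hkm with h | h
  · exact Or.inr (key k m h)
  · exact Or.inl (key m k h)

theorem card_upDents (r : ℤ) (a : List ℕ) : (upDents r a).card = oddSum a := by
  rw [upDents, Finset.card_biUnion (pairwiseDisjoint_dents (upDents_separated r a))]
  simp only [card_dents]
  rfl

theorem prod_downIndices {M : Type*} [CommMonoid M] (z : ℕ) (a : List ℕ) (f : ℕ → ℕ → M) :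
    ∏ k ∈ downIndices a, f k (downSide z a k) =
      f 0 z * ∏ k ∈ evenIndices a, f k (seqTerm a k) := by
  rw [downIndices, Finset.prod_insert (by simp [evenIndices])]
  refine congrArg₂ _ rfl (Finset.prod_congr rfl fun k hk => ?_)
  simp only [evenIndices, Finset.mem_filter, Finset.mem_Icc] at hk
  rw [downSide, if_neg (by omega)]

theorem card_downDents (r : ℤ) (z : ℕ) (a : List ℕ) : (downDents r z a).card = evenSum a + z := by
  rw [downDents, Finset.card_biUnion (pairwiseDisjoint_dents (downDents_separated r z a))]
  simp only [card_dents]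
  -- The product rule over the index set is read additively through `Multiplicative`.
  have := prod_downIndices z a (fun _ n => Multiplicative.ofAdd n)
  rw [← ofAdd_sum, ← ofAdd_sum, ← ofAdd_add] at this
  rw [Multiplicative.ofAdd.injective this, add_comm]
  rfl

theorem mem_upDents {r X : ℤ} {a : List ℕ} (h : X ∈ upDents r a) :
    r - 2 * partialSum a a.length < X ∧ X < r ∧ Odd (X - r) := by
  obtain ⟨k, hk, hX⟩ := Finset.mem_biUnion.1 h
  simp only [upIndices, Finset.mem_filter, Finset.mem_Icc] at hk
  rw [mem_dents, Int.odd_iff] at hX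
  have h1 := partialSum_eq (a := a) hk.1.1
  have h2 := partialSum_mono a hk.1.2
  rw [Int.odd_iff]
  omega

theorem mem_downDents {r X : ℤ} {z : ℕ} {a : List ℕ} (h : X ∈ downDents r z a) :
    r - 2 * partialSum a a.length < X ∧ X < r + 2 * z ∧ Odd (X - r) := by
  obtain ⟨k, hk, hX⟩ := Finset.mem_biUnion.1 h
  simp only [downIndices, evenIndices, Finset.mem_insert, Finset.mem_filter, Finset.mem_Icc] at hk
  rw [mem_dents, Int.odd_iff, downSide] at hX
  rw [Int.odd_iff]
  rcases hk with rfl | hk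
  · rw [if_pos rfl, partialSum_zero] at hX
    omega
  · rw [if_neg (by omega)] at hX
    have h1 := partialSum_eq (a := a) hk.1.1
    have h2 := partialSum_mono a hk.1.2
    omega

/-- Up- and down-pointing triangles are treated alike here: side by side, the first `j` of them have
all columns of one progression as dents. -/
theorem prod_dents_partialSum (r : ℤ) (a : List ℕ) (f : ℤ → ℚ) (j : ℕ) :
    ∏ k ∈ Finset.Icc 1 j, ∏ X ∈ dents (r - 2 * partialSum a k) (seqTerm a k), f X =
      ∏ t ∈ Finset.range (partialSum a j), f (r - 2 * partialSum a j + 1 + 2 * (t : ℤ)) := by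
  induction j with
  | zero => simp [partialSum_zero]
  | succ j ih =>
    rw [Finset.prod_Icc_succ_top (by omega), ih, prod_dents, partialSum_succ,
      add_comm (partialSum a j) (seqTerm a (j + 1)), Finset.prod_range_add, mul_comm]
    refine congrArg₂ _ rfl (Finset.prod_congr rfl fun t _ => congrArg f ?_)
    push_cast
    ring

/-- The dents of all triangles fill an interval. -/
theorem prod_upDents_mul_prod_downDents (r : ℤ) (z : ℕ) (a : List ℕ) (f : ℤ → ℚ) :
    (∏ X ∈ upDents r a, f X) * ∏ X ∈ downDents r z a, f X =
      ∏ t ∈ Finset.range (partialSum a a.length + z),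
        f (r - 2 * partialSum a a.length + 1 + 2 * (t : ℤ)) := by
  rw [upDents, downDents, Finset.prod_biUnion (pairwiseDisjoint_dents (upDents_separated r a)),
    Finset.prod_biUnion (pairwiseDisjoint_dents (downDents_separated r z a)),
    prod_downIndices z a (fun k n => ∏ X ∈ dents (r - 2 * partialSum a k) n, f X),
    Finset.prod_range_add, ← prod_dents_partialSum, mul_left_comm, mul_comm]
  refine congrArg₂ _ ?_ ?_
  · rw [← Finset.prod_filter_mul_prod_filter_not (Finset.Icc 1 a.length) (fun i => Odd i)]
    simp only [Nat.not_odd_iff_even]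
    rfl
  · rw [prod_dents]
    refine Finset.prod_congr rfl fun t _ => congrArg f ?_
    rw [partialSum_zero]
    push_cast
    ring

/-- Reading the reversed sequence from left to right, position `k` corresponds to the index `m + 1 -
k`. As `m` is even, the even positions are the odd indices. For odd length, `a_m = 0` and the first
gap is `w` alone. -/
theorem baseDents_upperSeq (b : ℤ) (w : ℕ) (a : List ℕ) :
    baseDents b (upperSeq w a) = upDents (2 * (w + partialSum a a.length) - b) a := by
  set m := 2 * ((a.length + 1) / 2) with hm
  have hlen : (upperSeq w a).length = m := by simp [upperSeq, length_descending, hm]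
  have hps : ∀ k, 1 ≤ k → k ≤ m →
      partialSum (upperSeq w a) k + partialSum a (m - k) = w + partialSum a a.length := by
    intro k h1 h2
    rw [upperSeq, partialSum_modifyHead_descending w a h1 h2, partialSum_of_length_le (by omega)]
  have hst : ∀ k, 2 ≤ k → k ≤ m → seqTerm (upperSeq w a) k = seqTerm a (m + 1 - k) := by
    intro k h1 h2
    rw [upperSeq, seqTerm_modifyHead _ _ _ h1, seqTerm_descending (by omega) h2]
  ext X
  simp only [baseDents, upDents, Finset.mem_biUnion, evenIndices, upIndices, Finset.mem_filter,
    Finset.mem_Icc, hlen]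
  have key : ∀ k, 2 ≤ k → k ≤ m →
      dents (-b + 2 * partialSum (upperSeq w a) (k - 1)) (seqTerm (upperSeq w a) k) =
      dents (2 * (w + partialSum a a.length) - b - 2 * partialSum a (m + 1 - k))
        (seqTerm a (m + 1 - k)) := by
    intro k h1 h2
    have := hps (k - 1) (by omega) (by omega)
    rw [hst k h1 h2]
    rw [show m - (k - 1) = m + 1 - k by omega] at this
    congr 1
    omega
  constructor
  · rintro ⟨k, ⟨⟨h1, h2⟩, h3⟩, h4⟩
    rw [Nat.even_iff] at h3
    rw [key k (by omega) h2] at h4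
    refine ⟨m + 1 - k, ⟨⟨by omega, ?_⟩, by rw [Nat.odd_iff]; omega⟩, h4⟩
    by_contra! hlt
    rw [mem_dents, seqTerm_eq_zero hlt] at h4
    omega
  · rintro ⟨k, ⟨⟨h1, h2⟩, h3⟩, h4⟩
    rw [Nat.odd_iff] at h3
    refine ⟨m + 1 - k, ⟨⟨by omega, by omega⟩, by rw [Nat.even_iff]; omega⟩, ?_⟩
    rw [key _ (by omega) (by omega), show m + 1 - (m + 1 - k) = k by omega]
    exact h4

/-- Now `m` is odd, so even positions correspond to even indices, and the appended entry `z` at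
position `m + 1` corresponds to the additional index 0. -/
theorem baseDents_lowerSeq (b : ℤ) (w z : ℕ) (a : List ℕ) :
    baseDents b (lowerSeq w z a) = downDents (2 * (w + partialSum a a.length) - b) z a := by
  set m := 2 * (a.length / 2) + 1 with hm
  have hlen' : ((descending a m).modifyHead (w + ·)).length = m := by
    simp [length_descending]
  have hlen : (lowerSeq w z a).length = m + 1 := by
    rw [lowerSeq, List.length_append, hlen', List.length_singleton]
  have hps : ∀ k, 1 ≤ k → k ≤ m →
      partialSum (lowerSeq w z a) k + partialSum a (m - k) = w + partialSum a a.length := by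
    intro k h1 h2
    rw [lowerSeq, partialSum_append_left _ _ (by rw [hlen']; exact h2),
      partialSum_modifyHead_descending w a h1 h2, partialSum_of_length_le (by omega)]
  have hst : ∀ k, 2 ≤ k → k ≤ m + 1 →
      seqTerm (lowerSeq w z a) k = downSide z a (m + 1 - k) := by
    intro k h1 h2
    rcases Nat.lt_or_ge m k with h | h
    · obtain rfl : k = m + 1 := by omega
      rw [Nat.sub_self, downSide, if_pos rfl, lowerSeq]
      have := seqTerm_append_singleton ((descending a m).modifyHead (w + ·)) z
      rwa [hlen'] at this
    · rw [lowerSeq, seqTerm_append_left _ _ (by omega) (by rw [hlen']; exact h),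
        seqTerm_modifyHead _ _ _ h1, seqTerm_descending (by omega) h, downSide, if_neg (by omega)]
  ext X
  simp only [baseDents, downDents, Finset.mem_biUnion, evenIndices, downIndices,
    Finset.mem_insert, Finset.mem_filter, Finset.mem_Icc, hlen]
  have key : ∀ k, 2 ≤ k → k ≤ m + 1 →
      dents (-b + 2 * partialSum (lowerSeq w z a) (k - 1)) (seqTerm (lowerSeq w z a) k) =
      dents (2 * (w + partialSum a a.length) - b - 2 * partialSum a (m + 1 - k))
        (downSide z a (m + 1 - k)) := by
    intro k h1 h2
    have := hps (k - 1) (by omega) (by omega)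
    rw [hst k h1 h2]
    rw [show m - (k - 1) = m + 1 - k by omega] at this
    congr 1
    omega
  constructor
  · rintro ⟨k, ⟨⟨h1, h2⟩, h3⟩, h4⟩
    rw [Nat.even_iff] at h3
    rw [key k (by omega) h2] at h4
    refine ⟨m + 1 - k, ?_, h4⟩
    rw [Nat.even_iff]
    omega
  · rintro ⟨k, h3, h4⟩
    rw [Nat.even_iff] at h3
    refine ⟨m + 1 - k, ⟨⟨by omega, by omega⟩, by rw [Nat.even_iff]; omega⟩, ?_⟩
    rw [key _ (by omega) (by omega), show m + 1 - (m + 1 - k) = k by omega]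
    exact h4

/-! ### Cutting the region along the level of the triangles -/

/-- All factors of the product formulas are nonzero. A tileable reference trapezoid is needed to fix
the number of crossing lozenges by balance. -/
theorem weightedTilingNumber_trapezoid_ne_zero {b c l h : ℤ} {D : Finset ℤ} (hb : b = 0 ∨ b = 1)
    (hl : l = h - 2 * D.card + b) (hc : Even c) (hh : Even h) (hD : ∀ X ∈ D, Odd (X + b))
    (hpos : ∀ X ∈ D, 0 ≤ X) (hlt : ∀ X ∈ D, X + l < c) :
    weightedTilingNumber (trapezoid c l h D) ≠ 0 := by
  have hV := (squareVandermonde_pos hpos).ne'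
  rcases hb with rfl | rfl
  · rw [add_zero] at hl
    subst hl
    simp only [add_zero] at hD
    rw [weightedTilingNumber_even_height hc hh hD hpos hlt]
    refine mul_ne_zero (Finset.prod_pos fun i _ => by positivity).ne'
      (mul_ne_zero (Finset.prod_ne_zero_iff.2 fun X hX => ?_) hV)
    have := hD X hX
    rw [Int.odd_iff] at this
    exact_mod_cast (show X ≠ 0 by omega)
  · subst hl
    rw [weightedTilingNumber_odd_height hc hh _ hpos hlt]
    · exact mul_ne_zero (Finset.prod_pos fun i _ => by positivity).ne' hV
    · intro X hX
      have := hD X hX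
      rw [Int.odd_iff] at this
      rw [Int.even_iff]
      omega

/-- The point `(r, L)` is the right end of the triangle array; it lies on the northeastern side,
whose equation is therefore `X + j = r + L`. -/
theorem mem_RRegion {x y z : ℕ} {a : List ℕ} {r L : ℤ}
    (hr : r = 2 * (x + oddSum a) + y + 2 * evenSum a - 1)
    (hL : L = y + 2 * z + 2 * evenSum a - 1) {u : UnitTriangle} :
    u ∈ RRegion x y z a ↔ 0 ≤ u.1 ∧ 0 ≤ u.2 ∧ u.2 < 2 * (y + z + evenSum a + oddSum a - 1) ∧
      u.1 - u.2 ≤ 2 * (x + oddSum a) ∧ u.1 + u.2 < r + L ∧ ¬ InTriangleArray a r L u := by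
  have e1 : 2 * ((x : ℤ) + oddSum a) + (y + z + 2 * evenSum a - 1) - z = r := by rw [hr]; ring
  have e2 : (y : ℤ) + z + 2 * evenSum a - 1 + z = L := by rw [hL]; ring
  simp only [RRegion, halvedHexagon, Finset.mem_filter, Finset.mem_product, Finset.mem_Ico, e1, e2]
  constructor
  · rintro ⟨⟨⟨⟨h1, h2⟩, h3, h4⟩, h5, h6⟩, h7⟩
    exact ⟨h1, h3, h4, h5, by omega, h7⟩
  · rintro ⟨h1, h2, h3, h4, h5, h6⟩
    exact ⟨⟨⟨⟨h1, by omega⟩, h2, h3⟩, h4, by omega⟩, h6⟩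

theorem inTriangleArray_of_le {a : List ℕ} {r L : ℤ} {u : UnitTriangle} (h : L ≤ u.2) :
    InTriangleArray a r L u ↔ ∃ k ∈ upIndices a,
      InUpTriangle (r - 2 * partialSum a k) (r - 2 * partialSum a k + 2 * seqTerm a k) L u := by
  simp only [InTriangleArray, upIndices, Finset.mem_filter, and_assoc]
  refine exists_congr fun k => and_congr_right fun hk => ?_
  rw [Finset.mem_Icc] at hk
  have h1 := partialSum_eq (a := a) hk.1
  have h2 : r - 2 * (partialSum a k : ℤ) + 2 * seqTerm a k = r - 2 * partialSum a (k - 1) := by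
    omega
  rw [h2]
  refine or_iff_left fun hd => ?_
  have := hd.2.1
  omega

theorem inTriangleArray_of_lt {a : List ℕ} {r L : ℤ} {u : UnitTriangle} (h : u.2 < L) :
    InTriangleArray a r L u ↔ ∃ k ∈ evenIndices a,
      InDownTriangle (r - 2 * partialSum a k) (r - 2 * partialSum a k + 2 * seqTerm a k) L u := by
  simp only [InTriangleArray, evenIndices, Finset.mem_filter, and_assoc]
  refine exists_congr fun k => and_congr_right fun hk => ?_
  rw [Finset.mem_Icc] at hk
  have h1 := partialSum_eq (a := a) hk.1
  have h2 : r - 2 * (partialSum a k : ℤ) + 2 * seqTerm a k = r - 2 * partialSum a (k - 1) := by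
    omega
  rw [h2]
  refine or_iff_right fun hd => ?_
  have := hd.2.1
  omega

/-- On and above level `L` the southeastern condition follows from the northeastern one, because the
rightmost vertex lies `z` levels below `L`. -/
theorem abovePart_RRegion {x y z : ℕ} {a : List ℕ} {r L : ℤ}
    (hr : r = 2 * (x + oddSum a) + y + 2 * evenSum a - 1)
    (hL : L = y + 2 * z + 2 * evenSum a - 1) (h0 : 0 ≤ L) (S : Finset ℤ) :
    abovePart (RRegion x y z a) L S =
      {u ∈ trapezoid (r + L) L (2 * (y + z + evenSum a + oddSum a - 1)) S | ¬ ∃ k ∈ upIndices a,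
        InUpTriangle (r - 2 * partialSum a k) (r - 2 * partialSum a k + 2 * seqTerm a k) L u} := by
  ext u
  simp only [abovePart, Finset.mem_filter, mem_RRegion hr hL, mem_trapezoid]
  constructor
  · rintro ⟨⟨h1, h2, h3, h4, h5, h6⟩, h7, h8⟩
    rw [inTriangleArray_of_le h7] at h6
    exact ⟨⟨h1, h7, h3, h5, h8⟩, h6⟩
  · rintro ⟨⟨h1, h7, h3, h5, h8⟩, h6⟩
    rw [← inTriangleArray_of_le h7] at h6
    exact ⟨⟨h1, by omega, h3, by omega, h5, h6⟩, h7, h8⟩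

/-- The reflection carries level `L` to `b` and level 0 to the even level `L + b`; the southeastern
side becomes the northeastern side of a trapezoid. The stretch of the northeastern side between
level `L` and the rightmost vertex cuts off a corner of side `z`, which after reflection is an
up-pointing triangle on the base. It is the triangle of index 0 and the source of the entry `z` in
the second factor. -/
theorem belowPart_RRegion {x y z : ℕ} {a : List ℕ} {r L b q : ℤ}
    (hr : r = 2 * (x + oddSum a) + y + 2 * evenSum a - 1)
    (hL : L = y + 2 * z + 2 * evenSum a - 1) (hq : 2 * q = L + b)
    (hLh : L ≤ 2 * (y + z + evenSum a + oddSum a - 1)) (S : Finset ℤ) :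
    (belowPart (RRegion x y z a) L S).map (levelReflection q) =
      {u ∈ trapezoid (r + 2 * z + b) b (L + b) S | ¬ ∃ k ∈ downIndices a,
        InUpTriangle (r - 2 * partialSum a k) (r - 2 * partialSum a k + 2 * downSide z a k) b u} := by
  ext ⟨X, j⟩
  have hmem : (X, j) ∈ (belowPart (RRegion x y z a) L S).map (levelReflection q) ↔
      (X, L + b - 1 - j) ∈ belowPart (RRegion x y z a) L S := by
    rw [Finset.mem_map]
    constructor
    · rintro ⟨⟨Y, i⟩, h, e⟩
      rw [levelReflection_apply, Prod.mk.injEq] at e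
      obtain ⟨rfl, rfl⟩ := e
      rwa [show L + b - 1 - (2 * q - 1 - i) = i by omega]
    · intro h
      refine ⟨_, h, ?_⟩
      rw [levelReflection_apply, Prod.mk.injEq]
      omega
  have htri : j < L + b → ((∃ k ∈ downIndices a, InUpTriangle (r - 2 * partialSum a k)
      (r - 2 * partialSum a k + 2 * downSide z a k) b (X, j)) ↔
      InUpTriangle r (r + 2 * z) b (X, j) ∨ (b ≤ j ∧ InTriangleArray a r L (X, L + b - 1 - j))) := by
    intro hj
    rw [downIndices, Finset.exists_mem_insert, downSide, if_pos rfl, partialSum_zero]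
    refine or_congr (by simp) ?_
    by_cases hbj : b ≤ j
    · rw [inTriangleArray_of_lt (by simp only; omega), and_iff_right hbj]
      refine exists_congr fun k => and_congr_right fun hk => ?_
      simp only [evenIndices, Finset.mem_filter, Finset.mem_Icc] at hk
      rw [downSide, if_neg (by omega)]
      simp only [InUpTriangle, InDownTriangle]
      constructor <;> rintro ⟨h1, h2, h3⟩ <;> refine ⟨?_, ?_, ?_⟩ <;> omega
    · refine iff_of_false ?_ (fun h => hbj h.1)
      rintro ⟨k, -, h, -⟩
      exact hbj h
  rw [hmem]
  simp only [belowPart, Finset.mem_filter, mem_RRegion hr hL, mem_trapezoid]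
  constructor
  · rintro ⟨⟨h1, h2, h3, h4, h5, h6⟩, h7, h8⟩
    refine ⟨⟨h1, by omega, by omega, by omega, fun h => h8 ⟨by omega, h.2⟩⟩, ?_⟩
    rw [htri (by omega)]
    rintro (h | h)
    · have := h.2.1
      simp only at this
      omega
    · exact h6 h.2
  · rintro ⟨⟨h1, h2, h3, h4, h5⟩, h6⟩
    rw [htri h3, not_or] at h6
    have h7 : X - j ≤ r - b := by
      by_contra! hlt
      exact h6.1 ⟨h2, by simp only; omega, by simp only; omega⟩
    exact ⟨⟨h1, by omega, by omega, by omega, by omega, fun h => h6.2 ⟨h2, h⟩⟩, by omega,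
      fun h => h5 ⟨by omega, h.2⟩⟩

/-- On their common level the triangles cover an interval. -/
theorem exists_partialSum_lt (a : List ℕ) {r X : ℤ} (h1 : r - 2 * partialSum a a.length < X)
    (h2 : X < r) (h3 : Odd (X - r)) : ∃ k ∈ Finset.Icc 1 a.length,
      r - 2 * partialSum a k < X ∧ X < r - 2 * partialSum a (k - 1) := by
  obtain ⟨i, hi1, hi2⟩ := exists_consecutive (n := a.length)
    (fun i => 2 * (partialSum a i : ℤ)) (X := r - X)
    (by simp only [Fin.val_zero, partialSum_zero]; push_cast; omega)
    (by simp only [Fin.val_last]; omega)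
  rw [Int.odd_iff] at h3
  refine ⟨i + 1, Finset.mem_Icc.2 ⟨by omega, by omega⟩, ?_, ?_⟩
  · simp only [Fin.val_succ] at hi2
    omega
  · rw [Nat.add_sub_cancel]
    simp only [Fin.val_castSucc] at hi1
    omega

/-- Within the array every column on the level is blocked from above or from below by a triangle; to
the left of the array nothing is in the way. -/
theorem crossingColumns_RRegion {x y z : ℕ} {a : List ℕ} {r L : ℤ}
    (hr : r = 2 * (x + oddSum a) + y + 2 * evenSum a - 1)
    (hL : L = y + 2 * z + 2 * evenSum a - 1) (h0 : 1 ≤ L)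
    (hLh : L < 2 * (y + z + evenSum a + oddSum a - 1)) {X : ℤ} :
    X ∈ crossingColumns (RRegion x y z a) L ↔
      0 ≤ X ∧ X < r - 2 * partialSum a a.length ∧ Odd (X + L) := by
  rw [mem_crossingColumns, mem_RRegion hr hL, mem_RRegion hr hL,
    inTriangleArray_of_le (by simp only; omega), inTriangleArray_of_lt (by simp only; omega)]
  simp only [InUpTriangle, InDownTriangle]
  constructor
  · rintro ⟨h1, ⟨h2, -, -, -, h3, h4⟩, -, -, -, -, -, h5⟩
    refine ⟨h2, ?_, h1⟩
    rw [Int.odd_iff] at h1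
    by_contra! hlt
    obtain ⟨k, hk, h6, h7⟩ := exists_partialSum_lt a (r := r) (X := X) (by omega) (by omega)
      (by rw [Int.odd_iff]; omega)
    have h8 := partialSum_eq (a := a) (Finset.mem_Icc.1 hk).1
    rcases Nat.even_or_odd k with he | ho
    · exact h5 ⟨k, Finset.mem_filter.2 ⟨hk, he⟩, by omega, by omega, by omega⟩
    · exact h4 ⟨k, Finset.mem_filter.2 ⟨hk, ho⟩, by omega, by omega, by omega⟩
  · rintro ⟨h1, h2, h3⟩
    have key : ∀ k ∈ Finset.Icc 1 a.length, r - 2 * (partialSum a a.length : ℤ) ≤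
        r - 2 * partialSum a k := by
      intro k hk
      have := partialSum_mono a (Finset.mem_Icc.1 hk).2
      omega
    refine ⟨h3, ⟨h1, by omega, hLh, by omega, by omega, ?_⟩, h1, by omega, by omega, by omega,
      by omega, ?_⟩
    · rintro ⟨k, hk, h4, h5, h6⟩
      have := key k (Finset.mem_filter.1 hk).1
      omega
    · rintro ⟨k, hk, h4, h5, h6⟩
      have := key k (Finset.mem_filter.1 hk).1
      omega

theorem weightedTilingNumber_abovePart {x y z : ℕ} {a : List ℕ} {r L : ℤ}
    (hr : r = 2 * (x + oddSum a) + y + 2 * evenSum a - 1)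
    (hL : L = y + 2 * z + 2 * evenSum a - 1) {S : Finset ℤ}
    (hS : ∀ X ∈ S, X < r - 2 * partialSum a a.length) :
    weightedTilingNumber (trapezoid (r + L) L (2 * (y + z + evenSum a + oddSum a - 1))
      (S ∪ upDents r a)) = weightedTilingNumber
      {u ∈ trapezoid (r + L) L (2 * (y + z + evenSum a + oddSum a - 1)) S | ¬ ∃ k ∈ upIndices a,
        InUpTriangle (r - 2 * partialSum a k) (r - 2 * partialSum a k + 2 * seqTerm a k) L u} := by
  have hN := partialSum_length a
  rw [upDents, weightedTilingNumber_trapezoid_fill _ _ _ _ (upDents_separated r a)]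
  · intro X hX k hk
    have := hS X hX
    have := partialSum_mono a (Finset.mem_Icc.1 (Finset.mem_filter.1 hk).1).2
    omega
  · intro k hk
    have hk' := Finset.mem_filter.1 hk
    have hk'' := Finset.mem_Icc.1 hk'.1
    have h1 := partialSum_mono a hk''.2
    have h2 := partialSum_eq (a := a) hk''.1
    have h3 := seqTerm_le_oddSum hk'.1 hk'.2
    rw [Int.even_iff]
    omega

theorem weightedTilingNumber_belowPart {x y z : ℕ} {a : List ℕ} {r L b : ℤ}
    (hLb : Even (L + b))
    (hr : r = 2 * (x + oddSum a) + y + 2 * evenSum a - 1)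
    (hL : L = y + 2 * z + 2 * evenSum a - 1) {S : Finset ℤ}
    (hS : ∀ X ∈ S, X < r - 2 * partialSum a a.length) :
    weightedTilingNumber (trapezoid (r + 2 * z + b) b (L + b) (S ∪ downDents r z a)) =
      weightedTilingNumber {u ∈ trapezoid (r + 2 * z + b) b (L + b) S | ¬ ∃ k ∈ downIndices a,
        InUpTriangle (r - 2 * partialSum a k)
          (r - 2 * partialSum a k + 2 * downSide z a k) b u} := by
  have hN := partialSum_length a
  rw [Int.even_iff] at hLb
  have hps : ∀ k, partialSum a k ≤ partialSum a a.length := fun k => by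
    rcases le_total k a.length with h | h
    · exact partialSum_mono a h
    · exact (partialSum_of_length_le h).le
  rw [downDents, weightedTilingNumber_trapezoid_fill _ _ _ _ (downDents_separated r z a)]
  · intro X hX k _
    have := hS X hX
    have := hps k
    omega
  · intro k hk
    have h1 := hps k
    rw [Int.even_iff]
    rcases Finset.mem_insert.1 hk with rfl | hk
    · rw [downSide, if_pos rfl, partialSum_zero]
      omega
    · have hk' := Finset.mem_filter.1 hk
      have hk'' := Finset.mem_Icc.1 hk'.1
      have h2 := partialSum_eq (a := a) hk''.1
      have h3 := seqTerm_le_evenSum hk'.1 hk'.2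
      rw [downSide, if_neg (by omega)]
      omega

/-- Here the array would sit on level -1, one row below the region. In the trapezoid on that level
the row -1 consists of `x` forced lozenges and the lowest row of the triangle, so the two regions
have the same tiling number. -/
theorem weightedTilingNumber_RRegion_degenerate (x p : ℕ) (hp : 0 < p) :
    weightedTilingNumber (trapezoid (2 * x + 2 * p - 2) (-1) (2 * p - 2)
        (upDents (2 * x + 2 * p - 1) [p])) =
      weightedTilingNumber (RRegion x 0 0 [p]) := by
  have hO : oddSum [p] = p := by simp [oddSum, Finset.filter_singleton, seqTerm]
  have hE : evenSum [p] = 0 := by simp [evenSum, Finset.filter_singleton]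
  have hN : partialSum [p] 1 = p := by simp [partialSum, seqTerm]
  have hup : upIndices [p] = {1} := by simp [upIndices, Finset.filter_singleton]
  have hr : (2 * x + 2 * p - 1 : ℤ) =
      2 * (x + oddSum [p]) + (0 : ℕ) + 2 * evenSum [p] - 1 := by rw [hO, hE]; push_cast; ring
  have hL : (-1 : ℤ) = (0 : ℕ) + 2 * (0 : ℕ) + 2 * evenSum [p] - 1 := by rw [hE]; simp
  have hfill := weightedTilingNumber_abovePart (S := ∅) hr hL (by simp)
  rw [Finset.empty_union, hO, hE,
    show (2 * x + 2 * p - 1 + -1 : ℤ) = 2 * x + 2 * p - 2 by ring,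
    show (2 * (((0 : ℕ) : ℤ) + (0 : ℕ) + (0 : ℕ) + p - 1)) = 2 * p - 2 by push_cast; ring] at hfill
  have hst : seqTerm [p] 1 = p := by simp [seqTerm]
  rw [hfill, weightedTilingNumber_forced_right (j := -1) x 0]
  · congr 1
    ext ⟨X, j⟩
    rw [Finset.mem_sdiff, mem_rowSegment, Finset.mem_filter, mem_trapezoid, mem_RRegion hr hL,
      hO, hE]
    by_cases hj : -1 ≤ j
    · rw [inTriangleArray_of_le hj]
      simp only [hup, Finset.mem_singleton, exists_eq_left, hN, hst, InUpTriangle,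
        Finset.notMem_empty, and_false, not_false_eq_true, and_true]
      push_cast
      omega
    · simp only
      refine iff_of_false (fun h => hj h.1.1.2.1) (fun h => hj (by omega))
  · decide
  · intro X h1 h2
    simp only [Finset.mem_filter, mem_trapezoid, hup, Finset.mem_singleton, exists_eq_left, hN,
      hst, InUpTriangle, Finset.notMem_empty, and_false, not_false_eq_true, and_true]
    omega
  · simp [mem_trapezoid]

/-- The region is cut along the level of the triangles; `k` vertical lozenges cross that level. -/
theorem weightedTilingNumber_RRegion {x y z k : ℕ} {a : List ℕ} {r L b : ℤ}
    (ha : ∀ n ∈ a, 0 < n) (hb : b = 0 ∨ b = 1) (hy : (y : ℤ) = 2 * k + 1 - b)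
    (hO : y = 0 → 0 < oddSum a)
    (hr : r = 2 * (x + oddSum a) + y + 2 * evenSum a - 1)
    (hL : L = y + 2 * z + 2 * evenSum a - 1) {P : Finset ℤ}
    (hP : ∀ X, X ∈ P ↔ 0 ≤ X ∧ X < r - 2 * partialSum a a.length ∧ Odd (X + b))
    (hPc : k ≤ P.card) :
    weightedTilingNumber (RRegion x y z a) = ∑ S ∈ P.powersetCard k, (∏ X ∈ S, columnWeight X) *
      weightedTilingNumber (trapezoid (r + L) L (2 * (y + z + evenSum a + oddSum a - 1))
        (S ∪ upDents r a)) *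
      weightedTilingNumber (trapezoid (r + 2 * z + b) b (L + b) (S ∪ downDents r z a)) := by
  have hN := partialSum_length a
  by_cases h0 : 0 ≤ L
  swap
  -- A negative `L` forces `y = z = 0` and an empty even part; positivity of the entries then leaves
  -- a single triangle.
  · obtain ⟨rfl, rfl, rfl, rfl, hE, rfl⟩ :
      b = 1 ∧ k = 0 ∧ y = 0 ∧ z = 0 ∧ evenSum a = 0 ∧ L = -1 := by omega
    have hO := hO rfl
    obtain ⟨p, rfl⟩ : ∃ p, a = [p] := by
      match a, ha, hE, hO with
      | [], _, _, hO => simp [oddSum] at hO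
      | [p], _, _, _ => exact ⟨p, rfl⟩
      | p :: q :: t, ha, hE, _ =>
        have h1 : 0 < q := ha q (by simp)
        have h2 := seqTerm_le_evenSum (a := p :: q :: t) (k := 2) (by simp) (by decide)
        simp [seqTerm] at h2
        omega
    have hp : oddSum [p] = p := by simp [oddSum, Finset.filter_singleton, seqTerm]
    rw [hp] at hr hO
    rw [← weightedTilingNumber_RRegion_degenerate x p hO, Finset.powersetCard_zero,
      Finset.sum_singleton, Finset.prod_empty, one_mul, Finset.empty_union, Finset.empty_union,
      hE, hp, show r = 2 * x + 2 * p - 1 by rw [hr, hE]; push_cast; ring,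
      show (2 * x + 2 * p - 1 + -1 : ℤ) = 2 * x + 2 * p - 2 by ring,
      show (2 * (((0 : ℕ) : ℤ) + (0 : ℕ) + (0 : ℕ) + p - 1)) = 2 * p - 2 by push_cast; ring,
      show trapezoid (2 * x + 2 * p - 1 + 2 * ((0 : ℕ) : ℤ) + 1) 1 (-1 + 1)
        (downDents (2 * x + 2 * p - 1) 0 [p]) = ∅ from Finset.eq_empty_of_forall_notMem
          fun u hu => by rw [mem_trapezoid] at hu; omega,
      weightedTilingNumber_empty, mul_one]
  have hLb : Even (L + b) := by rw [Int.even_iff]; omega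
  obtain ⟨q, hq⟩ := hLb
  have hLh : L ≤ 2 * (y + z + evenSum a + oddSum a - 1) := by omega
  rw [weightedTilingNumber_split _ L]
  have hparts : ∀ S ⊆ P, (∏ X ∈ S, columnWeight X) *
      weightedTilingNumber (abovePart (RRegion x y z a) L S) *
      weightedTilingNumber (belowPart (RRegion x y z a) L S) = (∏ X ∈ S, columnWeight X) *
      weightedTilingNumber (trapezoid (r + L) L (2 * (y + z + evenSum a + oddSum a - 1))
        (S ∪ upDents r a)) *
      weightedTilingNumber (trapezoid (r + 2 * z + b) b (L + b) (S ∪ downDents r z a)) := by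
    intro S hS
    have hS' : ∀ X ∈ S, X < r - 2 * partialSum a a.length := fun X hX => ((hP X).1 (hS hX)).2.1
    rw [abovePart_RRegion hr hL h0, ← weightedTilingNumber_reflect q (belowPart _ _ _),
      belowPart_RRegion (b := b) hr hL (by omega) hLh, weightedTilingNumber_abovePart hr hL hS',
      weightedTilingNumber_belowPart ⟨q, hq⟩ hr hL hS']
  by_cases hcase : 1 ≤ L ∧ L < 2 * (y + z + evenSum a + oddSum a - 1)
  · have hcr : crossingColumns (RRegion x y z a) L = P := by
      ext X
      rw [crossingColumns_RRegion hr hL hcase.1 hcase.2, hP, Int.odd_iff, Int.odd_iff]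
      omega
    rw [hcr, Finset.sum_congr rfl fun S hS => hparts S (Finset.mem_powerset.1 hS)]
    symm
    refine Finset.sum_subset (fun S hS => Finset.mem_powerset.2 (Finset.mem_powersetCard.1 hS).1)
      fun S hS hSk => ?_
    rw [Finset.mem_powerset] at hS
    -- A set `S'` with exactly `k` columns gives a tileable upper trapezoid. By balance any `S` of
    -- another size makes the upper trapezoid untileable, so its term vanishes.
    obtain ⟨S', hS', hS'k⟩ := Finset.exists_subset_card_eq hPc
    have hmem : ∀ T ⊆ P, ∀ X ∈ T ∪ upDents r a, Odd (X + L) ∧ 0 ≤ X ∧ X + L < r + L := by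
      intro T hT X hX
      rw [Int.odd_iff]
      rcases Finset.mem_union.1 hX with hX | hX
      · have := (hP X).1 (hT hX)
        rw [Int.odd_iff] at this
        omega
      · have := mem_upDents hX
        rw [Int.odd_iff] at this
        omega
    have hcard : ∀ T ⊆ P, (T ∪ upDents r a).card = T.card + oddSum a := by
      intro T hT
      rw [Finset.card_union_of_disjoint, card_upDents]
      refine Finset.disjoint_left.2 fun X hX hX' => ?_
      have := (hP X).1 (hT hX)
      have := mem_upDents hX'
      omega
    have hne : weightedTilingNumber (trapezoid (r + L) L
        (2 * (y + z + evenSum a + oddSum a - 1)) (S' ∪ upDents r a)) ≠ 0 := by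
      refine weightedTilingNumber_trapezoid_ne_zero hb ?_ ?_ (even_two_mul _) ?_
        (fun X hX => (hmem S' hS' X hX).2.1) (fun X hX => (hmem S' hS' X hX).2.2)
      · rw [hcard S' hS', hS'k]
        push_cast
        omega
      · rw [Int.even_iff]
        omega
      · intro X hX
        have := (hmem S' hS' X hX).1
        rw [Int.odd_iff] at this ⊢
        omega
    have hzero : weightedTilingNumber (trapezoid (r + L) L
        (2 * (y + z + evenSum a + oddSum a - 1)) (S ∪ upDents r a)) = 0 := by
      by_contra hne'
      have := card_eq_of_trapezoid_ne_zero hcase.2 (hmem S hS) (hmem S' hS') hne' hne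
      rw [hcard S hS, hcard S' hS', hS'k] at this
      exact hSk (Finset.mem_powersetCard.2 ⟨hS, by omega⟩)
    rw [hzero, mul_zero, zero_mul]
  -- If `L` is the bottom or the top level of the region, then `y = 1`: no lozenge crosses the level
  -- and the only term is the one for the empty set.
  · obtain rfl : k = 0 := by omega
    have hcr : crossingColumns (RRegion x y z a) L = ∅ := by
      refine Finset.eq_empty_of_forall_notMem fun X hX => hcase ?_
      rw [mem_crossingColumns, mem_RRegion hr hL, mem_RRegion hr hL] at hX
      simp only at hX
      omega
    rw [hcr, Finset.powerset_empty, Finset.powersetCard_zero, Finset.sum_singleton,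
      Finset.sum_singleton, hparts ∅ (Finset.empty_subset _)]

/-! ### Summation over the positions of the crossing lozenges -/

theorem mem_oddPoints {m : ℕ} {X : ℤ} : X ∈ oddPoints m ↔ 0 ≤ X ∧ X < 2 * m ∧ Odd X := by
  simp only [oddPoints, Finset.mem_image, Finset.mem_range, Int.odd_iff]
  constructor
  · rintro ⟨t, ht, rfl⟩; omega
  · rintro ⟨h1, h2, h3⟩
    exact ⟨((X - 1) / 2).toNat, by omega, by omega⟩

theorem mem_evenPoints {m : ℕ} {X : ℤ} : X ∈ evenPoints m ↔ 0 ≤ X ∧ X < 2 * m - 1 ∧ Even X := by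
  simp only [evenPoints, Finset.mem_image, Finset.mem_range, Int.even_iff]
  constructor
  · rintro ⟨t, ht, rfl⟩; omega
  · rintro ⟨h1, h2, h3⟩
    exact ⟨(X / 2).toNat, by omega, by omega⟩

theorem card_oddPoints (m : ℕ) : (oddPoints m).card = m := by
  rw [oddPoints, Finset.card_image_of_injective _ fun a b h => by simpa using h, Finset.card_range]

theorem card_evenPoints (m : ℕ) : (evenPoints m).card = m := by
  rw [evenPoints, Finset.card_image_of_injective _ fun a b h => by simpa using h,
    Finset.card_range]

/-- The mixed factors between `S` and the dents come from the upper half for up-pointing and from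
the lower half for down-pointing triangles. Only their product is independent of how the array is
divided between the two kinds. -/
theorem prod_gaps {r : ℤ} {c : ℚ} {z : ℕ} {a : List ℕ} {S : Finset ℤ}
    (hc : ((r - 2 * partialSum a a.length + 1 : ℤ) : ℚ) = c) :
    (∏ s ∈ S, ∏ X ∈ upDents r a, ((X : ℚ) ^ 2 - (s : ℚ) ^ 2)) *
      ∏ s ∈ S, ∏ X ∈ downDents r z a, ((X : ℚ) ^ 2 - (s : ℚ) ^ 2) =
      ∏ s ∈ S, gapProduct (partialSum a a.length + z) c s := by
  rw [← Finset.prod_mul_distrib]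
  refine Finset.prod_congr rfl fun s _ => ?_
  rw [prod_upDents_mul_prod_downDents r z a (fun X => (X : ℚ) ^ 2 - (s : ℚ) ^ 2), gapProduct,
    ← hc]
  refine Finset.prod_congr rfl fun t _ => ?_
  push_cast
  ring

/-- For odd `y` both halves have even height and each contributes a factor `s` for every crossing
column, whence the weight `s²`. These columns are odd, so no crossing lozenge has weight 1/2. -/
theorem RRegion_odd {x y z k : ℕ} {a : List ℕ} (ha : ∀ n ∈ a, 0 < n) (hy : y = 2 * k + 1) :
    weightedTilingNumber (RRegion x y z a) =
      evenHeightConst (k + oddSum a) * evenHeightConst (k + (evenSum a + z)) *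
      (∏ i ∈ Finset.range k,
        (((2 * (x + k) + 2 * (oddSum a + (evenSum a + z)) + 2 * i + 1)! : ℚ) /
        (2 * (x + k - 1 - i))! *
        (2 ^ (2 * (oddSum a + (evenSum a + z)) + 4 * i) *
          (oddSum a + (evenSum a + z) + 2 * i)! * (oddSum a + (evenSum a + z) + 2 * i + 1)! *
          (2 * i + 1)! * (2 * (oddSum a + (evenSum a + z)) + 2 * i + 1)! /
            ((2 * (oddSum a + (evenSum a + z)) + 4 * i + 1)! *
              (2 * (oddSum a + (evenSum a + z)) + 4 * i + 3)!)))) *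
      ((∏ X ∈ baseDents 0 (upperSeq (x + k) a), (X : ℚ)) *
        squareVandermonde (baseDents 0 (upperSeq (x + k) a))) *
      ((∏ X ∈ baseDents 0 (lowerSeq (x + k) z a), (X : ℚ)) *
        squareVandermonde (baseDents 0 (lowerSeq (x + k) z a))) := by
  have hN := partialSum_length a
  rw [baseDents_upperSeq, baseDents_lowerSeq]
  set r : ℤ := 2 * ((x + k : ℕ) + partialSum a a.length) - 0 with hr
  obtain ⟨L, hL⟩ : ∃ L : ℤ, L = y + 2 * z + 2 * evenSum a - 1 := ⟨_, rfl⟩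
  have hP : ∀ X, X ∈ oddPoints (x + k) ↔
      0 ≤ X ∧ X < r - 2 * partialSum a a.length ∧ Odd (X + 0) := by
    intro X
    rw [mem_oddPoints, add_zero, hr]
    push_cast
    ring_nf
  rw [weightedTilingNumber_RRegion (P := oddPoints (x + k)) (r := r) (L := L) (b := 0) (k := k) ha
    (Or.inl rfl) (by omega) (by omega) (by push_cast at hr; omega) hL hP
    (by rw [card_oddPoints]; omega)]
  have hterm : ∀ S ∈ (oddPoints (x + k)).powersetCard k, (∏ X ∈ S, columnWeight X) *
      weightedTilingNumber (trapezoid (r + L) L (2 * (y + z + evenSum a + oddSum a - 1))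
        (S ∪ upDents r a)) *
      weightedTilingNumber (trapezoid (r + 2 * z + 0) 0 (L + 0) (S ∪ downDents r z a)) =
      evenHeightConst (k + oddSum a) * evenHeightConst (k + (evenSum a + z)) *
      ((∏ X ∈ upDents r a, (X : ℚ)) * squareVandermonde (upDents r a)) *
      ((∏ X ∈ downDents r z a, (X : ℚ)) * squareVandermonde (downDents r z a)) *
      ((∏ s ∈ S, (s : ℚ) ^ 2 * gapProduct (oddSum a + (evenSum a + z)) (2 * (x + k : ℕ) + 1) s) *
        squareVandermonde S ^ 2) := by
    intro S hS
    obtain ⟨hSP, hSk⟩ := Finset.mem_powersetCard.1 hS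
    have hS' : ∀ X ∈ S, 0 ≤ X ∧ X < r - 2 * partialSum a a.length ∧ X % 2 = 1 := fun X hX => by
      have := (hP X).1 (hSP hX)
      rwa [add_zero, Int.odd_iff] at this
    have hA : ∀ X ∈ upDents r a, r - 2 * partialSum a a.length < X ∧ X < r ∧ X % 2 = 1 := by
      intro X hX
      have := mem_upDents hX
      rw [Int.odd_iff] at this
      omega
    have hB : ∀ X ∈ downDents r z a,
        r - 2 * partialSum a a.length < X ∧ X < r + 2 * z ∧ X % 2 = 1 := by
      intro X hX
      have := mem_downDents hX
      rw [Int.odd_iff] at this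
      omega
    have hSA : ∀ s ∈ S, ∀ X ∈ upDents r a, s < X := fun s hs X hX => by
      have := hS' s hs
      have := hA X hX
      omega
    have hSB : ∀ s ∈ S, ∀ X ∈ downDents r z a, s < X := fun s hs X hX => by
      have := hS' s hs
      have := hB X hX
      omega
    have dA : Disjoint S (upDents r a) :=
      Finset.disjoint_left.2 fun X hX hX' => (hSA X hX X hX').false
    have dB : Disjoint S (downDents r z a) :=
      Finset.disjoint_left.2 fun X hX hX' => (hSB X hX X hX').false
    have cA : (S ∪ upDents r a).card = k + oddSum a := by
      rw [Finset.card_union_of_disjoint dA, card_upDents, hSk]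
    have cB : (S ∪ downDents r z a).card = k + (evenSum a + z) := by
      rw [Finset.card_union_of_disjoint dB, card_downDents, hSk]
    have eA := weightedTilingNumber_even_height (c := r + L)
      (h := 2 * (y + z + evenSum a + oddSum a - 1)) (D := S ∪ upDents r a)
      (by rw [Int.even_iff]; omega) (even_two_mul _)
      (fun X hX => by
        rw [Int.odd_iff]
        exact (Finset.mem_union.1 hX).elim (fun h => (hS' X h).2.2) (fun h => (hA X h).2.2))
      (fun X hX => (Finset.mem_union.1 hX).elim (fun h => (hS' X h).1)
        (fun h => by have := hA X h; omega))
      (fun X hX => by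
        rw [cA]
        push_cast
        exact (Finset.mem_union.1 hX).elim (fun h => by have := hS' X h; omega)
          (fun h => by have := hA X h; omega))
    have eB := weightedTilingNumber_even_height (c := r + 2 * z + 0) (h := L + 0)
      (D := S ∪ downDents r z a) (by rw [Int.even_iff]; omega) (by rw [Int.even_iff]; omega)
      (fun X hX => by
        rw [Int.odd_iff]
        exact (Finset.mem_union.1 hX).elim (fun h => (hS' X h).2.2) (fun h => (hB X h).2.2))
      (fun X hX => (Finset.mem_union.1 hX).elim (fun h => (hS' X h).1)
        (fun h => by have := hB X h; omega))
      (fun X hX => by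
        rw [cB]
        push_cast
        exact (Finset.mem_union.1 hX).elim (fun h => by have := hS' X h; omega)
          (fun h => by have := hB X h; omega))
    rw [show (2 * ((y : ℤ) + z + evenSum a + oddSum a - 1)) - 2 * ((S ∪ upDents r a).card : ℤ) = L by
      rw [cA]; push_cast; omega] at eA
    rw [show L + 0 - 2 * ((S ∪ downDents r z a).card : ℤ) = 0 by
      rw [cB]; push_cast; omega] at eB
    rw [eA, eB, cA, cB, squareVandermonde_union hSA, squareVandermonde_union hSB,
      Finset.prod_union dA, Finset.prod_union dB, Finset.prod_mul_distrib,
      Finset.prod_pow, Finset.prod_congr rfl fun X hX => columnWeight_of_ne (by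
        have := hS' X hX; omega), Finset.prod_const_one, ← add_assoc (oddSum a), ← hN,
      ← prod_gaps (r := r) (by rw [hr]; push_cast; ring)]
    ring
  rw [Finset.sum_congr rfl hterm, ← Finset.mul_sum, sum_oddPoints (by omega)]
  ring

/-- For even `y` both halves have odd height and the crossing columns are even; the weight 1/2 of a
crossing lozenge in column 0 is what remains as `columnWeight`. -/
theorem RRegion_even {x y z k : ℕ} {a : List ℕ} (ha : ∀ n ∈ a, 0 < n) (hy : y = 2 * k)
    (hO : y = 0 → 0 < oddSum a) :
    weightedTilingNumber (RRegion x y z a) =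
      oddHeightConst (k + oddSum a) * oddHeightConst (k + (evenSum a + z)) *
      (∏ i ∈ Finset.range k,
        (((2 * (x + k) + 2 * (oddSum a + (evenSum a + z)) + 2 * i - 1)! : ℚ) /
        (2 * (x + k - 1 - i))! *
        (2 ^ (2 * (oddSum a + (evenSum a + z)) + 4 * i) *
          (oddSum a + (evenSum a + z) + 2 * i)! * (oddSum a + (evenSum a + z) + 2 * i + 1)! *
          (2 * i)! * (2 * (oddSum a + (evenSum a + z)) + 2 * i)! /
            ((2 * (oddSum a + (evenSum a + z)) + 4 * i)! *
              (2 * (oddSum a + (evenSum a + z)) + 4 * i + 2)!)))) *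
      squareVandermonde (baseDents 1 (upperSeq (x + k) a)) *
      squareVandermonde (baseDents 1 (lowerSeq (x + k) z a)) := by
  have hN := partialSum_length a
  rw [baseDents_upperSeq, baseDents_lowerSeq]
  set r : ℤ := 2 * ((x + k : ℕ) + partialSum a a.length) - 1 with hr
  obtain ⟨L, hL⟩ : ∃ L : ℤ, L = y + 2 * z + 2 * evenSum a - 1 := ⟨_, rfl⟩
  have hP : ∀ X, X ∈ evenPoints (x + k) ↔
      0 ≤ X ∧ X < r - 2 * partialSum a a.length ∧ Odd (X + 1) := by
    intro X
    rw [mem_evenPoints, hr, Int.even_iff, Int.odd_iff]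
    push_cast
    omega
  rw [weightedTilingNumber_RRegion (P := evenPoints (x + k)) (r := r) (L := L) (b := 1) (k := k) ha
    (Or.inr rfl) (by omega) hO (by push_cast at hr; omega) hL hP
    (by rw [card_evenPoints]; omega)]
  have hterm : ∀ S ∈ (evenPoints (x + k)).powersetCard k, (∏ X ∈ S, columnWeight X) *
      weightedTilingNumber (trapezoid (r + L) L (2 * (y + z + evenSum a + oddSum a - 1))
        (S ∪ upDents r a)) *
      weightedTilingNumber (trapezoid (r + 2 * z + 1) 1 (L + 1) (S ∪ downDents r z a)) =
      oddHeightConst (k + oddSum a) * oddHeightConst (k + (evenSum a + z)) *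
      squareVandermonde (upDents r a) * squareVandermonde (downDents r z a) *
      ((∏ s ∈ S, columnWeight s * gapProduct (oddSum a + (evenSum a + z)) (2 * (x + k : ℕ)) s) *
        squareVandermonde S ^ 2) := by
    intro S hS
    obtain ⟨hSP, hSk⟩ := Finset.mem_powersetCard.1 hS
    have hS' : ∀ X ∈ S, 0 ≤ X ∧ X < r - 2 * partialSum a a.length ∧ X % 2 = 0 := fun X hX => by
      have := (hP X).1 (hSP hX)
      rw [Int.odd_iff] at this
      omega
    have hA : ∀ X ∈ upDents r a, r - 2 * partialSum a a.length < X ∧ X < r ∧ X % 2 = 0 := by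
      intro X hX
      have := mem_upDents hX
      rw [Int.odd_iff] at this
      omega
    have hB : ∀ X ∈ downDents r z a,
        r - 2 * partialSum a a.length < X ∧ X < r + 2 * z ∧ X % 2 = 0 := by
      intro X hX
      have := mem_downDents hX
      rw [Int.odd_iff] at this
      omega
    have hSA : ∀ s ∈ S, ∀ X ∈ upDents r a, s < X := fun s hs X hX => by
      have := hS' s hs
      have := hA X hX
      omega
    have hSB : ∀ s ∈ S, ∀ X ∈ downDents r z a, s < X := fun s hs X hX => by
      have := hS' s hs
      have := hB X hX
      omega
    have dA : Disjoint S (upDents r a) :=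
      Finset.disjoint_left.2 fun X hX hX' => (hSA X hX X hX').false
    have dB : Disjoint S (downDents r z a) :=
      Finset.disjoint_left.2 fun X hX hX' => (hSB X hX X hX').false
    have cA : (S ∪ upDents r a).card = k + oddSum a := by
      rw [Finset.card_union_of_disjoint dA, card_upDents, hSk]
    have cB : (S ∪ downDents r z a).card = k + (evenSum a + z) := by
      rw [Finset.card_union_of_disjoint dB, card_downDents, hSk]
    have eA := weightedTilingNumber_odd_height (c := r + L)
      (h := 2 * (y + z + evenSum a + oddSum a - 1)) (D := S ∪ upDents r a)
      (by rw [Int.even_iff]; omega) (even_two_mul _)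
      (fun X hX => by
        rw [Int.even_iff]
        exact (Finset.mem_union.1 hX).elim (fun h => (hS' X h).2.2) (fun h => (hA X h).2.2))
      (fun X hX => (Finset.mem_union.1 hX).elim (fun h => (hS' X h).1)
        (fun h => by have := hA X h; omega))
      (fun X hX => by
        rw [cA]
        push_cast
        exact (Finset.mem_union.1 hX).elim (fun h => by have := hS' X h; omega)
          (fun h => by have := hA X h; omega))
    have eB := weightedTilingNumber_odd_height (c := r + 2 * z + 1) (h := L + 1)
      (D := S ∪ downDents r z a) (by rw [Int.even_iff]; omega) (by rw [Int.even_iff]; omega)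
      (fun X hX => by
        rw [Int.even_iff]
        exact (Finset.mem_union.1 hX).elim (fun h => (hS' X h).2.2) (fun h => (hB X h).2.2))
      (fun X hX => (Finset.mem_union.1 hX).elim (fun h => (hS' X h).1)
        (fun h => by have := hB X h; omega))
      (fun X hX => by
        rw [cB]
        push_cast
        exact (Finset.mem_union.1 hX).elim (fun h => by have := hS' X h; omega)
          (fun h => by have := hB X h; omega))
    rw [show (2 * ((y : ℤ) + z + evenSum a + oddSum a - 1)) -
        2 * ((S ∪ upDents r a).card : ℤ) + 1 = L by rw [cA]; push_cast; omega] at eA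
    rw [show L + 1 - 2 * ((S ∪ downDents r z a).card : ℤ) + 1 = 1 by
      rw [cB]; push_cast; omega] at eB
    rw [eA, eB, cA, cB, squareVandermonde_union hSA, squareVandermonde_union hSB,
      Finset.prod_mul_distrib, ← add_assoc (oddSum a), ← hN,
      ← prod_gaps (r := r) (by rw [hr]; push_cast; ring)]
    ring
  rw [Finset.sum_congr rfl hterm, ← Finset.mul_sum, sum_evenPoints (by omega)]
  ring

/-! ### The main theorem: matching the constants -/

theorem mainTheorem2 (x y z : ℕ) (a : List ℕ) (ha : ∀ k ∈ a, 0 < k)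
    (hy : seqTerm a 1 + 1 ≤ y + 2 * oddSum a) :
    (Odd y →
      weightedTilingNumber (RRegion x y z a) =
        (∏ i ∈ Finset.Icc 1 ((y - 1) / 2),
          ((2 * x + 2 * i - 1).ascFactorial
            (2 * partialSum a a.length + 2 * y + 2 * z - 4 * i + 1) : ℚ)) *
        (1 / 2 ^ (y - 1)) *
        ((hyperFac (partialSum a a.length + y + z - 1) * hyperFac₂ y *
            hyperFac₂ (2 * evenSum a + 2 * z + 1) * hyperFac₂ (2 * oddSum a + 1) *
            hyperFac₂ (2 * partialSum a a.length + y + 2 * z)) /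
          (hyperFac (partialSum a a.length + z) * hyperFac₂ (2 * evenSum a + y + 2 * z) *
            hyperFac₂ (2 * oddSum a + y) *
            hyperFac₂ (2 * partialSum a a.length + 2 * y + 2 * z - 1))) *
        QWeighted (upperSeq (x + (y - 1) / 2) a) * QWeighted (lowerSeq (x + (y - 1) / 2) z a)) ∧
    (Even y →
      weightedTilingNumber (RRegion x y z a) =
        (∏ i ∈ Finset.Icc 1 (y / 2),
          ((2 * x + 2 * i - 1).ascFactorial
            (2 * partialSum a a.length + 2 * y + 2 * z - 4 * i + 1) : ℚ)) *
        ((hyperFac (partialSum a a.length + y + z) * hyperFac₂ y *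
            hyperFac₂ (2 * evenSum a + 2 * z) * hyperFac₂ (2 * oddSum a) *
            hyperFac₂ (2 * partialSum a a.length + y + 2 * z)) /
          (hyperFac (partialSum a a.length + z) * hyperFac₂ (2 * evenSum a + y + 2 * z) *
            hyperFac₂ (2 * oddSum a + y) *
            hyperFac₂ (2 * partialSum a a.length + 2 * y + 2 * z))) *
        KWeighted (upperSeq (x + y / 2) a) * KWeighted (lowerSeq (x + y / 2) z a)) := by
  have hN := partialSum_length a
  constructor
  · rintro ⟨k, rfl⟩
    have hk : (2 * k + 1 - 1) / 2 = k := by omega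
    -- The constants are compared with `p = oddSum a` and `q = evenSum a + z`, the numbers of dents
    -- of the two factors Q'.
    rw [hk, RRegion_odd ha rfl, odd_constant, QWeighted_eq, QWeighted_eq]
    rw [show (baseDents 0 (upperSeq (x + k) a)).card = oddSum a by
        rw [baseDents_upperSeq, card_upDents],
      show (baseDents 0 (lowerSeq (x + k) z a)).card = evenSum a + z by
        rw [baseDents_lowerSeq, card_downDents], hN,
      show 2 * k + 1 - 1 = 2 * k by omega,
      show oddSum a + evenSum a + (2 * k + 1) + z - 1 = oddSum a + (evenSum a + z) + 2 * k by omega,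
      show 2 * evenSum a + 2 * z + 1 = 2 * (evenSum a + z) + 1 by omega,
      show 2 * (oddSum a + evenSum a) + (2 * k + 1) + 2 * z =
        2 * (oddSum a + (evenSum a + z) + k) + 1 by omega,
      show oddSum a + evenSum a + z = oddSum a + (evenSum a + z) by omega,
      show 2 * evenSum a + (2 * k + 1) + 2 * z = 2 * (evenSum a + z + k) + 1 by omega,
      show 2 * oddSum a + (2 * k + 1) = 2 * (oddSum a + k) + 1 by omega,
      show 2 * (oddSum a + evenSum a) + 2 * (2 * k + 1) + 2 * z - 1 =
        2 * (oddSum a + (evenSum a + z) + 2 * k) + 1 by omega,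
      show 2 * (oddSum a + evenSum a) + 2 * (2 * k + 1) + 2 * z =
        2 * (oddSum a + (evenSum a + z)) + 2 + 4 * k by omega]
    ring
  · intro he
    obtain ⟨k, rfl⟩ := he.exists_two_nsmul
    rw [smul_eq_mul] at *
    have hk : 2 * k / 2 = k := by omega
    -- For `y = 0` the hypothesis `hy` yields `0 < oddSum a`, which keeps level `L` from lying above
    -- the region.
    rw [hk, RRegion_even ha rfl (by omega), even_constant, KWeighted_eq, KWeighted_eq]
    rw [show (baseDents 1 (upperSeq (x + k) a)).card = oddSum a by
        rw [baseDents_upperSeq, card_upDents],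
      show (baseDents 1 (lowerSeq (x + k) z a)).card = evenSum a + z by
        rw [baseDents_lowerSeq, card_downDents], hN,
      show oddSum a + evenSum a + 2 * k + z = oddSum a + (evenSum a + z) + 2 * k by omega,
      show 2 * evenSum a + 2 * z = 2 * (evenSum a + z) by omega,
      show 2 * (oddSum a + evenSum a) + 2 * k + 2 * z =
        2 * (oddSum a + (evenSum a + z) + k) by omega,
      show oddSum a + evenSum a + z = oddSum a + (evenSum a + z) by omega,
      show 2 * evenSum a + 2 * k + 2 * z = 2 * (evenSum a + z + k) by omega,
      show 2 * oddSum a + 2 * k = 2 * (oddSum a + k) by omega,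
      show 2 * (oddSum a + evenSum a) + 2 * (2 * k) + 2 * z =
        2 * (oddSum a + (evenSum a + z) + 2 * k) by omega,
      Finset.prod_congr rfl fun i _ => by
        rw [show 2 * (oddSum a + (evenSum a + z)) + 4 * k =
          2 * (oddSum a + (evenSum a + z) + 2 * k) by omega]]
    ring
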